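/- Let $\ell\ge 0$ and let $Q=\bigoplus_{i=1}^{\ell}\mathbb Z v_i$ with $(v_i|v_j)=\delta_{ij}$, $Q_0=\{\sum_i j_iv_i : \sum_i j_i=0\}$, and let $\varepsilon:Q\times Q\to\{\pm1\}$ be the bimultiplicative function with $\varepsilon(v_i,v_j)=1$ for $i<j$ and $\varepsilon(v_i,v_j)=-1$ for $i\ge j$. Let $\mathbf x=(x^{(i)}_k)_{1\le i\le\ell,\,k\ge1}$ be variables, $\xi(\mathbf x^{(i)},z)=\sum_{k\ge1}x^{(i)}_kz^k$, $[z^{-1}]=(\tfrac1z,\tfrac1{2z^2},\tfrac1{3z^3},\dots)$, and let $\mathbf x\pm[z^{-1}]^{(k)}$ be obtained from $\mathbf x$ by replacing $\mathbf x^{(k)}$ by $\mathbf x^{(k)}\pm[z^{-1}]$. Let $\operatorname{Res}_z$ denote the coefficient of $z^{-1}$. Let $(\tau_\alpha)_{\alpha\in Q_0}$ be any family of formal power series in $\mathbb C[[\mathbf x]]$. The affine bilinear equations are $$\sum_{k=1}^{\ell}\varepsilon(v_k,\alpha-\beta+v_i+v_j)\operatorname{Res}_z\Big(z^{(v_k|\alpha-\beta)+m-2+\delta_{ik}+\delta_{jk}}e^{\xi(\mathbf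 x^{(k)}-\mathbf x'^{(k)},z)}\,\tau_{\alpha+v_i-v_k}(\mathbf x-[z^{-1}]^{(k)})\,\tau_{\beta-v_j+v_k}(\mathbf x'+[z^{-1}]^{(k)})\Big)=0\qquad(1)$$ for all $m\in\mathbb Z_{\ge0}$, $\alpha,\beta\in Q_0$, $1\le i,j\le\ell$. Let $\partial=\sum_{i}\partial/\partial x^{(i)}_1$. For $\tau_\alpha\ne0$ define the $\ell\times\ell$ matrix pseudo-differential operator $P_\alpha=\sum_{n\ge0}P_{\alpha,n}\partial^{-n}$, with coefficients in the field of fractions of $\mathbb C[[\mathbf x]]$, by $$(P_{\alpha,n})_{ij}=-\varepsilon(v_j,v_i)\operatorname{Res}_z\frac{z^{n+\delta_{ij}-2}\,\tau_{\alpha+v_i-v_j}(\mathbf x-[z^{-1}]^{(j)})}{\tau_\alpha(\mathbf x)} .$$ Let ${}^*$ denote the formal adjoint, $(A\partial^n)^*=(-\partial)^nA^T$; let $(\cdot)_-$ and $(\cdot)_+$ denote the parts with negative and with nonnegative powers of $\partial$; let $\Xi(\mathbf x,z)=\operatorname{diag}(\xi(\mathbf x^{(1)},z),\dots,\xi(\mathbf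 x^{(\ell)},z))$ and $\Lambda_\alpha(z)=\operatorname{diag}(\varepsilon(v_1,\alpha)z^{(v_1|\alpha)},\dots,\varepsilon(v_\ell,\alpha)z^{(v_\ell|\alpha)})$; put $\partial^n e^{\pm\xi(\mathbf x^{(i)},z)}=(\pm z)^ne^{\pm\xi(\mathbf x^{(i)},z)}$ for all $n\in\mathbb Z$. Two-point identities are understood as identities of formal power series in $\mathbf y=\mathbf x'-\mathbf x$ obtained by Taylor expansion at a generic point $\mathbf x$. Then: 1. For $\tau_\alpha\neq0$ the operators $P_\alpha$ and $P_\alpha^*$ are invertible. 2. The bilinear equations (1) hold (for all $m,\alpha,\beta,i,j$) if and only if $$\operatorname{Res}_z\Big(z^m\big(P_\alpha e^{\Xi(\mathbf x,z)}\big)\,\Lambda_{\alpha-\beta}(z)\,\big((P_\beta^*)^{-1}e^{-\Xi(\mathbf x,z)}\big)^T\Big|_{\mathbf x\mapsto\mathbf x'}\Big)=0$$ for all $m\in\mathbb Z_{\ge0}$ and all $\alpha,\beta\in Q_0$ with $\tau_\alpha\ne0$ and $\tau_\beta\neq0$. 3. If (1) holds, then for every $\alpha\in Q_0$ with $\tau_\alpha\ne0$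 and all $1\le i\le\ell$, $k\ge1$, $$(P_\alpha\,\partial\,P_\alpha^{-1})_-=0,\qquad \frac{\partial P_\alpha}{\partial x^{(i)}_k}=-\big(P_\alpha E_{ii}\partial^kP_\alpha^{-1}\big)_-P_\alpha .$$ These give the Lax equations of the $(1,\dots,1)$-reduction of the $\ell$-component KP hierarchy: with $L=P_\alpha\partial P_\alpha^{-1}$, $C_j=P_\alpha E_{jj}P_\alpha^{-1}$ and $B_{i,k}=(L^kC_i)_+$ one has $L_-=0$ and $$\frac{\partial L}{\partial x^{(i)}_k}=[B_{i,k},L],\qquad \frac{\partial C_j}{\partial x^{(i)}_k}=[B_{i,k},C_j]\qquad(1\le i,j\le\ell,\ k\ge1).$$ -/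

import Mathlib

noncomputable section

/-- A scalar pseudo-differential operator `∑_{n ≤ N} aₙ ∂ⁿ` with coefficients in a commutative
ring `R`, where `∂` acts on `R` through the derivation `D`. -/
@[ext]
structure PDO {R : Type*} [CommRing R] [Algebra ℂ R] (D : Derivation ℂ R R) where
  /-- `coeff n` is the coefficient of `∂ⁿ`. -/
  coeff : ℤ → R
  bdd : ∃ N : ℤ, ∀ n, N < n → coeff n = 0

namespace PDO

variable {R : Type*} [CommRing R] [Algebra ℂ R] {D : Derivation ℂ R R}

/-- The operator `a ∂ⁿ`. -/
def monomial (D : Derivation ℂ R R) (a : R) (n : ℤ) : PDO D where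
  coeff i := if i = n then a else 0
  bdd := ⟨n, fun i hi => if_neg (by omega)⟩

instance : Zero (PDO D) := ⟨⟨0, 0, fun _ _ => rfl⟩⟩
instance : One (PDO D) := ⟨monomial D 1 0⟩

instance : Add (PDO D) :=
  ⟨fun P Q => ⟨fun n => P.coeff n + Q.coeff n, by
    obtain ⟨A, hA⟩ := P.bdd
    obtain ⟨B, hB⟩ := Q.bdd
    exact ⟨max A B, fun n hn => by
      rw [hA n (lt_of_le_of_lt (le_max_left _ _) hn),
        hB n (lt_of_le_of_lt (le_max_right _ _) hn), add_zero]⟩⟩⟩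

instance : Neg (PDO D) :=
  ⟨fun P => ⟨fun n => -P.coeff n, by
    obtain ⟨A, hA⟩ := P.bdd
    exact ⟨A, fun n hn => by rw [hA n hn, neg_zero]⟩⟩⟩

/-- The coefficient of `∂ⁿ` in `P ∘ Q`, according to the rule
`a ∂ⁱ ∘ b ∂ʲ = ∑_{p ≥ 0} (i choose p) a Dᵖ(b) ∂^{i+j-p}` (so `j = n + p - i`).
Only finitely many terms are nonzero. -/
def mulCoeff (P Q : PDO D) (n : ℤ) : R :=
  ∑ᶠ x : ℤ × ℕ, Ring.choose x.1 x.2 • (P.coeff x.1 * D^[x.2] (Q.coeff (n + x.2 - x.1)))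

lemma mulCoeff_eq (P Q : PDO D) {A B : ℤ} (hA : ∀ n, A < n → P.coeff n = 0)
    (hB : ∀ n, B < n → Q.coeff n = 0) (n L : ℤ) (M : ℕ) (hL : L ≤ n - B)
    (hM : A + B - n < M) :
    mulCoeff P Q n = ∑ i ∈ Finset.Icc L A, ∑ p ∈ Finset.range M,
      Ring.choose i p • (P.coeff i * D^[p] (Q.coeff (n + p - i))) := by
  rw [← Finset.sum_product', mulCoeff]
  apply finsum_eq_sum_of_support_subset
  intro x hx
  have h1 : x.1 ≤ A := by
    by_contra h
    apply hx
    simp [hA x.1 (by omega)]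
  have h2 : n + x.2 - x.1 ≤ B := by
    by_contra h
    apply hx
    simp only [hB (n + x.2 - x.1) (by omega), iterate_map_zero, mul_zero, smul_zero]
  simp only [Finset.coe_product, Set.mem_prod, Finset.mem_coe, Finset.mem_Icc, Finset.mem_range]
  omega

instance : Mul (PDO D) :=
  ⟨fun P Q => ⟨mulCoeff P Q, by
    obtain ⟨A, hA⟩ := P.bdd
    obtain ⟨B, hB⟩ := Q.bdd
    refine ⟨A + B, fun n hn => ?_⟩
    rw [mulCoeff_eq P Q hA hB n (n - B) 0 le_rfl (by push_cast; omega)]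
    simp⟩⟩

@[simp] lemma coeff_zero (n : ℤ) : (0 : PDO D).coeff n = 0 := rfl
@[simp] lemma coeff_add (P Q : PDO D) (n : ℤ) : (P + Q).coeff n = P.coeff n + Q.coeff n := rfl
@[simp] lemma coeff_neg (P : PDO D) (n : ℤ) : (-P).coeff n = -P.coeff n := rfl
lemma coeff_one (n : ℤ) : (1 : PDO D).coeff n = if n = 0 then 1 else 0 := rfl
lemma coeff_mul (P Q : PDO D) (n : ℤ) : (P * Q).coeff n = mulCoeff P Q n := rfl

lemma coeff_mul_eq (P Q : PDO D) {A B : ℤ} (hA : ∀ n, A < n → P.coeff n = 0)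
    (hB : ∀ n, B < n → Q.coeff n = 0) (n L : ℤ) (M : ℕ) (hL : L ≤ n - B)
    (hM : A + B - n < M) :
    (P * Q).coeff n = ∑ i ∈ Finset.Icc L A, ∑ p ∈ Finset.range M,
      Ring.choose i p • (P.coeff i * D^[p] (Q.coeff (n + p - i))) :=
  mulCoeff_eq P Q hA hB n L M hL hM

lemma coeff_mul_vanish (P Q : PDO D) {A B : ℤ} (hA : ∀ n, A < n → P.coeff n = 0)
    (hB : ∀ n, B < n → Q.coeff n = 0) (n : ℤ) (hn : A + B < n) : (P * Q).coeff n = 0 := by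
  rw [coeff_mul_eq P Q hA hB n (n - B) 0 le_rfl (by push_cast; omega)]
  simp

lemma iterate_sum {ι : Type*} (p : ℕ) (s : Finset ι) (f : ι → R) :
    D^[p] (∑ i ∈ s, f i) = ∑ i ∈ s, D^[p] (f i) := by
  induction p with
  | zero => rfl
  | succ p ih => simp only [Function.iterate_succ_apply', ih, map_sum]

lemma iterate_zsmul (p : ℕ) (c : ℤ) (f : R) : D^[p] (c • f) = c • D^[p] f := by
  induction p with
  | zero => rfl
  | succ p ih => simp only [Function.iterate_succ_apply', ih, map_zsmul]

lemma iterate_add (p : ℕ) (f g : R) : D^[p] (f + g) = D^[p] f + D^[p] g := by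
  induction p with
  | zero => rfl
  | succ p ih => simp only [Function.iterate_succ_apply', ih, map_add]

lemma iterate_mul (p : ℕ) (f g : R) :
    D^[p] (f * g) = ∑ x ∈ Finset.HasAntidiagonal.antidiagonal p, p.choose x.1 • (D^[x.1] f * D^[x.2] g) := by
  induction p with
  | zero => simp
  | succ p ih =>
    rw [Finset.sum_antidiagonal_choose_succ_nsmul (M := R) (fun i j => D^[i] f * D^[j] g) p,
      Function.iterate_succ_apply', ih, map_sum, ← Finset.sum_add_distrib]
    refine Finset.sum_congr rfl fun x hx => ?_
    rw [map_nsmul, Derivation.leibniz,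
      ← Nat.choose_symm_of_eq_add (Finset.HasAntidiagonal.mem_antidiagonal.1 hx).symm, ← smul_add]
    simp only [Function.iterate_succ_apply', smul_eq_mul]
    congr 1
    ring

lemma iterate_one (p : ℕ) (hp : p ≠ 0) : D^[p] (1 : R) = 0 := by
  obtain ⟨q, rfl⟩ := Nat.exists_eq_succ_of_ne_zero hp
  rw [Function.iterate_succ_apply, Derivation.map_one_eq_zero, iterate_map_zero]

lemma sum_antidiagonal_box {X : Type*} [AddCommMonoid X] (M : ℕ) (f : ℕ → ℕ → X) (hf : ∀ a b, M ≤ a + b → f a b = 0) :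
    ∑ p ∈ Finset.range M, ∑ x ∈ Finset.HasAntidiagonal.antidiagonal p, f x.1 x.2 =
      ∑ a ∈ Finset.range M, ∑ b ∈ Finset.range M, f a b := by
  rw [← Finset.sum_product', Finset.sum_sigma']
  refine Finset.sum_of_injOn (fun x => x.2) ?_ ?_ ?_ ?_
  · rintro ⟨p, a, b⟩ h ⟨p', a', b'⟩ h' e
    simp only [Finset.coe_sigma, Set.mem_sigma_iff, Finset.mem_coe, Finset.mem_range,
      Finset.HasAntidiagonal.mem_antidiagonal] at h h'
    simp only [Prod.mk.injEq] at e
    obtain ⟨rfl, rfl⟩ := e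
    obtain ⟨-, rfl⟩ := h
    obtain ⟨-, rfl⟩ := h'
    rfl
  · rintro ⟨p, a, b⟩ h
    simp only [Finset.coe_sigma, Set.mem_sigma_iff, Finset.mem_coe, Finset.mem_range,
      Finset.HasAntidiagonal.mem_antidiagonal] at h
    simp only [Finset.coe_product, Set.mem_prod, Finset.mem_coe, Finset.mem_range]
    omega
  · rintro ⟨a, b⟩ _ h
    apply hf
    by_contra hlt
    apply h
    exact ⟨⟨a + b, a, b⟩, by simpa using hlt, rfl⟩
  · intros
    rfl

lemma sum_window {X : Type*} [AddCommMonoid X] (L L' B B' t : ℤ) (f : ℤ → X) (h : ∀ j, f j ≠ 0 → L ≤ j ∧ j ≤ B)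
    (h' : ∀ j, f j ≠ 0 → L' ≤ j + t ∧ j + t ≤ B') :
    ∑ m ∈ Finset.Icc L' B', f (m - t) = ∑ j ∈ Finset.Icc L B, f j := by
  rw [← finsum_eq_sum_of_support_subset f (s := Finset.Icc L B),
    ← finsum_eq_sum_of_support_subset (fun m => f (m - t)) (s := Finset.Icc L' B')]
  · exact finsum_comp_equiv (Equiv.subRight t)
  · intro m hm
    have := h' _ hm
    simp only [Finset.coe_Icc, Set.mem_Icc]
    omega
  · intro j hj
    simpa using h j hj

protected lemma mul_assoc (P Q S : PDO D) : P * Q * S = P * (Q * S) := by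
  obtain ⟨A, hA⟩ := P.bdd
  obtain ⟨B, hB⟩ := Q.bdd
  obtain ⟨C, hC⟩ := S.bdd
  ext n
  set M : ℕ := (A + B + C - n + 1).toNat with hMdef
  have hM : A + B + C - n < M := by omega
  -- the common form of both sides
  let G : ℤ → ℤ → ℕ → ℕ → ℕ → R := fun i j r w q =>
    (Ring.choose i r * (Ring.choose (i - r) w * Ring.choose j q)) •
      (P.coeff i * (D^[r] (Q.coeff j) * D^[w + q] (S.coeff (n + r + (w + q : ℕ) - i - j))))
  have hG : ∀ i j r w q, i ≤ A → j ≤ B → M ≤ r + w + q → G i j r w q = 0 := by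
    intro i j r w q hi hj h
    have : S.coeff (n + r + (w + q : ℕ) - i - j) = 0 := hC _ (by push_cast; omega)
    simp only [G, this, iterate_map_zero, mul_zero, smul_zero]
  trans ∑ i ∈ Finset.Icc (n - B - C) A, ∑ j ∈ Finset.Icc (n - A - C) B,
      ∑ r ∈ Finset.range M, ∑ w ∈ Finset.range M, ∑ q ∈ Finset.range M, G i j r w q
  · rw [coeff_mul_eq (P * Q) S (coeff_mul_vanish P Q hA hB) hC n (n - C) M le_rfl (by omega)]
    have e1 : ∀ m ∈ Finset.Icc (n - C) (A + B), (P * Q).coeff m =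
        ∑ i ∈ Finset.Icc (n - B - C) A, ∑ r ∈ Finset.range M,
          Ring.choose i r • (P.coeff i * D^[r] (Q.coeff (m + r - i))) := by
      intro m hm
      rw [Finset.mem_Icc] at hm
      exact coeff_mul_eq P Q hA hB m _ M (by omega) (by omega)
    rw [Finset.sum_congr rfl fun m hm => by rw [e1 m hm]]
    simp only [Finset.sum_mul, Finset.smul_sum]
    rw [Finset.sum_congr rfl fun m _ => Finset.sum_comm, Finset.sum_comm]
    refine Finset.sum_congr rfl fun i hi => ?_
    rw [Finset.mem_Icc] at hi
    rw [Finset.sum_congr rfl fun m _ => Finset.sum_comm, Finset.sum_comm]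
    conv_rhs => rw [Finset.sum_comm]
    refine Finset.sum_congr rfl fun r hr => ?_
    rw [Finset.sum_comm]
    have e2 : ∀ s ∈ Finset.range M, ∑ m ∈ Finset.Icc (n - C) (A + B),
        Ring.choose m s • (Ring.choose i r • (P.coeff i * D^[r] (Q.coeff (m + r - i))) *
          D^[s] (S.coeff (n + s - m))) =
        ∑ j ∈ Finset.Icc (n - A - C) B, ∑ x ∈ Finset.HasAntidiagonal.antidiagonal s, G i j r x.1 x.2 := by
      intro s _
      rw [← sum_window (n - A - C) (n - C) B (A + B) (i - r)]
      · refine Finset.sum_congr rfl fun m _ => ?_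
        have e3 : ∀ x ∈ Finset.HasAntidiagonal.antidiagonal s, G i (m - (i - r)) r x.1 x.2 =
            (Ring.choose (i - r) x.1 * Ring.choose (m - (i - r)) x.2) •
            (Ring.choose i r • (P.coeff i * (D^[r] (Q.coeff (m + r - i)) *
              D^[s] (S.coeff (n + s - m))))) := by
          intro x hx
          rw [Finset.HasAntidiagonal.mem_antidiagonal] at hx
          simp only [G, hx, smul_smul]
          rw [show m - (i - r) = m + r - i by ring,
            show n + r + (s : ℤ) - i - (m + r - i) = n + s - m by ring]
          congr 1
          ring
        rw [Finset.sum_congr rfl e3, ← Finset.sum_smul,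
          ← Ring.add_choose_eq s (Commute.all (i - (r : ℤ)) (m - (i - r))),
          show (i : ℤ) - r + (m - (i - r)) = m by ring, smul_mul_assoc, mul_assoc]
      · intro j hj
        obtain ⟨x, hx, hx'⟩ := Finset.exists_ne_zero_of_sum_ne_zero hj
        rw [Finset.HasAntidiagonal.mem_antidiagonal] at hx
        constructor
        · by_contra hlt
          apply hx'
          have : S.coeff (n + r + (x.1 + x.2 : ℕ) - i - j) = 0 := hC _ (by push_cast; omega)
          simp only [G, this, iterate_map_zero, mul_zero, smul_zero]
        · by_contra hlt
          apply hx'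
          have : Q.coeff j = 0 := hB _ (by omega)
          simp only [G, this, iterate_map_zero, zero_mul, mul_zero, smul_zero]
      · intro j hj
        obtain ⟨x, hx, hx'⟩ := Finset.exists_ne_zero_of_sum_ne_zero hj
        rw [Finset.HasAntidiagonal.mem_antidiagonal] at hx
        constructor
        · by_contra hlt
          apply hx'
          have : S.coeff (n + r + (x.1 + x.2 : ℕ) - i - j) = 0 := hC _ (by push_cast; omega)
          simp only [G, this, iterate_map_zero, mul_zero, smul_zero]
        · by_contra hlt
          apply hx'
          have : Q.coeff j = 0 := hB _ (by omega)
          simp only [G, this, iterate_map_zero, zero_mul, mul_zero, smul_zero]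
    rw [Finset.sum_congr rfl e2, Finset.sum_comm]
    refine Finset.sum_congr rfl fun j hj => ?_
    rw [Finset.mem_Icc] at hj
    exact sum_antidiagonal_box M _ fun a b hab => hG i j r a b hi.2 hj.2 (by omega)
  · symm
    rw [coeff_mul_eq P (Q * S) hA (coeff_mul_vanish Q S hB hC) n (n - B - C) M (by omega)
      (by omega)]
    refine Finset.sum_congr rfl fun i hi => ?_
    rw [Finset.mem_Icc] at hi
    have e1 : ∀ p ∈ Finset.range M, Ring.choose i p •
        (P.coeff i * D^[p] ((Q * S).coeff (n + p - i))) =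
        ∑ j ∈ Finset.Icc (n - A - C) B, ∑ q ∈ Finset.range M,
          ∑ x ∈ Finset.HasAntidiagonal.antidiagonal p, G i j x.1 x.2 q := by
      intro p _
      rw [coeff_mul_eq Q S hB hC (n + p - i) (n - A - C) M (by omega) (by omega), iterate_sum,
        Finset.mul_sum, Finset.smul_sum]
      refine Finset.sum_congr rfl fun j _ => ?_
      rw [iterate_sum, Finset.mul_sum, Finset.smul_sum]
      refine Finset.sum_congr rfl fun q _ => ?_
      rw [iterate_zsmul, iterate_mul, Finset.smul_sum, Finset.mul_sum, Finset.smul_sum]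
      refine Finset.sum_congr rfl fun x hx => ?_
      rw [Finset.HasAntidiagonal.mem_antidiagonal] at hx
      have e2 : Ring.choose i x.1 * Ring.choose (i - x.1) x.2 =
          (p.choose x.1 : ℤ) * Ring.choose i p := by
        have := Ring.choose_smul_choose i (n := p) (k := x.1) (by omega)
        rw [nsmul_eq_mul, show p - x.1 = x.2 by omega] at this
        exact this.symm
      simp only [G]
      rw [← mul_assoc (Ring.choose i x.1), e2, ← Function.iterate_add_apply,
        show n + (p : ℤ) - i + q - j = n + x.1 + (x.2 + q : ℕ) - i - j by push_cast; omega,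
        ← natCast_zsmul]
      simp only [smul_smul, mul_smul_comm]
      congr 1
      ring
    rw [Finset.sum_congr rfl e1, Finset.sum_comm]
    refine Finset.sum_congr rfl fun j hj => ?_
    rw [Finset.mem_Icc] at hj
    rw [Finset.sum_comm]
    rw [Finset.sum_congr rfl fun q _ => sum_antidiagonal_box M (fun r w => G i j r w q)
      fun r w h => hG i j r w q hi.2 hj.2 (by omega), Finset.sum_comm]
    exact Finset.sum_congr rfl fun r _ => Finset.sum_comm

instance : AddCommGroup (PDO D) where
  add_assoc P Q S := by ext n; simp [add_assoc]
  zero_add P := by ext n; simp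
  add_zero P := by ext n; simp
  neg_add_cancel P := by ext n; simp
  add_comm P Q := by ext n; simp [add_comm]
  nsmul := nsmulRec
  zsmul := zsmulRec

protected lemma left_distrib (P Q S : PDO D) : P * (Q + S) = P * Q + P * S := by
  obtain ⟨A, hA⟩ := P.bdd
  obtain ⟨B, hB⟩ := Q.bdd
  obtain ⟨C, hC⟩ := S.bdd
  have hB' : ∀ n, max B C < n → Q.coeff n = 0 := fun n hn => hB n (by omega)
  have hC' : ∀ n, max B C < n → S.coeff n = 0 := fun n hn => hC n (by omega)
  have hBC : ∀ n, max B C < n → (Q + S).coeff n = 0 := fun n hn => by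
    rw [coeff_add, hB' n hn, hC' n hn, add_zero]
  ext n
  have hM : A + max B C - n < ((A + max B C - n + 1).toNat : ℤ) := by omega
  rw [coeff_add, coeff_mul_eq P Q hA hB' n _ _ le_rfl hM, coeff_mul_eq P S hA hC' n _ _ le_rfl hM,
    coeff_mul_eq P (Q + S) hA hBC n _ _ le_rfl hM]
  simp only [coeff_add, iterate_add, mul_add, smul_add, Finset.sum_add_distrib]

protected lemma right_distrib (P Q S : PDO D) : (P + Q) * S = P * S + Q * S := by
  obtain ⟨A, hA⟩ := P.bdd
  obtain ⟨B, hB⟩ := Q.bdd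
  obtain ⟨C, hC⟩ := S.bdd
  have hA' : ∀ n, max A B < n → P.coeff n = 0 := fun n hn => hA n (by omega)
  have hB' : ∀ n, max A B < n → Q.coeff n = 0 := fun n hn => hB n (by omega)
  have hAB : ∀ n, max A B < n → (P + Q).coeff n = 0 := fun n hn => by
    rw [coeff_add, hA' n hn, hB' n hn, add_zero]
  ext n
  have hM : max A B + C - n < ((max A B + C - n + 1).toNat : ℤ) := by omega
  rw [coeff_add, coeff_mul_eq P S hA' hC n _ _ le_rfl hM, coeff_mul_eq Q S hB' hC n _ _ le_rfl hM,
    coeff_mul_eq (P + Q) S hAB hC n _ _ le_rfl hM]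
  simp only [coeff_add, add_mul, smul_add, Finset.sum_add_distrib]

protected lemma one_mul (P : PDO D) : 1 * P = P := by
  ext n
  rw [coeff_mul, mulCoeff, finsum_eq_single _ ((0 : ℤ), 0)]
  · simp [coeff_one]
  · rintro ⟨i, p⟩ h
    by_cases hi : i = 0
    · subst hi
      have hp : 0 < p := Nat.pos_of_ne_zero fun h0 => h (by rw [h0])
      simp [Ring.choose_zero_pos ℤ hp]
    · simp [coeff_one, hi]

protected lemma mul_one (P : PDO D) : P * 1 = P := by
  ext n
  rw [coeff_mul, mulCoeff, finsum_eq_single _ (n, 0)]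
  · simp [coeff_one]
  · rintro ⟨i, p⟩ h
    by_cases hp : p = 0
    · subst hp
      have hi : n - i ≠ 0 := fun h0 => h (by rw [show i = n by omega])
      simp [coeff_one, hi]
    · by_cases hi : n + p - i = 0
      · simp [coeff_one, hi, iterate_one p hp]
      · simp [coeff_one, hi]

protected lemma zero_mul (P : PDO D) : 0 * P = 0 := by
  have := PDO.right_distrib 0 0 P
  rwa [add_zero, left_eq_add] at this

protected lemma mul_zero (P : PDO D) : P * 0 = 0 := by
  have := PDO.left_distrib P 0 0
  rwa [add_zero, left_eq_add] at this

/-- Pseudo-differential operators form an associative ring under composition. -/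
instance : Ring (PDO D) :=
  { (inferInstance : AddCommGroup (PDO D)), (inferInstance : Mul (PDO D)),
    (inferInstance : One (PDO D)) with
    left_distrib := PDO.left_distrib
    right_distrib := PDO.right_distrib
    zero_mul := PDO.zero_mul
    mul_zero := PDO.mul_zero
    mul_assoc := PDO.mul_assoc
    one_mul := PDO.one_mul
    mul_one := PDO.mul_one }

/-- The operator `∑_{n ≥ 0} cₙ ∂⁻ⁿ`. -/
def ofNonpos (D : Derivation ℂ R R) (c : ℕ → R) : PDO D where
  coeff m := if m ≤ 0 then c (-m).toNat else 0
  bdd := ⟨0, fun m hm => if_neg (by omega)⟩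

/-- The part of `P` with negative powers of `∂`. -/
def negPart (P : PDO D) : PDO D where
  coeff n := if n < 0 then P.coeff n else 0
  bdd := ⟨0, fun n hn => if_neg (by omega)⟩

/-- The part of `P` with nonnegative powers of `∂`. -/
def posPart (P : PDO D) : PDO D where
  coeff n := if 0 ≤ n then P.coeff n else 0
  bdd := by
    obtain ⟨A, hA⟩ := P.bdd
    exact ⟨A, fun n hn => by rw [hA n hn, ite_self]⟩

/-- A derivation `δ` of the coefficient ring applied to the coefficients of `P`. -/
def deriveCoeffs (δ : Derivation ℂ R R) (P : PDO D) : PDO D where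
  coeff n := δ (P.coeff n)
  bdd := by
    obtain ⟨A, hA⟩ := P.bdd
    exact ⟨A, fun n hn => by rw [hA n hn, map_zero]⟩

/-- The formal adjoint `(∑ aₙ ∂ⁿ)^* = ∑ (-∂)ⁿ aₙ`. Since
`(-∂)ⁿ ∘ a = (-1)ⁿ ∑_{p ≥ 0} (n choose p) Dᵖ(a) ∂^{n-p}`, the coefficient of `∂ᵐ` is the sum
over `n = m + p` below; only finitely many terms are nonzero. -/
def adjoint (P : PDO D) : PDO D where
  coeff m := ∑ᶠ p : ℕ, (((m + p).negOnePow : ℤ) * Ring.choose (m + p) p) •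
    D^[p] (P.coeff (m + p))
  bdd := by
    obtain ⟨A, hA⟩ := P.bdd
    refine ⟨A, fun m hm => ?_⟩
    have h : ∀ p : ℕ, (((m + p).negOnePow : ℤ) * Ring.choose (m + p) p) •
        D^[p] (P.coeff (m + p)) = 0 := fun p => by
      rw [hA (m + p) (by omega), iterate_map_zero, smul_zero]
    simp only [h, finsum_zero]

/-- For a sign `s`, the Laurent series `∑ aₙ (s z)ⁿ`, written in the variable `t = z⁻¹`.
It is the factor in `P e^{s ξ} = (∑ aₙ (s z)ⁿ) e^{s ξ}`, where `ξ = ∑_{n > 0} xₙ zⁿ`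
and `∂ e^{s ξ} = s z e^{s ξ}`. -/
def waveSymbol (s : ℤˣ) (P : PDO D) : LaurentSeries R :=
  HahnSeries.ofSuppBddBelow (fun m : ℤ => ((s ^ m : ℤˣ) : ℤ) • P.coeff (-m)) (by
    obtain ⟨A, hA⟩ := P.bdd
    refine ⟨-A, fun m hm => ?_⟩
    by_contra hlt
    exact hm (by simp only [hA (-m) (by omega), smul_zero]))

end PDO

namespace FormalFunction

open MvPowerSeries

variable {σ τ : Type*}

instance : IsDomain (MvPowerSeries σ ℂ) := NoZeroDivisors.to_isDomain _

/-- `f ↦ f + ε ∂f/∂xₚ` on power series, with `ε² = 0`. -/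
def dualHom (p : σ) : MvPowerSeries σ ℂ →ₐ[ℂ]
    TrivSqZeroExt (FractionRing (MvPowerSeries σ ℂ)) (FractionRing (MvPowerSeries σ ℂ)) where
  toFun f := TrivSqZeroExt.inl (algebraMap _ _ f) +
    TrivSqZeroExt.inr (algebraMap _ _ (pderiv ℂ p f))
  map_zero' := by ext <;> simp
  map_one' := by ext <;> simp
  map_add' f g := by
    rw [map_add, map_add, map_add, TrivSqZeroExt.inl_add, TrivSqZeroExt.inr_add]
    abel
  map_mul' f g := by
    rw [Derivation.leibniz, smul_eq_mul, smul_eq_mul, map_add, map_mul, map_mul, map_mul]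
    ext
    · simp only [TrivSqZeroExt.fst_add, TrivSqZeroExt.fst_mul, TrivSqZeroExt.fst_inl,
        TrivSqZeroExt.fst_inr, add_zero]
    · simp only [TrivSqZeroExt.snd_add, TrivSqZeroExt.snd_mul, TrivSqZeroExt.fst_add,
        TrivSqZeroExt.fst_inl, TrivSqZeroExt.fst_inr, TrivSqZeroExt.snd_inl,
        TrivSqZeroExt.snd_inr, add_zero, zero_add, smul_eq_mul, op_smul_eq_mul]
      ring
  commutes' c := by
    ext
    · simp [TrivSqZeroExt.algebraMap_eq_inl', ← IsScalarTower.algebraMap_apply]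
    · simp [TrivSqZeroExt.algebraMap_eq_inl']

lemma dualHom_apply (p : σ) (f : MvPowerSeries σ ℂ) :
    dualHom p f = TrivSqZeroExt.inl (algebraMap _ _ f) +
      TrivSqZeroExt.inr (algebraMap _ _ (pderiv ℂ p f)) := rfl

/-- The unique extension of `dualHom p` to the fraction field. -/
def fracDualHom (p : σ) : FractionRing (MvPowerSeries σ ℂ) →ₐ[ℂ]
    TrivSqZeroExt (FractionRing (MvPowerSeries σ ℂ)) (FractionRing (MvPowerSeries σ ℂ)) :=
  IsLocalization.liftAlgHom (M := nonZeroDivisors (MvPowerSeries σ ℂ)) (f := dualHom p)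
    fun y => by
      rw [TrivSqZeroExt.isUnit_iff_isUnit_fst]
      simp [dualHom]

lemma fst_fracDualHom (p : σ) (f : FractionRing (MvPowerSeries σ ℂ)) :
    (fracDualHom p f).fst = f := by
  have : (TrivSqZeroExt.fstHom ℂ _ _).comp (fracDualHom p) = AlgHom.id ℂ _ := by
    apply IsLocalization.algHom_ext (nonZeroDivisors (MvPowerSeries σ ℂ))
    ext f
    simp [fracDualHom, dualHom, Algebra.algHom]
  exact DFunLike.congr_fun this f

/-- The partial derivative `∂/∂xₚ` on the field of fractions of the ring of formal power series:
the extension of the formal partial derivative by the quotient rule. -/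
def partialDeriv (p : σ) :
    Derivation ℂ (FractionRing (MvPowerSeries σ ℂ)) (FractionRing (MvPowerSeries σ ℂ)) where
  toFun f := (fracDualHom p f).snd
  map_add' f g := by simp
  map_smul' c f := by simp
  map_one_eq_zero' := by simp
  leibniz' f g := by simp [fst_fracDualHom, mul_comm]

lemma partialDeriv_algebraMap (p : σ) (f : MvPowerSeries σ ℂ) :
    partialDeriv p (algebraMap _ (FractionRing (MvPowerSeries σ ℂ)) f) =
      algebraMap _ _ (pderiv ℂ p f) := by
  change (fracDualHom p (algebraMap _ _ f)).snd = _
  rw [fracDualHom, IsLocalization.liftAlgHom_apply, IsLocalization.lift_eq]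
  change TrivSqZeroExt.snd (dualHom p f) = _
  rw [dualHom_apply, TrivSqZeroExt.snd_add, TrivSqZeroExt.snd_inl, TrivSqZeroExt.snd_inr, zero_add]

lemma sumElim_add (a a' : σ →₀ ℕ) (b b' : τ →₀ ℕ) :
    Finsupp.sumElim (a + a') (b + b') = Finsupp.sumElim a b + Finsupp.sumElim a' b' := by
  ext (i | i) <;> simp

lemma sumElim_inj {a a' : σ →₀ ℕ} {b b' : τ →₀ ℕ}
    (h : Finsupp.sumElim a b = Finsupp.sumElim a' b') : a = a' ∧ b = b' := by
  simp only [DFunLike.ext_iff, Sum.forall, Finsupp.sumElim_inl, Finsupp.sumElim_inr] at h ⊢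
  exact h

lemma exists_sumElim (c : σ ⊕ τ →₀ ℕ) : ∃ a b, c = Finsupp.sumElim a b :=
  ⟨(Finsupp.sumFinsuppEquivProdFinsupp c).1, (Finsupp.sumFinsuppEquivProdFinsupp c).2, by
    ext (i | i) <;> simp⟩

/-- The function underlying `regroup`. -/
def regroupFun (F : MvPowerSeries (σ ⊕ τ) ℂ) : MvPowerSeries τ (MvPowerSeries σ ℂ) :=
  fun b => fun a => coeff (Finsupp.sumElim a b) F

lemma coeff_regroupFun (F : MvPowerSeries (σ ⊕ τ) ℂ) (a : σ →₀ ℕ) (b : τ →₀ ℕ) :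
    coeff a (coeff b (regroupFun F)) = coeff (Finsupp.sumElim a b) F := rfl

/-- Regards a power series in two families of variables as a power series in the second family
whose coefficients are power series in the first family. -/
def regroup : MvPowerSeries (σ ⊕ τ) ℂ →+* MvPowerSeries τ (MvPowerSeries σ ℂ) where
  toFun := regroupFun
  map_zero' := rfl
  map_one' := by
    classical
    ext b a
    have h : Finsupp.sumElim a b = 0 ↔ a = 0 ∧ b = 0 := by
      rw [DFunLike.ext_iff, Sum.forall, DFunLike.ext_iff, DFunLike.ext_iff]
      rfl
    rw [coeff_regroupFun, coeff_one, coeff_one]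
    by_cases hb : b = 0
    · rw [if_pos hb, coeff_one]
      exact if_congr (h.trans (and_iff_left hb)) rfl rfl
    · rw [if_neg hb, if_neg (fun e => hb (h.1 e).2), map_zero]
  map_add' F G := rfl
  map_mul' F G := by
    classical
    ext b a
    rw [coeff_regroupFun, coeff_mul, coeff_mul, map_sum,
      Finset.sum_congr rfl fun x _ => coeff_mul _ _ _, ← Finset.sum_product']
    symm
    refine Finset.sum_bij (fun x _ => (Finsupp.sumElim x.2.1 x.1.1, Finsupp.sumElim x.2.2 x.1.2))
      ?_ ?_ ?_ ?_
    · rintro ⟨⟨b1, b2⟩, ⟨a1, a2⟩⟩ h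
      simp only [Finset.mem_product, Finset.HasAntidiagonal.mem_antidiagonal] at h ⊢
      rw [← h.1, ← h.2, sumElim_add]
    · rintro ⟨⟨b1, b2⟩, ⟨a1, a2⟩⟩ _ ⟨⟨b1', b2'⟩, ⟨a1', a2'⟩⟩ _ h
      rw [Prod.mk.injEq] at h
      obtain ⟨h1, h2⟩ := sumElim_inj h.1
      obtain ⟨h3, h4⟩ := sumElim_inj h.2
      simp only at h1 h2 h3 h4
      rw [h1, h2, h3, h4]
    · rintro ⟨c1, c2⟩ h
      obtain ⟨a1, b1, rfl⟩ := exists_sumElim c1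
      obtain ⟨a2, b2, rfl⟩ := exists_sumElim c2
      rw [Finset.HasAntidiagonal.mem_antidiagonal, ← sumElim_add] at h
      obtain ⟨h1, h2⟩ := sumElim_inj h
      exact ⟨((b1, b2), (a1, a2)), by simp [h1, h2], rfl⟩
    · intros
      rfl

lemma coeff_regroup (F : MvPowerSeries (σ ⊕ τ) ℂ) (a : σ →₀ ℕ) (b : τ →₀ ℕ) :
    coeff a (coeff b (regroup F)) = coeff (Finsupp.sumElim a b) F := rfl

lemma regroup_X_inl (p : σ) : regroup (X (Sum.inl p) : MvPowerSeries (σ ⊕ τ) ℂ) = C (X p) := by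
  classical
  ext b a
  rw [coeff_regroup, coeff_X, coeff_C]
  have h : Finsupp.sumElim a b = Finsupp.single (Sum.inl p) 1 ↔ a = Finsupp.single p 1 ∧ b = 0 := by
    rw [show Finsupp.single (Sum.inl p) 1 = Finsupp.sumElim (Finsupp.single p 1) (0 : τ →₀ ℕ) by
      ext (i | i) <;> simp [Finsupp.single_apply]]
    exact ⟨sumElim_inj, by rintro ⟨rfl, rfl⟩; rfl⟩
  by_cases hb : b = 0
  · rw [if_pos hb, coeff_X]
    exact if_congr (h.trans (and_iff_left hb)) rfl rfl
  · rw [if_neg hb, if_neg (fun e => hb (h.1 e).2), map_zero]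

lemma regroup_X_inr (p : τ) : regroup (X (Sum.inr p) : MvPowerSeries (σ ⊕ τ) ℂ) = X p := by
  classical
  ext b a
  rw [coeff_regroup, coeff_X, coeff_X]
  have h : Finsupp.sumElim a b = Finsupp.single (Sum.inr p) 1 ↔ a = 0 ∧ b = Finsupp.single p 1 := by
    rw [show Finsupp.single (Sum.inr p) 1 = Finsupp.sumElim (0 : σ →₀ ℕ) (Finsupp.single p 1) by
      ext (i | i) <;> simp [Finsupp.single_apply]]
    exact ⟨sumElim_inj, by rintro ⟨rfl, rfl⟩; rfl⟩
  by_cases hb : b = Finsupp.single p 1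
  · rw [if_pos hb, coeff_one]
    exact if_congr (h.trans (and_iff_left hb)) rfl rfl
  · rw [if_neg hb, if_neg (fun e => hb (h.1 e).2), map_zero]

lemma hasSubst_add : HasSubst (fun p : σ =>
    (X (Sum.inl p) + X (Sum.inr p) : MvPowerSeries (σ ⊕ σ) ℂ)) where
  const_coeff p := by simp
  coeff_zero d := by
    classical
    refine (d.support.finite_toSet.preimage (f := Sum.inl) (Sum.inl_injective.injOn)).union
      (d.support.finite_toSet.preimage (f := Sum.inr) (Sum.inr_injective.injOn)) |>.subset ?_
    intro p hp
    by_contra h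
    apply hp
    simp only [Set.mem_union, Set.mem_preimage, Finset.mem_coe, Finsupp.mem_support_iff, not_or,
      not_not] at h
    rw [map_add, coeff_X, coeff_X, if_neg, if_neg, add_zero]
    · rintro rfl
      simp at h
    · rintro rfl
      simp at h

/-- `f(x) ↦ f(x + y)`, as a power series in `y` whose coefficients are power series in `x`. -/
def translateHom : MvPowerSeries σ ℂ →+* MvPowerSeries σ (MvPowerSeries σ ℂ) :=
  regroup.comp (substAlgHom (R := ℂ) (hasSubst_add (σ := σ))).toRingHom

lemma constantCoeff_translateHom (f : MvPowerSeries σ ℂ) : constantCoeff (translateHom f) = f := by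
  classical
  ext a
  have key : ∀ d : σ →₀ ℕ, coeff (Finsupp.sumElim a 0) (d.prod fun p e =>
      (X (Sum.inl p) + X (Sum.inr p) : MvPowerSeries (σ ⊕ σ) ℂ) ^ e) = if a = d then 1 else 0 := by
    intro d
    rw [← coeff_regroup, coeff_zero_eq_constantCoeff_apply, Finsupp.prod, map_prod, map_prod,
      ← coeff_monomial, monomial_one_eq]
    congr 1
    refine Finset.prod_congr rfl fun p _ => ?_
    simp [regroup_X_inl, regroup_X_inr]
  change coeff (Finsupp.sumElim a 0) (substAlgHom hasSubst_add f) = _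
  rw [substAlgHom_apply, coeff_subst hasSubst_add, finsum_eq_single _ a]
  · rw [key, if_pos rfl, smul_eq_mul, mul_one]
  · intro d hd
    rw [key, if_neg hd.symm, smul_zero]

/-- The Taylor expansion `f(x) ↦ f(x + y)` at a generic point `x`, on the field of fractions of
the ring of power series: `(f / g)(x + y) = f(x + y) / g(x + y)`, as a power series in `y`. -/
def taylor : FractionRing (MvPowerSeries σ ℂ) →+*
    MvPowerSeries σ (FractionRing (MvPowerSeries σ ℂ)) :=
  IsLocalization.lift (M := nonZeroDivisors (MvPowerSeries σ ℂ))
    (g := (MvPowerSeries.map (algebraMap _ _)).comp translateHom) fun y => by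
      rw [isUnit_iff_constantCoeff]
      have : constantCoeff (translateHom (y : MvPowerSeries σ ℂ)) = y := constantCoeff_translateHom _
      simp [this]

lemma hasSubst_shift {ι : Type*} [DecidableEq ι] (s : ℂ) (k : ι) : HasSubst
    (fun p : ι × ℕ+ => (X (some p) + if p.1 = k then C (s / (p.2 : ℕ)) * X none ^ (p.2 : ℕ) else 0 :
      MvPowerSeries (Option (ι × ℕ+)) ℂ)) where
  const_coeff p := by
    by_cases h : p.1 = k <;> simp [h]
  coeff_zero d := by
    classical
    have h2 : Set.InjOn (fun n : ℕ+ => (n : ℕ)) ((fun n : ℕ+ => (n : ℕ)) ⁻¹' {d none}) :=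
      PNat.coe_injective.injOn
    refine ((d.support.finite_toSet.preimage (f := some) (Option.some_injective _).injOn).union
      (((Set.finite_singleton (d none)).preimage h2).image (Prod.mk k))).subset ?_
    rintro ⟨j, n⟩ hp
    by_contra h
    simp only [Set.mem_union, Set.mem_preimage, Finset.mem_coe, Finsupp.mem_support_iff, not_or,
      not_not, Set.mem_image, Set.mem_singleton_iff, not_exists, not_and] at h
    apply hp
    rw [map_add, coeff_X, if_neg, zero_add]
    · split_ifs with hj
      · rw [coeff_C_mul, coeff_X_pow, if_neg, mul_zero]
        rintro rfl
        exact h.2 n (by simp) (by rw [← show j = k from hj])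
      · simp
    · rintro rfl
      simp at h

/-- `f(x) ↦ f(x + s [z⁻¹]^{(k)})`, that is, the substitution `x_n^{(k)} ↦ x_n^{(k)} + s / (n zⁿ)`
for all `n`, as a power series in `t = z⁻¹`. -/
def shift {ι : Type*} [DecidableEq ι] (s : ℂ) (k : ι) (f : MvPowerSeries (ι × ℕ+) ℂ) :
    PowerSeries (MvPowerSeries (ι × ℕ+) ℂ) :=
  optionEquivLeft _ _ (substAlgHom (R := ℂ) (hasSubst_shift s k) f)

end FormalFunction

namespace AffineSL

open MvPowerSeries FormalFunction

/-- Indices of the variables: `(i, k)` stands for `x_k^{(i)}`, with `k ≥ 1`. -/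
abbrev Var (ℓ : ℕ) : Type := Fin ℓ × ℕ+

/-- Formal power series in all the variables `x_k^{(i)}`. -/
abbrev FPS (ℓ : ℕ) : Type := MvPowerSeries (Var ℓ) ℂ

/-- Quotients of formal power series in the variables `x_k^{(i)}`. -/
abbrev Fn (ℓ : ℕ) : Type := FractionRing (FPS ℓ)

/-- Functions of two points and of the spectral parameter: power series in `y = x' - x`, whose
coefficients are Laurent series in `z⁻¹` with coefficients depending on `x`. Here `x` and
`x' = x + y` are independent. The variable of `LaurentSeries` is `t = z⁻¹`. -/
abbrev TwoPoint (ℓ : ℕ) : Type := MvPowerSeries (Var ℓ) (LaurentSeries (Fn ℓ))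

variable {ℓ : ℕ}

/-- `zⁿ`, where the variable of `LaurentSeries` is `z⁻¹`. -/
def zPow (n : ℤ) : LaurentSeries (Fn ℓ) := HahnSeries.single (-n) 1

/-- `Res_z F`, the coefficient of `z⁻¹`. -/
def res (F : LaurentSeries (Fn ℓ)) : Fn ℓ := F.coeff 1

/-- `Res_z F` for a function of two points. -/
def twoPointRes (F : TwoPoint ℓ) : MvPowerSeries (Var ℓ) (Fn ℓ) :=
  fun b => res (coeff b F)

/-- A function `F(x, z)` at the point `x`. -/
def atLeft (F : LaurentSeries (Fn ℓ)) : TwoPoint ℓ := C F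

/-- A function `F(x', z)` at the point `x' = x + y`, by Taylor expansion in `y`. -/
def atRight (F : LaurentSeries (Fn ℓ)) : TwoPoint ℓ :=
  fun b => F.map ((coeff b).toAddMonoidHom.comp (taylor (σ := Var ℓ)).toAddMonoidHom)

/-- `f(x + s [z⁻¹]^{(k)})`, where `[z⁻¹] = (1/z, 1/(2z²), 1/(3z³), …)`. -/
def shifted (s : ℂ) (k : Fin ℓ) (f : FPS ℓ) : LaurentSeries (Fn ℓ) :=
  HahnSeries.ofPowerSeries ℤ (Fn ℓ) (PowerSeries.map (algebraMap (FPS ℓ) (Fn ℓ)) (shift s k f))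

/-- `exp ξ(x^{(k)} - x'^{(k)}, z) = exp (-∑ₙ yₙ^{(k)} zⁿ) = ∏ₙ ∑ₑ (-yₙ^{(k)} zⁿ)ᵉ / e!`. -/
def expXi (k : Fin ℓ) : TwoPoint ℓ := fun b =>
  if ∀ p ∈ b.support, p.1 = k then
    b.prod fun p e => ((e.factorial : ℂ)⁻¹) • (-zPow (p.2 : ℕ)) ^ e
  else 0

/-- The lattice form `(α|β)`, for which the `v_i` are orthonormal. -/
def form (α β : Fin ℓ → ℤ) : ℤ := ∑ i, α i * β i

/-- The basis vector `v_i` of the lattice `Q = ℤ^ℓ`. -/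
def basisVec (i : Fin ℓ) : Fin ℓ → ℤ := Pi.single i 1

/-- The bimultiplicative function on `Q` with `ε(v_i, v_j) = 1` for `i < j` and `-1` for `i ≥ j`. -/
def eps (α β : Fin ℓ → ℤ) : ℤˣ := ∏ i, ∏ j, (if i < j then 1 else -1 : ℤˣ) ^ (α i * β j)

/-- The root lattice `Q₀ = {α ∈ Q | the coordinates of α sum to 0}`. -/
def rootLattice (ℓ : ℕ) : AddSubgroup (Fin ℓ → ℤ) where
  carrier := {α | ∑ i, α i = 0}
  add_mem' {α β} hα hβ := by
    simp only [Set.mem_ofPred_eq, Pi.add_apply, Finset.sum_add_distrib] at *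
    rw [hα, hβ, add_zero]
  zero_mem' := by simp
  neg_mem' {α} hα := by
    simp only [Set.mem_ofPred_eq, Pi.neg_apply, Finset.sum_neg_distrib] at *
    rw [hα, neg_zero]

/-- The root `v_i - v_j`. -/
def root (i j : Fin ℓ) : rootLattice ℓ :=
  ⟨basisVec i - basisVec j, by
    change ∑ k, (basisVec i - basisVec j) k = 0
    simp [basisVec, Finset.sum_sub_distrib]⟩

/-- Kronecker's delta. -/
def delta (i j : Fin ℓ) : ℤ := if i = j then 1 else 0

/-- The left-hand side of the Hirota bilinear equation of the affine Lie algebra of `sl_ℓ` with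
parameters `m, α, β, i, j`. -/
def hirota (τ : rootLattice ℓ → FPS ℓ) (m : ℕ) (α β : rootLattice ℓ) (i j : Fin ℓ) :
    MvPowerSeries (Var ℓ) (Fn ℓ) :=
  ∑ k, ((eps (basisVec k) ((α : Fin ℓ → ℤ) - (β : Fin ℓ → ℤ) + basisVec i + basisVec j) : ℤ) :
      MvPowerSeries (Var ℓ) (Fn ℓ)) *
    twoPointRes (
      atLeft (zPow (form (basisVec k) ((α : Fin ℓ → ℤ) - (β : Fin ℓ → ℤ)) + m - 2 + delta i k + delta j k)) *
      expXi k * atLeft (shifted (-1) k (τ (α + root i k))) *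
      atRight (shifted 1 k (τ (β - root j k))))

/-- All the bilinear equations. -/
def SatisfiesHirota (τ : rootLattice ℓ → FPS ℓ) : Prop :=
  ∀ (m : ℕ) (α β : rootLattice ℓ) (i j : Fin ℓ), hirota τ m α β i j = 0

/-- The derivation `∂ = ∑_i ∂/∂x_1^{(i)}`. -/
def del (ℓ : ℕ) : Derivation ℂ (Fn ℓ) (Fn ℓ) := ∑ i : Fin ℓ, partialDeriv (i, 1)

/-- `ℓ × ℓ` matrix pseudo-differential operators. -/
abbrev MatPDO (ℓ : ℕ) : Type := Matrix (Fin ℓ) (Fin ℓ) (PDO (del ℓ))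

/-- `∂ᵏ` times the identity matrix. -/
def delPow (k : ℕ) : MatPDO ℓ := Matrix.diagonal fun _ => PDO.monomial (del ℓ) 1 k

/-- The matrix unit `E_ii`. -/
def unitE (i : Fin ℓ) : MatPDO ℓ := Matrix.single i i 1

/-- The part of `P` with negative powers of `∂`. -/
def negM (P : MatPDO ℓ) : MatPDO ℓ := P.map PDO.negPart

/-- The part of `P` with nonnegative powers of `∂`. -/
def posM (P : MatPDO ℓ) : MatPDO ℓ := P.map PDO.posPart

/-- The formal adjoint of a matrix operator: `(A ∂ⁿ)^* = (-∂)ⁿ Aᵀ`. -/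
def adjointM (P : MatPDO ℓ) : MatPDO ℓ := (P.map PDO.adjoint).transpose

/-- The coefficientwise derivative `∂P/∂x_k^{(i)}`. -/
def derivM (i : Fin ℓ) (k : ℕ+) (P : MatPDO ℓ) : MatPDO ℓ :=
  P.map (PDO.deriveCoeffs (partialDeriv (i, k)))

/-- The dressing operator `P_α = ∑_{n ≥ 0} P_{α,n} ∂⁻ⁿ` (meaningful for `τ_α ≠ 0`), with
`(P_{α,n})_{ij} = -ε(v_j, v_i) Res_z z^{n + δ_ij - 2} τ_{α+v_i-v_j}(x - [z⁻¹]^{(j)}) / τ_α(x)`. -/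
def dressing (τ : rootLattice ℓ → FPS ℓ) (α : rootLattice ℓ) : MatPDO ℓ :=
  Matrix.of fun i j => PDO.ofNonpos (del ℓ) fun n =>
    -((eps (basisVec j) (basisVec i) : ℤ) : Fn ℓ) *
      (res (zPow (n + delta i j - 2) * shifted (-1) j (τ (α + root i j))) /
        algebraMap (FPS ℓ) (Fn ℓ) (τ α))

/-- `Λ_α(z)`, the diagonal matrix with entries `ε(v_k, α) z^{(v_k|α)}`. -/
def lambdaM (α : rootLattice ℓ) : Matrix (Fin ℓ) (Fin ℓ) (TwoPoint ℓ) :=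
  Matrix.diagonal fun k =>
    atLeft (((eps (basisVec k) α : ℤ) : LaurentSeries (Fn ℓ)) * zPow (form (basisVec k) (α : Fin ℓ → ℤ)))

/-- `exp Ξ(x, z) exp (-Ξ(x', z)) = exp (Ξ(x, z) - Ξ(x', z))`, a diagonal matrix. -/
def expXiM (ℓ : ℕ) : Matrix (Fin ℓ) (Fin ℓ) (TwoPoint ℓ) := Matrix.diagonal expXi

/-- The matrix
`Res_z (z^m (P e^{Ξ(x,z)}) Λ_{α-β}(z) ((Q e^{-Ξ(x,z)})ᵀ at x ↦ x'))` with `P = P_α` and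
`Q = (P_β^*)⁻¹`. The factors `e^{Ξ(x,z)}` and `e^{-Ξ(x',z)}` are diagonal, as is `Λ`, and are
combined into one factor. -/
def bilinearResidue (τ : rootLattice ℓ → FPS ℓ) (m : ℕ) (α β : rootLattice ℓ) :
    Matrix (Fin ℓ) (Fin ℓ) (MvPowerSeries (Var ℓ) (Fn ℓ)) :=
  ((atLeft (zPow m) : TwoPoint ℓ) •
    ((dressing τ α).map (fun p => atLeft (p.waveSymbol 1)) * expXiM ℓ * lambdaM (α - β) *
      ((Ring.inverse (adjointM (dressing τ β))).map
        (fun q => atRight (q.waveSymbol (-1)))).transpose)).map twoPointRes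

/-- `L = P ∂ P⁻¹`. -/
def laxL (P : MatPDO ℓ) : MatPDO ℓ := P * delPow 1 * Ring.inverse P

/-- `C_i = P E_ii P⁻¹`. -/
def laxC (P : MatPDO ℓ) (i : Fin ℓ) : MatPDO ℓ := P * unitE i * Ring.inverse P

/-- The differential operator `(L^k C_i)_+`. -/
def laxB (P : MatPDO ℓ) (i : Fin ℓ) (k : ℕ+) : MatPDO ℓ :=
  posM (laxL P ^ (k : ℕ) * laxC P i)

end AffineSL

end

/-!
The bilinear equations are statements about residues of products of wave functions. For matrix
operators `A`, `B` put `pairing A B = Res_z (A e^{Ξ(x,z)}) (B e^{-Ξ(x',z)})ᵀ`.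

* `negM_eq_of_pairing`: by Taylor expansion at `x' = x`, the pairing of `A` and `B` determines
  `(A B^*)_-`.
* `pderiv_pairing`: differentiating in `x'` gives
  `∂/∂x'_k^{(i)} pairing A B = pairing A (∂B/∂x_k^{(i)}) - pairing (A E_ii ∂ᵏ) B`.

The left-hand side of the bilinear equation is, up to the factors `τ_α(x)` and `τ_β(x')`, the
pairing of `P_α ∂^m Λ_{α-β}(∂)` with an operator `R_β` (`adjDressing`) whose symbol consists of
the functions `τ_{β-v_j+v_k}(x + [z⁻¹]^{(k)}) / τ_β(x)`; see `hirota_eq_pairing`. As the equation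
depends on `α, i` and `β, j` only through `α + v_i` and `β - v_j`, it suffices to consider `α, β`
with `τ_α ≠ 0 ≠ τ_β` (`satisfiesHirota_iff`). So the equivalence of the two bilinear identities
amounts to `R_β = (P_β^*)⁻¹`, which each of them implies through its case `α = β`, `m = 0`:

* If `pairing P_β R_β = 0`, then `P_β R_β^*` has no negative part; it is also `1` plus terms of
  negative order, hence equal to `1` (`eq_inverse_adjointM_of_pairing`).
* Conversely, if `Q` is `1` plus terms of negative order and `pairing P_β Q = 0`, the substitution
  `x' = x - [t]^{(i)}`, under which `e^{ξ(x^{(i)} - x'^{(i)}, z)}` becomes the geometric series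
  `1 / (1 - t z)`, evaluates the residue to the product of `(P_β)_ii(x, t⁻¹)` and
  `Q_si(x - [t]^{(i)}, t⁻¹)`. Since `(P_β)_ii` is `τ_β(x - [t]^{(i)}) / τ_β(x)`, this determines
  `τ_β Q_si` after the shift, and shifting back gives `Q = R_β` (`eq_adjDressing_of_pairing`).

To avoid a theory of composition for the quotients of power series involved, the substitution
`f(x) ↦ f(x ± [t])` is treated as the formal flow `exp (±∑_p ∂_p t^p / p)` of the partial
derivatives (`flow`). It is multiplicative and compatible with all additive maps that commute with
the derivatives; that it agrees with substitution in power series follows from the chain rule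
(`shiftHom_succ`), proved on polynomials and extended by continuity.

With `(P_α^*)⁻¹` identified, the case `α = β`, `m = 1` gives `(P_α ∂ P_α⁻¹)_- = 0`, and the
derivative of the case `α = β`, `m = 0` gives the Sato–Wilson equation (`derivM_eq_of_pairing`),
from which the Lax equations follow algebraically (`lax_equation`).
-/

namespace PDO

/-! ### Orders, coefficients and monomials -/

lemma coeff_mul_eq_zero_of_lt {R : Type*} [CommRing R] {F G : LaurentSeries R} {a b : ℤ}
    (hF : ∀ n < a, F.coeff n = 0) (hG : ∀ n < b, G.coeff n = 0) (n : ℤ) (hn : n < a + b) :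
    (F * G).coeff n = 0 := by
  rw [HahnSeries.coeff_mul]
  refine Finset.sum_eq_zero fun x hx => ?_
  rw [Finset.mem_antidiagonal] at hx
  by_cases h : x.1 < a
  · rw [hF _ h, zero_mul]
  · rw [hG _ (by omega), mul_zero]

variable {R : Type*} [CommRing R] [Algebra ℂ R] {D : Derivation ℂ R R}

/-- `P` has order at most `N`, that is, no powers `∂ⁿ` with `n > N`. -/
def OrderLE (P : PDO D) (N : ℤ) : Prop := ∀ n, N < n → P.coeff n = 0

lemma exists_orderLE (P : PDO D) : ∃ N, P.OrderLE N := P.bdd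

lemma OrderLE.mono {P : PDO D} {A B : ℤ} (h : P.OrderLE A) (hAB : A ≤ B) : P.OrderLE B :=
  fun n hn => h n (by omega)

lemma OrderLE.add {P Q : PDO D} {A : ℤ} (hP : P.OrderLE A) (hQ : Q.OrderLE A) :
    (P + Q).OrderLE A := fun n hn => by rw [coeff_add, hP n hn, hQ n hn, add_zero]

lemma OrderLE.neg {P : PDO D} {A : ℤ} (hP : P.OrderLE A) : (-P).OrderLE A :=
  fun n hn => by rw [coeff_neg, hP n hn, neg_zero]

lemma OrderLE.mul {P Q : PDO D} {A B : ℤ} (hP : P.OrderLE A) (hQ : Q.OrderLE B) :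
    (P * Q).OrderLE (A + B) := coeff_mul_vanish P Q hP hQ

lemma orderLE_zero (A : ℤ) : (0 : PDO D).OrderLE A := fun _ _ => rfl

lemma orderLE_one : (1 : PDO D).OrderLE 0 := fun n hn => by
  rw [coeff_one, if_neg (by omega)]

lemma orderLE_sum {ι : Type*} (s : Finset ι) (f : ι → PDO D) {A : ℤ}
    (h : ∀ i ∈ s, (f i).OrderLE A) : (∑ i ∈ s, f i).OrderLE A :=
  Finset.sum_induction f (fun P => P.OrderLE A) (fun _ _ => OrderLE.add) (orderLE_zero A) h

/-- The coefficient of `∂ⁿ` as an additive map. -/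
noncomputable def coeffHom (D : Derivation ℂ R R) (n : ℤ) : PDO D →+ R where
  toFun P := P.coeff n
  map_zero' := rfl
  map_add' _ _ := rfl

@[simp] lemma coeffHom_apply (P : PDO D) (n : ℤ) : coeffHom D n P = P.coeff n := rfl

lemma coeff_sum {ι : Type*} (s : Finset ι) (f : ι → PDO D) (n : ℤ) :
    (∑ i ∈ s, f i).coeff n = ∑ i ∈ s, (f i).coeff n := map_sum (coeffHom D n) f s

@[simp] lemma coeff_sub (P Q : PDO D) (n : ℤ) : (P - Q).coeff n = P.coeff n - Q.coeff n :=
  map_sub (coeffHom D n) P Q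

lemma coeff_zsmul (c : ℤ) (P : PDO D) (n : ℤ) : (c • P).coeff n = c • P.coeff n :=
  map_zsmul (coeffHom D n) c P

@[simp] lemma coeff_monomial (a : R) (n m : ℤ) :
    (monomial D a n).coeff m = if m = n then a else 0 := rfl

lemma orderLE_monomial (a : R) (n : ℤ) : (monomial D a n).OrderLE n := fun m hm => by
  rw [coeff_monomial, if_neg (by omega)]

lemma one_eq_monomial : (1 : PDO D) = monomial D 1 0 := rfl

/-- An additive map that kills all monomials and all operators of sufficiently low order is zero:
an operator is a finite sum of monomials up to terms of low order. -/
lemma addMonoidHom_eq_zero {M : Type*} [AddCommGroup M] (T : PDO D →+ M) (N : ℤ)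
    (hlow : ∀ P : PDO D, P.OrderLE N → T P = 0) (hmon : ∀ a n, T (monomial D a n) = 0)
    (P : PDO D) : T P = 0 := by
  obtain ⟨A, hA⟩ := P.exists_orderLE
  have h : (P - ∑ i ∈ Finset.Ioc N A, monomial D (P.coeff i) i).OrderLE N := by
    intro n hn
    rw [coeff_sub, coeff_sum]
    simp only [coeff_monomial]
    rw [Finset.sum_ite_eq]
    split_ifs with h
    · rw [sub_self]
    · rw [hA n (by rw [Finset.mem_Ioc] at h; omega), sub_zero]
  have := hlow _ h
  rwa [map_sub, map_sum, Finset.sum_eq_zero fun i _ => hmon _ i, sub_zero] at this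

/-- Additive endomorphisms that shift the order by a bounded amount are determined by their values
on monomials. -/
lemma eq_of_monomial (S T : PDO D →+ PDO D) (c : ℤ)
    (hS : ∀ P N, P.OrderLE N → (S P).OrderLE (N + c))
    (hT : ∀ P N, P.OrderLE N → (T P).OrderLE (N + c))
    (hmon : ∀ a n, S (monomial D a n) = T (monomial D a n)) (P : PDO D) : S P = T P := by
  ext n
  have := addMonoidHom_eq_zero ((coeffHom D n).comp (S - T)) (n - c - 1) (fun P hP => by
    simp [hS P _ hP n (by omega), hT P _ hP n (by omega)]) (fun a m => by simp [hmon a m]) P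
  simpa [sub_eq_zero] using this

lemma coeff_mul_monomial_one (P : PDO D) (m n : ℤ) :
    (P * monomial D 1 m).coeff n = P.coeff (n - m) := by
  rw [coeff_mul, mulCoeff, finsum_eq_single _ (n - m, 0)]
  · simp
  · rintro ⟨i, p⟩ h
    by_cases hp : p = 0
    · subst hp
      have hi : n - i ≠ m := fun h0 => h (by rw [show i = n - m by omega])
      simp [hi]
    · by_cases hi : n + p - i = m
      · simp [hi, iterate_one p hp]
      · simp [hi]

lemma coeff_monomial_zero_mul (a : R) (P : PDO D) (n : ℤ) :
    (monomial D a 0 * P).coeff n = a * P.coeff n := by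
  rw [coeff_mul, mulCoeff, finsum_eq_single _ ((0 : ℤ), 0)]
  · simp
  · rintro ⟨i, p⟩ h
    by_cases hi : i = 0
    · subst hi
      have hp : 0 < p := Nat.pos_of_ne_zero fun h0 => h (by rw [h0])
      simp [Ring.choose_zero_pos ℤ hp]
    · simp [hi]

lemma coeff_del_mul (P : PDO D) (n : ℤ) :
    (monomial D 1 1 * P).coeff n = P.coeff (n - 1) + D (P.coeff n) := by
  rw [coeff_mul, mulCoeff,
    finsum_eq_sum_of_support_subset (s := {((1 : ℤ), 0), ((1 : ℤ), 1)})]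
  · rw [Finset.sum_pair (by simp)]
    simp
  · rintro ⟨i, p⟩ h
    by_contra h'
    apply h
    by_cases hi : i = 1
    · subst hi
      have hp : 2 ≤ p := by
        by_contra hlt
        apply h'
        have : p = 0 ∨ p = 1 := by omega
        rcases this with rfl | rfl <;> simp
      have : Ring.choose (1 : ℤ) p = 0 := by
        have := Ring.choose_natCast (R := ℤ) 1 p
        rw [Nat.choose_eq_zero_of_lt (by omega)] at this
        simpa using this
      simp [this]
    · simp [hi]

lemma monomial_mul_monomial_one (a : R) (n m : ℤ) :
    monomial D a n * monomial D 1 m = monomial D a (n + m) := by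
  ext i
  rw [coeff_mul_monomial_one, coeff_monomial, coeff_monomial]
  exact if_congr (by omega) rfl rfl

lemma monomial_zero_mul_monomial (a b : R) (n : ℤ) :
    monomial D a 0 * monomial D b n = monomial D (a * b) n := by
  ext i
  rw [coeff_monomial_zero_mul, coeff_monomial, coeff_monomial, mul_ite, mul_zero]

lemma del_mul_monomial (b : R) (n : ℤ) :
    monomial D 1 1 * monomial D b n = monomial D b (n + 1) + monomial D (D b) n := by
  ext i
  rw [coeff_del_mul, coeff_add]
  simp only [coeff_monomial]
  congr 1
  · exact if_congr (by omega) rfl rfl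
  · split_ifs <;> simp

lemma coeff_monomial_one_mul_monomial_zero (a : R) (n m : ℤ) :
    (monomial D 1 n * monomial D a 0).coeff m =
      if m ≤ n then Ring.choose n (n - m).toNat • D^[(n - m).toNat] a else 0 := by
  rw [coeff_mul, mulCoeff]
  split_ifs with h
  · rw [finsum_eq_single _ (n, (n - m).toNat)]
    · simp [Int.toNat_of_nonneg (sub_nonneg.2 h)]
    · rintro ⟨i, p⟩ hx
      by_cases hi : i = n
      · subst hi
        have : m + p - i ≠ 0 := fun h0 => hx (by rw [show p = (i - m).toNat by omega])
        simp [this]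
      · simp [hi]
  · refine (finsum_congr fun x => ?_).trans finsum_zero
    obtain ⟨i, p⟩ := x
    by_cases hi : i = n
    · subst hi
      have : m + p - i ≠ 0 := by omega
      simp [this]
    · simp [hi]

/-! ### The formal adjoint -/

lemma coeff_adjoint (P : PDO D) {A : ℤ} (hA : P.OrderLE A) (m : ℤ) (M : ℕ) (hM : A - m < M) :
    (adjoint P).coeff m = ∑ p ∈ Finset.range M,
      (((m + p).negOnePow : ℤ) * Ring.choose (m + p) p) • D^[p] (P.coeff (m + p)) := by
  apply finsum_eq_sum_of_support_subset
  intro p hp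
  rw [Finset.mem_coe, Finset.mem_range]
  by_contra h
  apply hp
  change _ • D^[p] (P.coeff (m + p)) = 0
  rw [hA (m + p) (by omega), iterate_map_zero, smul_zero]

lemma OrderLE.adjoint {P : PDO D} {A : ℤ} (hP : P.OrderLE A) : P.adjoint.OrderLE A :=
  fun m hm => by
    rw [coeff_adjoint P hP m 0 (by push_cast; omega)]
    simp

/-- The formal adjoint as an additive map. -/
noncomputable def adjointHom (D : Derivation ℂ R R) : PDO D →+ PDO D :=
  AddMonoidHom.mk' adjoint fun P Q => by
    obtain ⟨A, hA⟩ := P.exists_orderLE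
    obtain ⟨B, hB⟩ := Q.exists_orderLE
    have hA' := hA.mono (le_max_left A B)
    have hB' := hB.mono (le_max_right A B)
    ext m
    have hM : max A B - m < ((max A B - m + 1).toNat : ℤ) := by omega
    rw [coeff_add, coeff_adjoint _ hA' m _ hM, coeff_adjoint _ hB' m _ hM,
      coeff_adjoint _ (hA'.add hB') m _ hM, ← Finset.sum_add_distrib]
    simp only [coeff_add, iterate_add, smul_add]

@[simp] lemma adjointHom_apply (P : PDO D) : adjointHom D P = adjoint P := rfl

lemma adjoint_add (P Q : PDO D) : adjoint (P + Q) = adjoint P + adjoint Q :=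
  map_add (adjointHom D) P Q

lemma adjoint_zsmul (c : ℤ) (P : PDO D) : adjoint (c • P) = c • adjoint P :=
  map_zsmul (adjointHom D) c P

lemma adjoint_sum {ι : Type*} (s : Finset ι) (f : ι → PDO D) :
    adjoint (∑ i ∈ s, f i) = ∑ i ∈ s, adjoint (f i) := map_sum (adjointHom D) f s

lemma adjoint_monomial (a : R) (n : ℤ) :
    adjoint (monomial D a n) = (n.negOnePow : ℤ) • (monomial D 1 n * monomial D a 0) := by
  ext m
  rw [coeff_zsmul, coeff_monomial_one_mul_monomial_zero]
  split_ifs with h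
  · change ∑ᶠ p : ℕ, _ = _
    rw [finsum_eq_single _ (n - m).toNat]
    · rw [show m + ((n - m).toNat : ℤ) = n by omega]
      simp [mul_smul]
    · intro p hp
      rw [coeff_monomial, if_neg (by omega), iterate_map_zero, smul_zero]
  · rw [(orderLE_monomial a n).adjoint m (by omega), smul_zero]

lemma adjoint_monomial_zero (a : R) : adjoint (monomial D a 0) = monomial D a 0 := by
  rw [adjoint_monomial, ← one_eq_monomial, one_mul]
  simp

lemma adjoint_monomial_one (n : ℤ) :
    adjoint (monomial D 1 n) = (n.negOnePow : ℤ) • monomial D 1 n := by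
  rw [adjoint_monomial, ← one_eq_monomial, mul_one]

lemma adjoint_monomial_zero_mul (a : R) (Q : PDO D) :
    adjoint (monomial D a 0 * Q) = adjoint Q * monomial D a 0 := by
  refine eq_of_monomial ((adjointHom D).comp (AddMonoidHom.mulLeft (monomial D a 0)))
    ((AddMonoidHom.mulRight (monomial D a 0)).comp (adjointHom D)) 0 ?_ ?_ ?_ Q
  · intro P N hP
    exact ((orderLE_monomial a 0).mul hP).adjoint.mono (by omega)
  · intro P N hP
    exact hP.adjoint.mul (orderLE_monomial a 0)
  · intro b n
    simp only [AddMonoidHom.comp_apply, AddMonoidHom.coe_mulLeft, AddMonoidHom.coe_mulRight,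
      adjointHom_apply, monomial_zero_mul_monomial, adjoint_monomial, smul_mul_assoc, mul_assoc]
    rw [mul_comm]

lemma adjoint_del_mul (Q : PDO D) :
    adjoint (monomial D 1 1 * Q) = -(adjoint Q * monomial D 1 1) := by
  refine eq_of_monomial ((adjointHom D).comp (AddMonoidHom.mulLeft (monomial D 1 1)))
    (-((AddMonoidHom.mulRight (monomial D 1 1)).comp (adjointHom D))) 1 ?_ ?_ ?_ Q
  · intro P N hP
    exact ((orderLE_monomial 1 1).mul hP).adjoint.mono (by omega)
  · intro P N hP
    exact (hP.adjoint.mul (orderLE_monomial 1 1)).neg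
  · intro b n
    simp only [AddMonoidHom.comp_apply, AddMonoidHom.coe_mulLeft, AddMonoidHom.neg_apply,
      AddMonoidHom.coe_mulRight, adjointHom_apply, del_mul_monomial, adjoint_add, adjoint_monomial,
      smul_mul_assoc, mul_assoc]
    rw [monomial_mul_monomial_one, zero_add, show monomial D b 1 = monomial D 1 1 * monomial D b 0 -
      monomial D (D b) 0 by rw [del_mul_monomial, zero_add, add_sub_cancel_right], mul_sub,
      ← mul_assoc, monomial_mul_monomial_one, Int.negOnePow_succ, smul_sub]
    simp only [Units.val_neg, neg_smul]
    abel

/-- The formal adjoint is an anti-homomorphism. -/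
theorem adjoint_mul (P Q : PDO D) : adjoint (P * Q) = adjoint Q * adjoint P := by
  have hinv : monomial D 1 1 * monomial D 1 (-1) = (1 : PDO D) := by
    rw [monomial_mul_monomial_one]; rfl
  have hd : ∀ (n : ℕ) (Q : PDO D), adjoint (monomial D 1 n * Q) =
      (((n : ℤ).negOnePow : ℤˣ) : ℤ) • (adjoint Q * monomial D 1 n) := by
    intro n
    induction n with
    | zero => intro Q; simp [← one_eq_monomial]
    | succ n ih =>
      intro Q
      rw [show monomial D (1 : R) ((n + 1 : ℕ) : ℤ) = monomial D 1 n * monomial D 1 1 by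
        rw [monomial_mul_monomial_one]; push_cast; rfl, mul_assoc, ih, adjoint_del_mul]
      push_cast
      rw [Int.negOnePow_succ, neg_mul, mul_assoc, monomial_mul_monomial_one,
        monomial_mul_monomial_one, add_comm (1 : ℤ)]
      simp
  have hd' : ∀ (n : ℤ) (Q : PDO D), adjoint (monomial D 1 n * Q) =
      (n.negOnePow : ℤ) • (adjoint Q * monomial D 1 n) := by
    intro n Q
    obtain ⟨k, rfl | rfl⟩ := n.eq_nat_or_neg
    · exact hd k Q
    · have h := hd k (monomial D 1 (-k) * Q)
      rw [← mul_assoc, monomial_mul_monomial_one, add_neg_cancel, ← one_eq_monomial, one_mul] at h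
      rw [h, smul_mul_assoc, mul_assoc, monomial_mul_monomial_one, add_neg_cancel,
        ← one_eq_monomial, mul_one, smul_smul, ← Units.val_mul, ← Int.negOnePow_add]
      simp
  obtain ⟨B, hB⟩ := Q.exists_orderLE
  refine eq_of_monomial ((adjointHom D).comp (AddMonoidHom.mulRight Q))
    ((AddMonoidHom.mulLeft (adjoint Q)).comp (adjointHom D)) B ?_ ?_ ?_ P
  · intro P N hP
    exact (hP.mul hB).adjoint
  · intro P N hP
    exact (hB.adjoint.mul hP.adjoint).mono (by omega)
  · intro a n
    have e : monomial D a n = monomial D a 0 * monomial D 1 n := by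
      rw [monomial_mul_monomial_one, zero_add]
    simp only [AddMonoidHom.comp_apply, AddMonoidHom.coe_mulLeft, AddMonoidHom.coe_mulRight,
      adjointHom_apply]
    rw [adjoint_monomial, e, mul_assoc, adjoint_monomial_zero_mul, hd', smul_mul_assoc, mul_assoc,
      mul_smul_comm]

/-- The formal adjoint is an involution. -/
theorem adjoint_adjoint (P : PDO D) : adjoint (adjoint P) = P := by
  refine eq_of_monomial ((adjointHom D).comp (adjointHom D)) (AddMonoidHom.id _) 0 ?_ ?_ ?_ P
  · intro P N hP
    exact hP.adjoint.adjoint.mono (by omega)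
  · intro P N hP
    exact hP.mono (by omega)
  · intro a n
    simp only [AddMonoidHom.comp_apply, adjointHom_apply, AddMonoidHom.id_apply]
    rw [adjoint_monomial, adjoint_zsmul, adjoint_mul, adjoint_monomial_zero, adjoint_monomial_one,
      mul_smul_comm, smul_smul, monomial_mul_monomial_one, zero_add, ← Units.val_mul,
      ← Int.negOnePow_add]
    simp

lemma adjoint_one : adjoint (1 : PDO D) = 1 := adjoint_monomial_zero 1

/-! ### Derivations acting on coefficients -/

@[simp] lemma coeff_deriveCoeffs (δ : Derivation ℂ R R) (P : PDO D) (n : ℤ) :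
    (deriveCoeffs δ P).coeff n = δ (P.coeff n) := rfl

lemma iterate_comm (δ : Derivation ℂ R R) (h : ∀ f, δ (D f) = D (δ f)) (p : ℕ) (f : R) :
    δ (D^[p] f) = D^[p] (δ f) := by
  induction p with
  | zero => rfl
  | succ p ih => rw [Function.iterate_succ_apply', h, ih, Function.iterate_succ_apply']

lemma OrderLE.deriveCoeffs {P : PDO D} {A : ℤ} (hP : P.OrderLE A) (δ : Derivation ℂ R R) :
    (P.deriveCoeffs δ).OrderLE A := fun n hn => by
  rw [coeff_deriveCoeffs, hP n hn, map_zero]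

lemma deriveCoeffs_add (δ : Derivation ℂ R R) (P Q : PDO D) :
    deriveCoeffs δ (P + Q) = deriveCoeffs δ P + deriveCoeffs δ Q := by
  ext n
  simp

lemma deriveCoeffs_sum {ι : Type*} (δ : Derivation ℂ R R) (s : Finset ι) (f : ι → PDO D) :
    deriveCoeffs δ (∑ i ∈ s, f i) = ∑ i ∈ s, deriveCoeffs δ (f i) := by
  ext n
  simp [coeff_sum]

lemma deriveCoeffs_mul (δ : Derivation ℂ R R) (h : ∀ f, δ (D f) = D (δ f)) (P Q : PDO D) :
    deriveCoeffs δ (P * Q) = deriveCoeffs δ P * Q + P * deriveCoeffs δ Q := by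
  obtain ⟨A, hA⟩ := P.exists_orderLE
  obtain ⟨B, hB⟩ := Q.exists_orderLE
  ext n
  have hM : A + B - n < ((A + B - n + 1).toNat : ℤ) := by omega
  rw [coeff_deriveCoeffs, coeff_add, coeff_mul_eq P Q hA hB n _ _ le_rfl hM,
    coeff_mul_eq _ Q (hA.deriveCoeffs δ) hB n _ _ le_rfl hM,
    coeff_mul_eq P _ hA (hB.deriveCoeffs δ) n _ _ le_rfl hM]
  simp only [map_sum, map_zsmul, Derivation.leibniz, smul_eq_mul, coeff_deriveCoeffs,
    iterate_comm δ h, smul_add, Finset.sum_add_distrib]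
  rw [add_comm]
  congr 1
  refine Finset.sum_congr rfl fun i _ => Finset.sum_congr rfl fun p _ => ?_
  rw [mul_comm]

lemma deriveCoeffs_adjoint (δ : Derivation ℂ R R) (h : ∀ f, δ (D f) = D (δ f)) (P : PDO D) :
    deriveCoeffs δ (adjoint P) = adjoint (deriveCoeffs δ P) := by
  obtain ⟨A, hA⟩ := P.exists_orderLE
  ext n
  have hM : A - n < ((A - n + 1).toNat : ℤ) := by omega
  rw [coeff_deriveCoeffs, coeff_adjoint P hA n _ hM, coeff_adjoint _ (hA.deriveCoeffs δ) n _ hM]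
  simp only [map_sum, map_zsmul, coeff_deriveCoeffs, iterate_comm δ h]

/-! ### Wave symbols -/

lemma coeff_waveSymbol (s : ℤˣ) (P : PDO D) (m : ℤ) :
    (P.waveSymbol s).coeff m = ((s ^ m : ℤˣ) : ℤ) • P.coeff (-m) := rfl

lemma coeff_waveSymbol_eq_mul (s : ℤˣ) (P : PDO D) (m : ℤ) :
    (P.waveSymbol s).coeff m = (((s ^ m : ℤˣ) : ℤ) : R) * P.coeff (-m) := by
  rw [coeff_waveSymbol, zsmul_eq_mul]

/-- The operator with a given wave symbol. -/
noncomputable def ofSymbol (D : Derivation ℂ R R) (s : ℤˣ) (F : LaurentSeries R) : PDO D where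
  coeff m := ((s ^ m : ℤˣ) : ℤ) • F.coeff (-m)
  bdd := by
    refine ⟨-F.order, fun n hn => ?_⟩
    rw [HahnSeries.coeff_eq_zero_of_lt_order (by omega), smul_zero]

lemma waveSymbol_ofSymbol (s : ℤˣ) (F : LaurentSeries R) :
    (ofSymbol D s F).waveSymbol s = F := by
  ext m
  rw [coeff_waveSymbol]
  change _ • (_ • F.coeff (- -m)) = _
  rw [smul_smul, ← Units.val_mul, ← zpow_add, add_neg_cancel, neg_neg]
  simp

/-- The wave symbol as an additive map. -/
noncomputable def waveSymbolHom (D : Derivation ℂ R R) (s : ℤˣ) : PDO D →+ LaurentSeries R where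
  toFun := waveSymbol s
  map_zero' := by ext m; simp [coeff_waveSymbol]
  map_add' P Q := by ext m; simp [coeff_waveSymbol, smul_add]

@[simp] lemma waveSymbolHom_apply (s : ℤˣ) (P : PDO D) : waveSymbolHom D s P = P.waveSymbol s := rfl

lemma waveSymbol_injective (s : ℤˣ) : Function.Injective (waveSymbol s : PDO D → _) := by
  intro P Q h
  ext m
  have := congrArg (fun F => HahnSeries.coeff F (-m)) h
  simp only [coeff_waveSymbol, neg_neg] at this
  have h2 := congrArg (((s ^ m : ℤˣ) : ℤ) • ·) this
  simpa only [smul_smul, ← Units.val_mul, ← zpow_add, add_neg_cancel, zpow_zero, Units.val_one,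
    one_smul] using h2

lemma waveSymbol_mul_monomial_one (P : PDO D) (n : ℤ) :
    (P * monomial D 1 n).waveSymbol 1 = P.waveSymbol 1 * HahnSeries.single (-n) 1 := by
  ext m
  rw [coeff_waveSymbol, coeff_mul_monomial_one, HahnSeries.coeff_mul_single, coeff_waveSymbol]
  simp [show -m - n = -(m - -n) by ring]

lemma coeff_waveSymbol_del_mul (Q : PDO D) (m : ℤ) :
    ((monomial D 1 1 * Q).waveSymbol (-1)).coeff m =
      D ((Q.waveSymbol (-1)).coeff m) - (Q.waveSymbol (-1)).coeff (m + 1) := by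
  rw [coeff_waveSymbol, coeff_del_mul, coeff_waveSymbol, coeff_waveSymbol, zpow_add, map_zsmul,
    smul_add, show -m - 1 = -(m + 1) by ring]
  simp
  abel

lemma waveSymbol_monomial (s : ℤˣ) (a : R) (n : ℤ) :
    (monomial D a n).waveSymbol s = HahnSeries.single (-n) (((s ^ n : ℤˣ) : ℤ) • a) := by
  ext m
  rw [coeff_waveSymbol, coeff_monomial, HahnSeries.coeff_single]
  by_cases h : m = -n
  · subst h
    simp
  · rw [if_neg (by omega), if_neg h, smul_zero]

lemma OrderLE.coeff_waveSymbol {P : PDO D} {A : ℤ} (hP : P.OrderLE A) (s : ℤˣ) (n : ℤ)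
    (hn : n < -A) : (P.waveSymbol s).coeff n = 0 := by
  rw [PDO.coeff_waveSymbol, hP _ (by omega), smul_zero]

/-- The residue of `(P e^{ξ}) (Q e^{-ξ})` in `z` is the coefficient of `∂⁻¹` in `P Q^*`. -/
theorem residue_eq (P Q : PDO D) :
    (P.waveSymbol 1 * Q.waveSymbol (-1)).coeff 1 = (P * adjoint Q).coeff (-1) := by
  have key : ∀ P Q : PDO D, ∀ A B, P.OrderLE A → Q.OrderLE B → A + B < -1 →
      (P.waveSymbol 1 * Q.waveSymbol (-1)).coeff 1 - (P * adjoint Q).coeff (-1) = 0 := by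
    intro P Q A B hP hQ h
    rw [coeff_mul_eq_zero_of_lt (hP.coeff_waveSymbol 1) (hQ.coeff_waveSymbol (-1)) 1 (by omega),
      hP.mul hQ.adjoint _ h, sub_zero]
  let T (Q : PDO D) : PDO D →+ R :=
    AddMonoidHom.mk' (fun P => (P.waveSymbol 1 * Q.waveSymbol (-1)).coeff 1 -
      (P * adjoint Q).coeff (-1)) fun P P' => by
        simp only [← waveSymbolHom_apply, map_add, add_mul, HahnSeries.coeff_add, coeff_add]
        abel
  let S (P : PDO D) : PDO D →+ R :=
    AddMonoidHom.mk' (fun Q => (P.waveSymbol 1 * Q.waveSymbol (-1)).coeff 1 -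
      (P * adjoint Q).coeff (-1)) fun Q Q' => by
        simp only [← waveSymbolHom_apply, map_add, mul_add, HahnSeries.coeff_add, coeff_add,
          adjoint_add]
        abel
  -- both sides vanish for operators of low order, so it suffices to compare them on monomials
  rw [← sub_eq_zero]
  obtain ⟨B, hB⟩ := Q.exists_orderLE
  refine addMonoidHom_eq_zero (T Q) (-1 - B - 1) (fun P hP => key P Q _ _ hP hB (by omega)) ?_ P
  intro a i
  refine addMonoidHom_eq_zero (S (monomial D a i)) (-1 - i - 1)
    (fun Q hQ => key _ Q _ _ (orderLE_monomial a i) hQ (by omega)) ?_ Q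
  intro b j
  change ((monomial D a i).waveSymbol 1 * (monomial D b j).waveSymbol (-1)).coeff 1 -
      (monomial D a i * adjoint (monomial D b j)).coeff (-1) = 0
  rw [waveSymbol_monomial, waveSymbol_monomial, HahnSeries.single_mul_single,
    HahnSeries.coeff_single, adjoint_monomial, mul_smul_comm _ (monomial D a i), coeff_zsmul,
    ← mul_assoc, monomial_mul_monomial_one,
    show monomial D a (i + j) = monomial D a 0 * monomial D 1 (i + j) by
      rw [monomial_mul_monomial_one, zero_add], mul_assoc, coeff_monomial_zero_mul,
    coeff_monomial_one_mul_monomial_zero]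
  by_cases h : i + j = -1
  · rw [if_pos (by omega), if_pos (by omega), h]
    simp [Int.negOnePow, mul_left_comm]
  · rw [if_neg (by omega)]
    split_ifs with h'
    · obtain ⟨k, hk⟩ := Int.eq_ofNat_of_zero_le (show 0 ≤ i + j by omega)
      -- `∂ᵏ ∘ b` is a differential operator for `k ≥ 0`: the binomial `k choose k + 1` vanishes
      have : Ring.choose (i + j) (i + j - -1).toNat = 0 := by
        rw [hk, Ring.choose_natCast, Nat.choose_eq_zero_of_lt (by omega), Nat.cast_zero]
      rw [this]
      simp
    · simp

end PDO

namespace AffineSL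

open PDO

variable {ℓ : ℕ}

/-! ### Matrix pseudo-differential operators -/

/-- All entries of `P` have order at most `N`. -/
def MatOrderLE (P : MatPDO ℓ) (N : ℤ) : Prop := ∀ i j, (P i j).OrderLE N

lemma MatOrderLE.mul {P Q : MatPDO ℓ} {A B : ℤ} (hP : MatOrderLE P A) (hQ : MatOrderLE Q B) :
    MatOrderLE (P * Q) (A + B) := fun i j => by
  rw [Matrix.mul_apply]
  exact orderLE_sum _ _ fun k _ => (hP i k).mul (hQ k j)

lemma MatOrderLE.add {P Q : MatPDO ℓ} {A : ℤ} (hP : MatOrderLE P A) (hQ : MatOrderLE Q A) :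
    MatOrderLE (P + Q) A := fun i j => (hP i j).add (hQ i j)

lemma MatOrderLE.neg {P : MatPDO ℓ} {A : ℤ} (hP : MatOrderLE P A) :
    MatOrderLE (-P) A := fun i j => (hP i j).neg

lemma MatOrderLE.mono {P : MatPDO ℓ} {A B : ℤ} (hP : MatOrderLE P A) (h : A ≤ B) :
    MatOrderLE P B := fun i j => (hP i j).mono h

lemma matOrderLE_one : MatOrderLE (1 : MatPDO ℓ) 0 := fun i j => by
  rw [Matrix.one_apply]
  split_ifs
  · exact orderLE_one
  · exact orderLE_zero 0

lemma MatOrderLE.pow {P : MatPDO ℓ} (hP : MatOrderLE P (-1)) (k : ℕ) : MatOrderLE (P ^ k) (-k) := by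
  induction k with
  | zero => exact matOrderLE_one
  | succ k ih =>
    rw [pow_succ]
    exact (ih.mul hP).mono (by push_cast; omega)

lemma eq_zero_of_matOrderLE {P : MatPDO ℓ} (h : ∀ K : ℕ, MatOrderLE P (-K)) : P = 0 := by
  ext i j n
  exact h ((-n).toNat + 1) i j n (by push_cast; omega)

/-- An operator `1 - X` with `X` of negative order is inverted by the geometric series, whose
coefficients are finite sums. -/
lemma exists_inverse_one_sub {X : MatPDO ℓ} (hX : MatOrderLE X (-1)) :
    ∃ S : MatPDO ℓ, (1 - X) * S = 1 ∧ S * (1 - X) = 1 ∧ MatOrderLE (S - 1) (-1) := by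
  let S : MatPDO ℓ := Matrix.of fun i j =>
    { coeff := fun m => ∑ k ∈ Finset.range ((1 - m).toNat), ((X ^ k) i j).coeff m
      bdd := ⟨0, fun m hm => by rw [show (1 - m).toNat = 0 by omega, Finset.sum_range_zero]⟩ }
  have hS : ∀ K : ℕ, MatOrderLE (S - ∑ k ∈ Finset.range K, X ^ k) (-K) := by
    intro K i j m hm
    rw [Matrix.sub_apply, PDO.coeff_sub, Matrix.sum_apply, PDO.coeff_sum, sub_eq_zero]
    change ∑ k ∈ Finset.range ((1 - m).toNat), ((X ^ k) i j).coeff m = _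
    refine Finset.sum_subset (fun k hk => ?_) fun k _ hk => hX.pow k i j m ?_
    · rw [Finset.mem_range] at hk ⊢
      omega
    · rw [Finset.mem_range] at hk
      omega
  have h1 : MatOrderLE (1 - X) 0 := by
    rw [sub_eq_add_neg]
    exact matOrderLE_one.add (hX.neg.mono (by omega))
  have hl : (1 - X) * S = 1 := by
    rw [← sub_eq_zero]
    refine eq_zero_of_matOrderLE fun K => ?_
    rw [show (1 - X) * S - 1 = (1 - X) * (S - ∑ k ∈ Finset.range K, X ^ k) + -X ^ K by
      rw [mul_sub (1 - X) S, mul_neg_geom_sum]; abel]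
    exact ((h1.mul (hS K)).mono (by omega)).add (hX.pow K).neg
  have hr : S * (1 - X) = 1 := by
    rw [← sub_eq_zero]
    refine eq_zero_of_matOrderLE fun K => ?_
    rw [show S * (1 - X) - 1 = (S - ∑ k ∈ Finset.range K, X ^ k) * (1 - X) + -X ^ K by
      rw [sub_mul S, geom_sum_mul_neg]; abel]
    exact (((hS K).mul h1).mono (by omega)).add (hX.pow K).neg
  refine ⟨S, hl, hr, ?_⟩
  have := hS 1
  rwa [Finset.sum_range_one, pow_zero] at this

/-- `P = 1 + ` terms with negative powers of `∂`. -/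
def IsMonic (P : MatPDO ℓ) : Prop := MatOrderLE (P - 1) (-1)

lemma IsMonic.matOrderLE {P : MatPDO ℓ} (h : IsMonic P) : MatOrderLE P 0 := by
  rw [← sub_add_cancel P 1]
  exact (MatOrderLE.mono h (by omega)).add matOrderLE_one

lemma IsMonic.mul {P Q : MatPDO ℓ} (hP : IsMonic P) (hQ : IsMonic Q) : IsMonic (P * Q) := by
  have e : P * Q - 1 = P * (Q - 1) + (P - 1) := by noncomm_ring
  rw [IsMonic, e]
  exact ((hP.matOrderLE.mul hQ).mono (by omega)).add hP

lemma IsMonic.exists_inverse {P : MatPDO ℓ} (h : IsMonic P) :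
    ∃ S : MatPDO ℓ, P * S = 1 ∧ S * P = 1 ∧ IsMonic S := by
  have h' := exists_inverse_one_sub (MatOrderLE.neg h)
  rwa [neg_sub, sub_sub_cancel] at h'

lemma IsMonic.isUnit {P : MatPDO ℓ} (h : IsMonic P) : IsUnit P := by
  obtain ⟨S, hl, hr, -⟩ := h.exists_inverse
  exact ⟨⟨P, S, hl, hr⟩, rfl⟩

lemma IsMonic.inverse {P : MatPDO ℓ} (h : IsMonic P) : IsMonic (Ring.inverse P) := by
  obtain ⟨S, hl, hr, hS⟩ := h.exists_inverse
  have : Ring.inverse P = S := Ring.inverse_unit ⟨P, S, hl, hr⟩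
  rwa [this]

lemma adjointM_mul (P Q : MatPDO ℓ) : adjointM (P * Q) = adjointM Q * adjointM P := by
  ext1 i j
  simp only [adjointM, Matrix.transpose_apply, Matrix.map_apply, Matrix.mul_apply, adjoint_sum,
    adjoint_mul]

lemma adjointM_adjointM (P : MatPDO ℓ) : adjointM (adjointM P) = P := by
  ext1 i j
  simp only [adjointM, Matrix.transpose_apply, Matrix.map_apply, adjoint_adjoint]

lemma adjointM_one : adjointM (1 : MatPDO ℓ) = 1 := by
  ext1 i j
  simp only [adjointM, Matrix.transpose_apply, Matrix.map_apply, Matrix.one_apply, eq_comm (a := j)]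
  split_ifs
  · exact adjoint_one
  · exact map_zero (adjointHom _)

lemma adjointM_sub (P Q : MatPDO ℓ) : adjointM (P - Q) = adjointM P - adjointM Q := by
  ext1 i j
  exact map_sub (adjointHom (del ℓ)) (P j i) (Q j i)

lemma MatOrderLE.adjointM {P : MatPDO ℓ} {A : ℤ} (h : MatOrderLE P A) :
    MatOrderLE (adjointM P) A := fun i j => (h j i).adjoint

lemma IsMonic.adjointM {P : MatPDO ℓ} (h : IsMonic P) : IsMonic (adjointM P) := by
  have := MatOrderLE.adjointM h
  rwa [adjointM_sub, adjointM_one] at this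

lemma isUnit_adjointM {P : MatPDO ℓ} (h : IsUnit P) : IsUnit (adjointM P) := by
  obtain ⟨u, rfl⟩ := h
  refine ⟨⟨adjointM u, adjointM (u⁻¹ : (MatPDO ℓ)ˣ), ?_, ?_⟩, rfl⟩
  · rw [← adjointM_mul, Units.inv_mul, adjointM_one]
  · rw [← adjointM_mul, Units.mul_inv, adjointM_one]

lemma adjointM_inverse {P : MatPDO ℓ} (h : IsUnit P) :
    Ring.inverse (adjointM P) = adjointM (Ring.inverse P) := by
  have h' := isUnit_adjointM h
  rw [← h'.mul_right_inj, Ring.mul_inverse_cancel _ h', ← adjointM_mul,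
    Ring.inverse_mul_cancel _ h, adjointM_one]

lemma negM_eq_iff {P Q : MatPDO ℓ} :
    negM P = negM Q ↔ ∀ i j, ∀ p : ℕ, (P i j).coeff (-1 - p) = (Q i j).coeff (-1 - p) := by
  constructor
  · intro h i j p
    have := congrArg (fun M : MatPDO ℓ => (M i j).coeff (-1 - p)) h
    simpa only [negM, Matrix.map_apply, PDO.negPart, if_pos (show (-1 - p : ℤ) < 0 by omega)]
      using this
  · intro h
    ext i j n
    simp only [negM, Matrix.map_apply, PDO.negPart]
    split_ifs with hn
    · have := h i j (-1 - n).toNat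
      rwa [show (-1 - ((-1 - n).toNat : ℤ)) = n by omega] at this
    · rfl

lemma negM_zero : negM (0 : MatPDO ℓ) = 0 := by
  ext i j n
  simp [negM, PDO.negPart]

lemma negM_neg (P : MatPDO ℓ) : negM (-P) = -negM P := by
  ext i j n
  simp only [negM, Matrix.map_apply, PDO.negPart, Matrix.neg_apply, coeff_neg]
  split_ifs <;> simp

lemma negM_eq_self {P : MatPDO ℓ} (h : MatOrderLE P (-1)) : negM P = P := by
  ext i j n
  simp only [negM, Matrix.map_apply, PDO.negPart]
  split_ifs with hn
  · rfl
  · rw [h i j n (by omega)]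

lemma posM_add_negM (P : MatPDO ℓ) : posM P + negM P = P := by
  ext i j n
  simp only [negM, posM, Matrix.map_apply, PDO.negPart, PDO.posPart, Matrix.add_apply, coeff_add]
  split_ifs with h1 h2 h2
  · omega
  · simp
  · simp
  · omega

/-- An operator of order `0` with leading coefficient `1` and no negative part is `1`. -/
lemma eq_one_of_negM_eq_zero {P : MatPDO ℓ} (h : negM P = 0) (h1 : IsMonic P) :
    P = 1 := by
  rw [← sub_eq_zero, ← negM_eq_self h1, ← negM_zero, negM_eq_iff]
  rw [← negM_zero, negM_eq_iff] at h
  intro i j p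
  have h2 : ((1 : MatPDO ℓ) i j).coeff (-1 - p) = 0 := by
    rw [Matrix.one_apply]
    split_ifs
    · rw [coeff_one, if_neg (by omega)]
    · rfl
  rw [Matrix.sub_apply, PDO.coeff_sub, h i j p, h2, Matrix.zero_apply, coeff_zero, sub_zero]

lemma delPow_mul_apply (p : ℕ) (B : MatPDO ℓ) (s k : Fin ℓ) :
    (delPow p * B : MatPDO ℓ) s k = monomial (del ℓ) 1 p * B s k := by
  rw [delPow, Matrix.diagonal_mul]

lemma delPow_succ (p : ℕ) : (delPow (p + 1) : MatPDO ℓ) = delPow 1 * delPow p := by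
  rw [delPow, delPow, delPow, Matrix.diagonal_mul_diagonal]
  congr 1
  funext _
  rw [monomial_mul_monomial_one, add_comm]
  push_cast
  rfl

lemma delPow_zero : (delPow 0 : MatPDO ℓ) = 1 := Matrix.diagonal_one

lemma delPow_eq_pow (p : ℕ) : (delPow p : MatPDO ℓ) = delPow 1 ^ p := by
  induction p with
  | zero => rw [delPow_zero, pow_zero]
  | succ p ih => rw [delPow_succ, ih, pow_succ']

lemma unitE_mul_delPow (i : Fin ℓ) (p : ℕ) :
    (unitE i * delPow p : MatPDO ℓ) = delPow p * unitE i := by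
  ext1 r s
  rw [delPow, Matrix.diagonal_mul, Matrix.mul_diagonal, unitE]
  by_cases h : i = r ∧ i = s
  · obtain ⟨rfl, rfl⟩ := h
    simp
  · rw [Matrix.single_apply, if_neg h, zero_mul, mul_zero]

lemma unitE_mul_unitE_comm (i j : Fin ℓ) : (unitE i * unitE j : MatPDO ℓ) = unitE j * unitE i := by
  by_cases h : i = j
  · rw [h]
  · rw [unitE, unitE, Matrix.single_mul_single_of_ne _ _ _ _ h,
      Matrix.single_mul_single_of_ne _ _ _ _ (Ne.symm h)]

/-- The residue of a product of wave symbols reads off the negative part of `A B^*`. -/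
lemma coeff_mul_adjointM (A B : MatPDO ℓ) (r s : Fin ℓ) (p : ℕ) :
    ∑ k, ((A r k).waveSymbol 1 * ((delPow p * B : MatPDO ℓ) s k).waveSymbol (-1)).coeff 1 =
      (((p : ℤ).negOnePow : ℤ) • (A * adjointM B) r s).coeff (-1 - p) := by
  rw [Matrix.mul_apply, Finset.smul_sum, coeff_sum]
  refine Finset.sum_congr rfl fun k _ => ?_
  rw [delPow_mul_apply, residue_eq, adjoint_mul, adjoint_monomial_one, mul_smul_comm, mul_smul_comm,
    coeff_zsmul, coeff_zsmul, ← mul_assoc, coeff_mul_monomial_one]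
  rfl

end AffineSL

/-! ### Flows of derivations -/

namespace FormalFunction

open Finset.HasAntidiagonal (antidiagonal mem_antidiagonal)

lemma succ_nsmul_sum_antidiagonal {A : Type*} [AddCommMonoid A] (n : ℕ) (F : ℕ → ℕ → A) :
    (n + 1) • ∑ x ∈ antidiagonal (n + 1), F x.1 x.2 =
      ∑ x ∈ antidiagonal n, (x.1 + 1) • F (x.1 + 1) x.2 +
        ∑ x ∈ antidiagonal n, (x.2 + 1) • F x.1 (x.2 + 1) := by
  have h : (n + 1) • ∑ x ∈ antidiagonal (n + 1), F x.1 x.2 =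
      ∑ x ∈ antidiagonal (n + 1), x.1 • F x.1 x.2 +
        ∑ x ∈ antidiagonal (n + 1), x.2 • F x.1 x.2 := by
    rw [Finset.smul_sum, ← Finset.sum_add_distrib]
    refine Finset.sum_congr rfl fun x hx => ?_
    rw [mem_antidiagonal] at hx
    rw [← add_smul, hx]
  rw [h, Finset.Nat.sum_antidiagonal_succ, Finset.Nat.sum_antidiagonal_succ']
  simp

lemma sum_antidiagonal_assoc {A : Type*} [AddCommMonoid A] (n : ℕ) (G : ℕ → ℕ → ℕ → A) :
    ∑ x ∈ antidiagonal n, ∑ y ∈ antidiagonal x.1, G y.1 y.2 x.2 =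
      ∑ x ∈ antidiagonal n, ∑ y ∈ antidiagonal x.2, G x.1 y.1 y.2 := by
  rw [Finset.sum_sigma', Finset.sum_sigma']
  refine Finset.sum_bij' (fun x _ => ⟨(x.2.1, x.2.2 + x.1.2), (x.2.2, x.1.2)⟩)
    (fun x _ => ⟨(x.1.1 + x.2.1, x.2.2), (x.1.1, x.2.1)⟩) ?_ ?_ ?_ ?_ ?_
  · rintro ⟨⟨a, b⟩, ⟨c, d⟩⟩ h
    simp only [Finset.mem_sigma, mem_antidiagonal, and_true] at h ⊢
    omega
  · rintro ⟨⟨a, b⟩, ⟨c, d⟩⟩ h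
    simp only [Finset.mem_sigma, mem_antidiagonal, and_true] at h ⊢
    omega
  · rintro ⟨⟨a, b⟩, ⟨c, d⟩⟩ h
    simp only [Finset.mem_sigma, mem_antidiagonal] at h ⊢
    obtain ⟨-, rfl⟩ := h
    rfl
  · rintro ⟨⟨a, b⟩, ⟨c, d⟩⟩ h
    simp only [Finset.mem_sigma, mem_antidiagonal] at h ⊢
    obtain ⟨-, rfl⟩ := h
    rfl
  · intros
    rfl

section Flow

variable {A B : Type*} [AddCommGroup A] [Module ℂ A] [AddCommGroup B] [Module ℂ B]

/-- The coefficients `uₙ` of the formal flow `∑ₙ uₙ tⁿ = exp (∑_{p ≥ 0} d_p t^{p+1} / (p+1))` of a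
sequence of commuting operators `d_p`, defined by the recursion
`(n + 1) u_{n+1} = ∑_{p ≤ n} u_{n-p} ∘ d_p`. For `d_p = s ∂/∂x_{p+1}^{(k)}` it is the
substitution `f(x) ↦ f(x + s [z⁻¹]^{(k)})` with `t = z⁻¹`. -/
noncomputable def flow (d : ℕ → A →+ A) : ℕ → A →+ A
  | 0 => AddMonoidHom.id A
  | n + 1 => (((n + 1 : ℕ) : ℂ)⁻¹) • ∑ p : Fin (n + 1), (flow d (n - p)).comp (d p)
  decreasing_by omega

@[simp] lemma flow_zero (d : ℕ → A →+ A) (f : A) : flow d 0 f = f := by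
  rw [flow, AddMonoidHom.id_apply]

lemma flow_succ (d : ℕ → A →+ A) (n : ℕ) (f : A) :
    (n + 1) • flow d (n + 1) f = ∑ x ∈ antidiagonal n, flow d x.2 (d x.1 f) := by
  rw [flow, AddMonoidHom.smul_apply, ← Nat.cast_smul_eq_nsmul ℂ, smul_smul,
    mul_inv_cancel₀ (by exact_mod_cast n.succ_ne_zero), one_smul, AddMonoidHom.finsetSum_apply,
    Finset.Nat.sum_antidiagonal_eq_sum_range_succ_mk, Finset.sum_range]
  rfl

lemma nsmul_succ_injective (n : ℕ) : Function.Injective (fun a : A => (n + 1) • a) := by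
  intro a b h
  simp only [← Nat.cast_smul_eq_nsmul ℂ] at h
  exact smul_right_injective A (r := ((n + 1 : ℕ) : ℂ)) (by exact_mod_cast n.succ_ne_zero) h

/-- A sequence of maps satisfying the recursion of a flow is that flow. -/
lemma eq_flow {X : Type*} (e : ℕ → B →+ B) (u : ℕ → X → B) (d : ℕ → X → X) (ψ : X → B)
    (h0 : ∀ f, u 0 f = ψ f)
    (hsucc : ∀ n f, (n + 1) • u (n + 1) f = ∑ x ∈ antidiagonal n, u x.2 (d x.1 f))
    (hd : ∀ p f, ψ (d p f) = e p (ψ f)) (n : ℕ) (f : X) : u n f = flow e n (ψ f) := by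
  induction n using Nat.strong_induction_on generalizing f with
  | _ n ih =>
    cases n with
    | zero => rw [h0, flow_zero]
    | succ n =>
      apply nsmul_succ_injective n
      change (n + 1) • u (n + 1) f = (n + 1) • flow e (n + 1) (ψ f)
      rw [hsucc, flow_succ]
      refine Finset.sum_congr rfl fun x hx => ?_
      rw [mem_antidiagonal] at hx
      rw [ih x.2 (by omega), hd]

lemma map_flow (φ : A →+ B) (d : ℕ → A →+ A) (e : ℕ → B →+ B)
    (hd : ∀ p f, φ (d p f) = e p (φ f)) (n : ℕ) (f : A) : φ (flow d n f) = flow e n (φ f) :=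
  eq_flow e (fun n f => φ (flow d n f)) (fun p => d p) φ (fun f => by rw [flow_zero])
    (fun n f => by rw [← map_nsmul, flow_succ, map_sum]) hd n f

lemma flow_comm (d : ℕ → A →+ A) (φ : A →+ A) (h : ∀ p f, φ (d p f) = d p (φ f)) (n : ℕ) (f : A) :
    flow d n (φ f) = φ (flow d n f) := (map_flow φ d d h n f).symm

/-- The flows of `d` and `-d` are inverse to each other. -/
lemma sum_flow_neg_flow (d : ℕ → A →+ A) (hc : ∀ p q f, d p (d q f) = d q (d p f)) (n : ℕ) (f : A) :
    ∑ x ∈ antidiagonal n, flow (fun p => -d p) x.1 (flow d x.2 f) = if n = 0 then f else 0 := by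
  cases n with
  | zero => simp
  | succ n =>
    rw [if_neg n.succ_ne_zero]
    apply nsmul_succ_injective n
    change (n + 1) • _ = (n + 1) • (0 : A)
    rw [succ_nsmul_sum_antidiagonal n (fun a b => flow (fun p => -d p) a (flow d b f)), smul_zero,
      Finset.sum_congr rfl fun x _ => flow_succ (fun p => -d p) x.1 _]
    have h2 : ∀ x ∈ antidiagonal n, (x.2 + 1) • flow (fun p => -d p) x.1 (flow d (x.2 + 1) f) =
        ∑ y ∈ antidiagonal x.2, flow (fun p => -d p) x.1 (d y.1 (flow d y.2 f)) := by
      intro x _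
      rw [← map_nsmul, flow_succ, map_sum]
      exact Finset.sum_congr rfl fun y _ => by rw [flow_comm d (d y.1) fun p f => hc _ _ _]
    rw [Finset.sum_congr rfl h2,
      ← sum_antidiagonal_assoc n fun a b c => flow (fun p => -d p) a (d b (flow d c f)),
      ← Finset.sum_add_distrib]
    refine Finset.sum_eq_zero fun x _ => ?_
    rw [← Finset.Nat.sum_antidiagonal_swap, ← Finset.sum_add_distrib]
    refine Finset.sum_eq_zero fun y _ => ?_
    simp

end Flow

section FlowRing

variable {A : Type*} [CommRing A] [Module ℂ A]

lemma flow_mul (d : ℕ → A →+ A) (hd : ∀ p f g, d p (f * g) = d p f * g + f * d p g) (n : ℕ)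
    (f g : A) : flow d n (f * g) = ∑ x ∈ antidiagonal n, flow d x.1 f * flow d x.2 g := by
  induction n using Nat.strong_induction_on generalizing f g with
  | _ n ih =>
    cases n with
    | zero => simp
    | succ n =>
      apply nsmul_succ_injective n
      change (n + 1) • _ = (n + 1) • _
      rw [succ_nsmul_sum_antidiagonal n (fun a b => flow d a f * flow d b g), flow_succ]
      have h1 : ∀ x ∈ antidiagonal n, flow d x.2 (d x.1 (f * g)) =
          ∑ y ∈ antidiagonal x.2, flow d y.1 (d x.1 f) * flow d y.2 g +
            ∑ y ∈ antidiagonal x.2, flow d y.1 f * flow d y.2 (d x.1 g) := by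
        intro x hx
        rw [mem_antidiagonal] at hx
        rw [hd, map_add, ih x.2 (by omega), ih x.2 (by omega)]
      rw [Finset.sum_congr rfl h1, Finset.sum_add_distrib]
      congr 1
      · rw [← sum_antidiagonal_assoc n fun a b c => flow d b (d a f) * flow d c g]
        refine Finset.sum_congr rfl fun x _ => ?_
        rw [← smul_mul_assoc, flow_succ, Finset.sum_mul]
      · rw [← sum_antidiagonal_assoc n fun a b c => flow d b f * flow d c (d a g)]
        have h2 : ∀ x ∈ antidiagonal n, (x.2 + 1) • (flow d x.1 f * flow d (x.2 + 1) g) =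
            ∑ y ∈ antidiagonal x.2, flow d x.1 f * flow d y.2 (d y.1 g) := by
          intro x _
          rw [← mul_smul_comm, flow_succ, Finset.mul_sum]
        rw [Finset.sum_congr rfl h2,
          ← sum_antidiagonal_assoc n fun a b c => flow d a f * flow d c (d b g)]
        refine Finset.sum_congr rfl fun x _ => ?_
        rw [← Finset.Nat.sum_antidiagonal_swap]
        rfl

lemma flow_const_mul (d : ℕ → A →+ A) (c : A) (h : ∀ p f, d p (c * f) = c * d p f) (n : ℕ)
    (f : A) : flow d n (c * f) = c * flow d n f :=
  flow_comm d (AddMonoidHom.mulLeft c) (fun p f => (h p f).symm) n f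

lemma flow_one (d : ℕ → A →+ A) (h : ∀ p, d p 1 = 0) (n : ℕ) (hn : n ≠ 0) : flow d n 1 = 0 := by
  obtain ⟨n, rfl⟩ := Nat.exists_eq_succ_of_ne_zero hn
  apply nsmul_succ_injective n
  change (n + 1) • flow d (n + 1) (1 : A) = (n + 1) • 0
  rw [flow_succ, smul_zero]
  exact Finset.sum_eq_zero fun x _ => by rw [h, map_zero]

end FlowRing

/-! ### Translations and shifts of formal power series -/

open MvPowerSeries

section

variable {σ τ M : Type*}

/-- `T f` vanishes as soon as finitely many coefficients of `f` do. -/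
def FinitelyDetermined [Zero M] (T : MvPowerSeries σ ℂ → M) : Prop :=
  ∃ s : Finset (σ →₀ ℕ), ∀ f, (∀ d ∈ s, coeff d f = 0) → T f = 0

/-- A finitely determined additive map that vanishes on polynomials is zero. -/
lemma FinitelyDetermined.eq_zero [AddCommGroup M] (T : MvPowerSeries σ ℂ →+ M)
    (hT : FinitelyDetermined T) (hpoly : ∀ p : MvPolynomial σ ℂ, T (p : MvPowerSeries σ ℂ) = 0)
    (f : MvPowerSeries σ ℂ) : T f = 0 := by
  classical
  obtain ⟨s, hs⟩ := hT
  have h := hs (f - ((∑ d ∈ s, MvPolynomial.monomial d (coeff d f) : MvPolynomial σ ℂ) :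
    MvPowerSeries σ ℂ)) fun d hd => by
      rw [map_sub, MvPolynomial.coeff_coe, MvPolynomial.coeff_sum]
      simp only [MvPolynomial.coeff_monomial]
      rw [Finset.sum_ite_eq', if_pos hd, sub_self]
  rwa [map_sub, hpoly, sub_zero] at h

lemma FinitelyDetermined.sub [AddGroup M] {S T : MvPowerSeries σ ℂ → M} (hS : FinitelyDetermined S)
    (hT : FinitelyDetermined T) : FinitelyDetermined (fun f => S f - T f) := by
  classical
  obtain ⟨s, hs⟩ := hS
  obtain ⟨t, ht⟩ := hT
  refine ⟨s ∪ t, fun f hf => ?_⟩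
  change S f - T f = 0
  rw [hs f fun d hd => hf d (Finset.mem_union_left _ hd),
    ht f fun d hd => hf d (Finset.mem_union_right _ hd), sub_zero]

lemma FinitelyDetermined.sum [AddCommMonoid M] {ι : Type*} (I : Finset ι)
    {T : ι → MvPowerSeries σ ℂ → M} (h : ∀ i, FinitelyDetermined (T i)) :
    FinitelyDetermined (fun f => ∑ i ∈ I, T i f) := by
  classical
  choose s hs using h
  refine ⟨I.biUnion s, fun f hf => Finset.sum_eq_zero fun i hi => hs i f fun d hd => hf d ?_⟩
  exact Finset.mem_biUnion.2 ⟨i, hi, hd⟩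

lemma FinitelyDetermined.comp_pderiv [Zero M] {T : MvPowerSeries σ ℂ → M}
    (hT : FinitelyDetermined T) (p : σ) : FinitelyDetermined (fun f => T (pderiv ℂ p f)) := by
  classical
  obtain ⟨s, hs⟩ := hT
  refine ⟨s.image (· + Finsupp.single p 1), fun f hf => hs _ fun d hd => ?_⟩
  rw [coeff_pderiv, hf _ (Finset.mem_image_of_mem _ hd), zero_mul]

lemma FinitelyDetermined.mul_left {T : MvPowerSeries σ ℂ → ℂ} (hT : FinitelyDetermined T) (c : ℂ) :
    FinitelyDetermined (fun f => c * T f) := by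
  obtain ⟨s, hs⟩ := hT
  exact ⟨s, fun f hf => by change c * T f = 0; rw [hs f hf, mul_zero]⟩

lemma finitelyDetermined_coeff (e : σ →₀ ℕ) :
    FinitelyDetermined (fun f : MvPowerSeries σ ℂ => coeff e f) :=
  ⟨{e}, fun _ hf => hf e (Finset.mem_singleton_self e)⟩

lemma finitelyDetermined_subst {a : σ → MvPowerSeries τ ℂ} (ha : HasSubst a) (e : τ →₀ ℕ) :
    FinitelyDetermined (fun f => coeff e (substAlgHom (R := ℂ) ha f)) := by
  -- the series with all coefficients equal to `1`
  let one : MvPowerSeries σ ℂ := fun _ => 1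
  have h : Set.Finite (Function.support fun d =>
      coeff d one • coeff e (d.prod fun s e => a s ^ e)) :=
    coeff_subst_finite ha one e
  refine ⟨h.toFinset, fun f hf => ?_⟩
  change coeff e (substAlgHom ha f) = 0
  rw [substAlgHom_apply, coeff_subst ha, ← finsum_zero (α := σ →₀ ℕ)]
  refine finsum_congr fun d => ?_
  by_cases hd : coeff e (d.prod fun s e => a s ^ e) = 0
  · rw [hd, smul_zero]
  · rw [hf d, zero_smul]
    refine h.mem_toFinset.2 ?_
    change (1 : ℂ) • coeff e (d.prod fun s e => a s ^ e) ≠ 0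
    rwa [one_smul]

lemma regroup_C (c : ℂ) : regroup (C c : MvPowerSeries (σ ⊕ τ) ℂ) = C (C c) := by
  classical
  ext b a
  have h : Finsupp.sumElim a b = 0 ↔ a = 0 ∧ b = 0 := by
    rw [DFunLike.ext_iff, Sum.forall, DFunLike.ext_iff, DFunLike.ext_iff]
    rfl
  rw [coeff_regroup, coeff_C, coeff_C]
  by_cases hb : b = 0
  · rw [if_pos hb, coeff_C]
    exact if_congr (h.trans (and_iff_left hb)) rfl rfl
  · rw [if_neg hb, if_neg (fun e => hb (h.1 e).2), map_zero]

lemma translateHom_C (c : ℂ) : translateHom (C c : MvPowerSeries σ ℂ) = C (C c) := by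
  change regroup (substAlgHom hasSubst_add (algebraMap ℂ _ c)) = _
  rw [AlgHom.commutes]
  exact regroup_C c

lemma translateHom_X (q : σ) : translateHom (X q : MvPowerSeries σ ℂ) = C (X q) + X q := by
  change regroup (substAlgHom hasSubst_add (X q)) = _
  rw [substAlgHom_X, map_add, regroup_X_inl, regroup_X_inr]

lemma pderiv_mul {R : Type*} [CommRing R] (p : σ) (f g : MvPowerSeries σ R) :
    pderiv R p (f * g) = f * pderiv R p g + g * pderiv R p f := by
  rw [Derivation.leibniz, smul_eq_mul, smul_eq_mul]

/-- Translation commutes with partial derivatives: `∂/∂yₚ (f(x + y)) = (∂f/∂xₚ)(x + y)`. -/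
lemma pderiv_translateHom (p : σ) (f : MvPowerSeries σ ℂ) :
    pderiv (MvPowerSeries σ ℂ) p (translateHom f) = translateHom (pderiv ℂ p f) := by
  classical
  let T : MvPowerSeries σ ℂ →+ MvPowerSeries σ (MvPowerSeries σ ℂ) :=
    AddMonoidHom.mk' (fun f => pderiv (MvPowerSeries σ ℂ) p (translateHom f) -
      translateHom (pderiv ℂ p f)) fun f g => by
        simp only [map_add]
        abel
  have hpoly : ∀ q : MvPolynomial σ ℂ, T (q : MvPowerSeries σ ℂ) = 0 := by
    intro q
    induction q using MvPolynomial.induction_on with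
    | C c =>
      change pderiv _ p (translateHom _) - translateHom (pderiv ℂ p _) = 0
      rw [MvPolynomial.coe_C, translateHom_C, pderiv_C, pderiv_C, map_zero, sub_zero]
    | add f g hf hg => rw [MvPolynomial.coe_add, map_add, hf, hg, add_zero]
    | mul_X f q hf =>
      change pderiv _ p (translateHom _) - translateHom (pderiv ℂ p _) = 0
      have hf : pderiv _ p (translateHom (f : MvPowerSeries σ ℂ)) =
        translateHom (pderiv ℂ p _) := sub_eq_zero.1 hf
      rw [MvPolynomial.coe_mul, MvPolynomial.coe_X, map_mul, pderiv_mul,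
        pderiv_mul, map_add, map_mul, map_mul, hf, translateHom_X, map_add, pderiv_C,
        zero_add, pderiv_X, pderiv_X, sub_eq_zero]
      by_cases h : p = q
      · subst h
        simp
      · rw [Pi.single_eq_of_ne (Ne.symm h), Pi.single_eq_of_ne (Ne.symm h), map_zero]
  rw [← sub_eq_zero]
  ext b a
  refine FinitelyDetermined.eq_zero (M := ℂ)
    (((coeff a).toAddMonoidHom.comp (coeff b).toAddMonoidHom).comp T) ?_
    (fun q => by
      change coeff a (coeff b (T q)) = 0
      rw [hpoly, map_zero, map_zero]) f
  have h1 : ∀ b, FinitelyDetermined (fun f : MvPowerSeries σ ℂ =>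
      coeff a (coeff b (translateHom f))) :=
    fun b => finitelyDetermined_subst hasSubst_add (Finsupp.sumElim a b)
  have h2 := ((h1 (b + Finsupp.single p 1)).mul_left ((b p : ℂ) + 1)).sub ((h1 b).comp_pderiv p)
  convert h2 using 2 with f
  change coeff a (coeff b (pderiv (MvPowerSeries σ ℂ) p (translateHom f) -
      translateHom (pderiv ℂ p f))) = _
  rw [map_sub, map_sub, coeff_pderiv, ← coeff_C_mul, mul_comm]
  simp

end

end FormalFunction

namespace FormalFunction

open Finset.HasAntidiagonal (antidiagonal mem_antidiagonal)
open MvPowerSeries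

section

variable {σ : Type*}

/-- A derivation along a ring homomorphism out of the fraction field is determined by its values
on power series. -/
lemma eq_zero_of_leibniz {B : Type*} [CommRing B]
    (T : FractionRing (MvPowerSeries σ ℂ) →+* B) (E : FractionRing (MvPowerSeries σ ℂ) →+ B)
    (hE : ∀ f g, E (f * g) = T f * E g + T g * E f)
    (h0 : ∀ a : MvPowerSeries σ ℂ, E (algebraMap _ _ a) = 0)
    (f : FractionRing (MvPowerSeries σ ℂ)) : E f = 0 := by
  obtain ⟨⟨a, b⟩, h⟩ := IsLocalization.surj (nonZeroDivisors (MvPowerSeries σ ℂ)) f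
  have h2 := congrArg E h
  rw [hE, h0, h0, mul_zero, zero_add] at h2
  have hu : IsUnit (T (algebraMap _ _ (b : MvPowerSeries σ ℂ))) :=
    (IsLocalization.map_units _ b).map T
  exact (hu.mul_right_eq_zero).1 h2

lemma partialDeriv_comm (p q : σ) (f : FractionRing (MvPowerSeries σ ℂ)) :
    partialDeriv p (partialDeriv q f) = partialDeriv q (partialDeriv p f) := by
  rw [← sub_eq_zero]
  refine eq_zero_of_leibniz (RingHom.id _)
    (AddMonoidHom.mk' (fun f => partialDeriv p (partialDeriv q f) -
      partialDeriv q (partialDeriv p f)) fun f g => by simp only [map_add]; abel) ?_ ?_ f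
  · intro f g
    simp only [AddMonoidHom.mk'_apply, Derivation.leibniz, map_add, smul_eq_mul, RingHom.id_apply]
    ring
  · intro a
    simp only [AddMonoidHom.mk'_apply, partialDeriv_algebraMap]
    rw [sub_eq_zero]
    congr 1
    ext d
    simp only [coeff_pderiv]
    rw [add_right_comm]
    by_cases h : p = q
    · subst h
      rfl
    · simp only [Finsupp.add_apply, Finsupp.single_eq_of_ne h,
        Finsupp.single_eq_of_ne (Ne.symm h), add_zero]
      ring

lemma taylor_algebraMap (f : MvPowerSeries σ ℂ) :
    taylor (algebraMap _ _ f) = MvPowerSeries.map (algebraMap _ _) (translateHom f) := by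
  rw [taylor, IsLocalization.lift_eq]
  rfl

lemma constantCoeff_taylor (f : FractionRing (MvPowerSeries σ ℂ)) :
    constantCoeff (taylor f) = f := by
  have : (constantCoeff.comp taylor) = RingHom.id (FractionRing (MvPowerSeries σ ℂ)) := by
    apply IsLocalization.ringHom_ext (nonZeroDivisors (MvPowerSeries σ ℂ))
    ext1 f
    rw [RingHom.comp_apply, RingHom.comp_apply, taylor_algebraMap, constantCoeff_map,
      constantCoeff_translateHom]
    rfl
  exact DFunLike.congr_fun this f

lemma taylor_ne_zero {f : FractionRing (MvPowerSeries σ ℂ)} (h : f ≠ 0) : taylor f ≠ 0 := by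
  intro h0
  apply h
  rw [← constantCoeff_taylor f, h0, map_zero]

lemma pderiv_map {R S : Type*} [CommRing R] [CommRing S] (φ : R →+* S) (p : σ)
    (f : MvPowerSeries σ R) :
    pderiv S p (MvPowerSeries.map φ f) = MvPowerSeries.map φ (pderiv R p f) := by
  ext d
  simp only [coeff_pderiv, MvPowerSeries.coeff_map, map_mul, map_add, map_natCast, map_one]

/-- Taylor expansion commutes with partial derivatives. -/
lemma pderiv_taylor (p : σ) (f : FractionRing (MvPowerSeries σ ℂ)) :
    pderiv _ p (taylor f) = taylor (partialDeriv p f) := by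
  rw [← sub_eq_zero]
  refine eq_zero_of_leibniz taylor
    (AddMonoidHom.mk' (fun f => pderiv _ p (taylor f) - taylor (partialDeriv p f))
      fun f g => by simp only [map_add]; abel) ?_ ?_ f
  · intro f g
    simp only [AddMonoidHom.mk'_apply, Derivation.leibniz, map_add, map_mul, smul_eq_mul]
    ring
  · intro a
    simp only [AddMonoidHom.mk'_apply, partialDeriv_algebraMap, taylor_algebraMap, pderiv_map,
      pderiv_translateHom, sub_self]

end

section Shift

variable {ι : Type*} [DecidableEq ι]

/-- `shift s k` as an algebra homomorphism. -/
noncomputable def shiftHom (s : ℂ) (k : ι) :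
    MvPowerSeries (ι × ℕ+) ℂ →ₐ[ℂ] PowerSeries (MvPowerSeries (ι × ℕ+) ℂ) :=
  (optionEquivLeft _ _).toAlgHom.comp (substAlgHom (R := ℂ) (hasSubst_shift s k))

lemma shiftHom_apply (s : ℂ) (k : ι) (f : MvPowerSeries (ι × ℕ+) ℂ) :
    shiftHom s k f = shift s k f := rfl

lemma finitelyDetermined_shift (s : ℂ) (k : ι) (a : ι × ℕ+ →₀ ℕ) (n : ℕ) :
    FinitelyDetermined (fun f : MvPowerSeries (ι × ℕ+) ℂ =>
      coeff a (PowerSeries.coeff n (shiftHom s k f))) := by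
  have := finitelyDetermined_subst (hasSubst_shift s k) (a.optionElim n)
  simp only [← coeff_coeff_optionEquivLeft] at this
  exact this

lemma shiftHom_C (s : ℂ) (k : ι) (c : ℂ) : shiftHom s k (C c) = PowerSeries.C (C c) := by
  change optionEquivLeft _ _ (substAlgHom (hasSubst_shift s k) (algebraMap ℂ _ c)) = _
  rw [AlgHom.commutes]
  exact optionEquivLeft_C c

lemma shiftHom_X (s : ℂ) (k : ι) (q : ι × ℕ+) : shiftHom s k (X q) = PowerSeries.C (X q) +
    if q.1 = k then PowerSeries.C (C (s / (q.2 : ℕ))) * PowerSeries.X ^ (q.2 : ℕ) else 0 := by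
  change optionEquivLeft _ _ (substAlgHom (hasSubst_shift s k) (X q)) = _
  rw [substAlgHom_X, map_add, optionEquivLeft_X_some]
  split_ifs
  · rw [map_mul, map_pow, optionEquivLeft_C, optionEquivLeft_X_none]
  · rw [map_zero]

lemma coeff_zero_shiftHom (s : ℂ) (k : ι) (f : MvPowerSeries (ι × ℕ+) ℂ) :
    PowerSeries.coeff 0 (shiftHom s k f) = f := by
  rw [PowerSeries.coeff_zero_eq_constantCoeff_apply]
  let T : MvPowerSeries (ι × ℕ+) ℂ →+ MvPowerSeries (ι × ℕ+) ℂ :=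
    AddMonoidHom.mk' (fun f => PowerSeries.constantCoeff (shiftHom s k f) - f) fun f g => by
        simp only [map_add]
        abel
  have hpoly : ∀ q : MvPolynomial (ι × ℕ+) ℂ, T (q : MvPowerSeries (ι × ℕ+) ℂ) = 0 := by
    intro q
    rw [AddMonoidHom.mk'_apply, sub_eq_zero]
    induction q using MvPolynomial.induction_on with
    | C c => rw [MvPolynomial.coe_C, shiftHom_C, PowerSeries.constantCoeff_C]
    | add f g hf hg => rw [MvPolynomial.coe_add, map_add, map_add, hf, hg]
    | mul_X f q hf =>
      rw [MvPolynomial.coe_mul, MvPolynomial.coe_X, map_mul, map_mul, hf, shiftHom_X, map_add,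
        PowerSeries.constantCoeff_C]
      split_ifs <;> simp
  rw [← sub_eq_zero]
  ext a
  refine FinitelyDetermined.eq_zero ((coeff a).toAddMonoidHom.comp T) ?_
    (fun q => by
      change coeff a (T q) = 0
      rw [hpoly, map_zero]) f
  have := (finitelyDetermined_shift s k a 0).sub (finitelyDetermined_coeff a)
  simp only [PowerSeries.coeff_zero_eq_constantCoeff_apply] at this
  exact this

/-- The defect of the chain rule
`d/dt f(x + s [t]^{(k)}) = s ∑_{p ≥ 0} t^p (∂_{(k,p+1)} f)(x + s [t]^{(k)})`, with the sum
cut off at `p < m`. -/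
noncomputable def chainDefect (s : ℂ) (k : ι) (m : ℕ) :
    MvPowerSeries (ι × ℕ+) ℂ →+ PowerSeries (MvPowerSeries (ι × ℕ+) ℂ) :=
  AddMonoidHom.mk' (fun f => PowerSeries.derivative _ (shiftHom s k f) -
    ∑ p ∈ Finset.range m, PowerSeries.C (C s) * PowerSeries.X ^ p *
      shiftHom s k (pderiv ℂ (k, p.succPNat) f)) fun f g => by
        simp only [map_add, mul_add, Finset.sum_add_distrib]
        abel

lemma chainDefect_apply (s : ℂ) (k : ι) (m : ℕ) (f : MvPowerSeries (ι × ℕ+) ℂ) :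
    chainDefect s k m f = PowerSeries.derivative _ (shiftHom s k f) -
    ∑ p ∈ Finset.range m, PowerSeries.C (C s) * PowerSeries.X ^ p *
      shiftHom s k (pderiv ℂ (k, p.succPNat) f) := rfl

lemma derivative_mul {R : Type*} [CommRing R] (f g : PowerSeries R) :
    PowerSeries.derivative R (f * g) = f * PowerSeries.derivative R g +
      g * PowerSeries.derivative R f := by
  rw [Derivation.leibniz, smul_eq_mul, smul_eq_mul]

lemma chainDefect_mul (s : ℂ) (k : ι) (m : ℕ) (f g : MvPowerSeries (ι × ℕ+) ℂ) :
    chainDefect s k m (f * g) =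
      shiftHom s k f * chainDefect s k m g + shiftHom s k g * chainDefect s k m f := by
  simp only [chainDefect_apply, map_mul, derivative_mul, pderiv_mul, map_add, mul_add, mul_sub,
    Finset.sum_add_distrib, Finset.mul_sum]
  simp only [mul_left_comm]
  ring

lemma X_pow_dvd_chainDefect_X (s : ℂ) (k : ι) (m : ℕ) (q : ι × ℕ+) :
    PowerSeries.X ^ m ∣ chainDefect s k m (X q) := by
  classical
  rw [chainDefect_apply, shiftHom_X, map_add, PowerSeries.derivative_C, zero_add]
  have hsum : ∀ p ∈ Finset.range m, PowerSeries.C (C s) * PowerSeries.X ^ p *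
      shiftHom s k (pderiv ℂ (k, p.succPNat) (X q)) =
      if q.1 = k ∧ p = (q.2 : ℕ) - 1 then
        (PowerSeries.C (C s) * PowerSeries.X ^ ((q.2 : ℕ) - 1) :
          PowerSeries (MvPowerSeries (ι × ℕ+) ℂ)) else 0 := by
    intro p _
    by_cases h : q.1 = k ∧ p = (q.2 : ℕ) - 1
    · rw [if_pos h]
      have hq : (k, p.succPNat) = q := by
        refine Prod.ext h.1.symm (PNat.coe_injective ?_)
        have := q.2.pos
        simp [h.2]
        omega
      rw [hq, pderiv_X_self, map_one, mul_one, h.2]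
    · rw [if_neg h, pderiv_X_of_ne, map_zero, mul_zero]
      rintro rfl
      exact h ⟨rfl, by simp⟩
  rw [Finset.sum_congr rfl hsum]
  by_cases hq : q.1 = k
  · have hpos : (q.2 : ℕ) - 1 + 1 = q.2 := Nat.succ_pred_eq_of_pos q.2.pos
    have hd : PowerSeries.derivative (MvPowerSeries (ι × ℕ+) ℂ)
        (PowerSeries.C (C (s / (q.2 : ℕ))) * PowerSeries.X ^ (q.2 : ℕ)) =
        PowerSeries.C (C s) * PowerSeries.X ^ ((q.2 : ℕ) - 1) := by
      rw [derivative_mul, PowerSeries.derivative_C, mul_zero, add_zero, PowerSeries.derivative_pow,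
        PowerSeries.derivative_X, mul_one, ← mul_assoc]
      congr 1
      rw [← map_natCast (PowerSeries.C (R := MvPowerSeries (ι × ℕ+) ℂ)),
        ← map_natCast (C (σ := ι × ℕ+) (R := ℂ)), ← map_mul, ← map_mul, div_mul_cancel₀]
      exact_mod_cast q.2.ne_zero
    simp only [hq, true_and, if_true, hd]
    rw [Finset.sum_ite_eq']
    split_ifs with hm
    · rw [sub_self]
      exact dvd_zero _
    · rw [sub_zero]
      rw [Finset.mem_range, not_lt] at hm
      exact (pow_dvd_pow _ hm).mul_left _
  · simp [hq]

lemma coeff_chainDefect (s : ℂ) (k : ι) (n : ℕ) (f : MvPowerSeries (ι × ℕ+) ℂ) :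
    PowerSeries.coeff n (chainDefect s k (n + 1) f) =
      (n + 1) • PowerSeries.coeff (n + 1) (shiftHom s k f) -
      ∑ x ∈ antidiagonal n, C s *
        PowerSeries.coeff x.2 (shiftHom s k (pderiv ℂ (k, x.1.succPNat) f)) := by
  rw [chainDefect_apply, map_sub, PowerSeries.coeff_derivative, map_sum,
    Finset.Nat.sum_antidiagonal_eq_sum_range_succ_mk, nsmul_eq_mul, mul_comm]
  congr 1
  · push_cast
    rfl
  · refine Finset.sum_congr rfl fun p hp => ?_
    rw [Finset.mem_range] at hp
    rw [mul_assoc, PowerSeries.coeff_C_mul, PowerSeries.coeff_X_pow_mul', if_pos (by omega)]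

/-- The chain rule for the shift `x^{(k)} ↦ x^{(k)} + s [t]`: its coefficients in `t` satisfy the
recursion of a flow. -/
lemma shiftHom_succ (s : ℂ) (k : ι) (n : ℕ) (f : MvPowerSeries (ι × ℕ+) ℂ) :
    (n + 1) • PowerSeries.coeff (n + 1) (shiftHom s k f) =
      ∑ x ∈ antidiagonal n, C s *
        PowerSeries.coeff x.2 (shiftHom s k (pderiv ℂ (k, x.1.succPNat) f)) := by
  rw [← sub_eq_zero, ← coeff_chainDefect]
  have hpoly : ∀ q : MvPolynomial (ι × ℕ+) ℂ,
      PowerSeries.X ^ (n + 1) ∣ chainDefect s k (n + 1) (q : MvPowerSeries (ι × ℕ+) ℂ) := by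
    intro q
    induction q using MvPolynomial.induction_on with
    | C c =>
      rw [chainDefect_apply, MvPolynomial.coe_C, shiftHom_C, PowerSeries.derivative_C]
      simp
    | add f g hf hg =>
      rw [MvPolynomial.coe_add, map_add]
      exact dvd_add hf hg
    | mul_X f q hf =>
      rw [MvPolynomial.coe_mul, MvPolynomial.coe_X, chainDefect_mul]
      exact dvd_add ((X_pow_dvd_chainDefect_X s k _ q).mul_left _) (hf.mul_left _)
  ext a
  refine FinitelyDetermined.eq_zero (((coeff a).toAddMonoidHom.comp
    (PowerSeries.coeff n).toAddMonoidHom).comp (chainDefect s k (n + 1))) ?_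
    (fun q => by
      change coeff a (PowerSeries.coeff n (chainDefect s k (n + 1) q)) = 0
      rw [PowerSeries.X_pow_dvd_iff.1 (hpoly q) n (by omega), map_zero]) f
  have h1 := ((finitelyDetermined_shift s k a (n + 1)).mul_left ((n : ℂ) + 1)).sub
    (FinitelyDetermined.sum (antidiagonal n) fun x =>
      ((finitelyDetermined_shift s k a x.2).comp_pderiv (k, x.1.succPNat)).mul_left s)
  convert h1 using 2 with f
  change coeff a (PowerSeries.coeff n (chainDefect s k (n + 1) f)) = _
  rw [coeff_chainDefect, map_sub, map_sum, map_nsmul, nsmul_eq_mul]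
  simp only [coeff_C_mul]
  push_cast
  rfl

end Shift

end FormalFunction

namespace AffineSL

open Finset.HasAntidiagonal (antidiagonal mem_antidiagonal)
open MvPowerSeries FormalFunction

variable {ℓ : ℕ}

/-! ### Two-point functions -/

/-- An additive map applied to the coefficients of a Laurent series. -/
noncomputable def mapCoeff (φ : Fn ℓ →+ Fn ℓ) : LaurentSeries (Fn ℓ) →+ LaurentSeries (Fn ℓ) where
  toFun F := F.map φ
  map_zero' := by ext; simp
  map_add' F G := by ext; simp

@[simp] lemma coeff_mapCoeff (φ : Fn ℓ →+ Fn ℓ) (F : LaurentSeries (Fn ℓ)) (n : ℤ) :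
    (mapCoeff φ F).coeff n = φ (F.coeff n) := rfl

/-- The partial derivative `∂/∂xₚ` as an additive map. -/
noncomputable def partialHom (p : Var ℓ) : Fn ℓ →+ Fn ℓ :=
  (partialDeriv p).toLinearMap.toAddMonoidHom

@[simp] lemma partialHom_apply (p : Var ℓ) (f : Fn ℓ) : partialHom p f = partialDeriv p f := rfl

lemma coeff_atRight (F : LaurentSeries (Fn ℓ)) (b : Var ℓ →₀ ℕ) (n : ℤ) :
    (coeff b (atRight F)).coeff n = coeff b (taylor (F.coeff n)) := rfl

lemma coeff_twoPointRes (F : TwoPoint ℓ) (b : Var ℓ →₀ ℕ) :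
    coeff b (twoPointRes F) = (coeff b F).coeff 1 := rfl

/-- `twoPointRes` as an additive map. -/
noncomputable def twoPointResHom : TwoPoint ℓ →+ MvPowerSeries (Var ℓ) (Fn ℓ) where
  toFun := twoPointRes
  map_zero' := rfl
  map_add' _ _ := rfl

@[simp] lemma twoPointResHom_apply (F : TwoPoint ℓ) : twoPointResHom F = twoPointRes F := rfl

/-- `atRight` as an additive map. -/
noncomputable def atRightHom : LaurentSeries (Fn ℓ) →+ TwoPoint ℓ where
  toFun := atRight
  map_zero' := by
    ext b n
    rw [coeff_atRight]
    simp
  map_add' F G := by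
    ext b n
    rw [coeff_atRight, map_add, HahnSeries.coeff_add, HahnSeries.coeff_add, map_add, map_add]
    rfl

@[simp] lemma atRightHom_apply (F : LaurentSeries (Fn ℓ)) : atRightHom F = atRight F := rfl

lemma res_nsmul (n : ℕ) (F : LaurentSeries (Fn ℓ)) (m : ℤ) :
    (F * (n : LaurentSeries (Fn ℓ))).coeff m = F.coeff m * n := by
  rw [← nsmul_eq_mul', ← nsmul_eq_mul']
  exact map_nsmul (HahnSeries.coeff.addMonoidHom m) n F

lemma pderiv_twoPointRes (p : Var ℓ) (F : TwoPoint ℓ) :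
    pderiv _ p (twoPointRes F) = twoPointRes (pderiv _ p F) := by
  ext b
  rw [coeff_pderiv, coeff_twoPointRes, coeff_twoPointRes, coeff_pderiv]
  exact_mod_cast (res_nsmul (b p + 1) _ 1).symm

lemma constantCoeff_twoPointRes (F : TwoPoint ℓ) :
    constantCoeff (twoPointRes F) = res (constantCoeff F) := rfl

lemma pderiv_atRight (p : Var ℓ) (F : LaurentSeries (Fn ℓ)) :
    pderiv _ p (atRight F) = atRight (mapCoeff (partialHom p) F) := by
  ext b n
  rw [coeff_pderiv, coeff_atRight, coeff_mapCoeff, partialHom_apply, ← pderiv_taylor, coeff_pderiv,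
    ← coeff_atRight]
  exact_mod_cast res_nsmul (b p + 1) _ n

lemma constantCoeff_atRight (F : LaurentSeries (Fn ℓ)) : constantCoeff (atRight F) = F := by
  ext n
  exact constantCoeff_taylor (F.coeff n)

lemma pderiv_atLeft (p : Var ℓ) (F : LaurentSeries (Fn ℓ)) : pderiv _ p (atLeft F) = 0 :=
  pderiv_C

lemma constantCoeff_atLeft (F : LaurentSeries (Fn ℓ)) : constantCoeff (atLeft F) = F :=
  constantCoeff_C _

lemma atLeft_mul (F G : LaurentSeries (Fn ℓ)) : atLeft (F * G) = atLeft F * atLeft G :=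
  map_mul C F G

lemma coeff_zPow_mul (a : ℤ) (F : LaurentSeries (Fn ℓ)) (n : ℤ) :
    (zPow a * F).coeff n = F.coeff (n + a) := by
  rw [zPow, HahnSeries.coeff_single_mul, one_mul, sub_neg_eq_add]

lemma atRight_zPow_mul (a : ℤ) (F : LaurentSeries (Fn ℓ)) :
    atRight (zPow a * F) = atLeft (zPow a) * atRight F := by
  ext b n
  rw [coeff_atRight, coeff_zPow_mul, atLeft, coeff_C_mul, coeff_zPow_mul, coeff_atRight]

lemma coeff_const_mul (c : Fn ℓ) (F : LaurentSeries (Fn ℓ)) (n : ℤ) :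
    (HahnSeries.C c * F).coeff n = c * F.coeff n := by
  rw [HahnSeries.C_apply, HahnSeries.coeff_single_zero_mul]

lemma atRight_C_mul (c : Fn ℓ) (F : LaurentSeries (Fn ℓ)) :
    atRight (HahnSeries.C c * F) = MvPowerSeries.map HahnSeries.C (taylor c) * atRight F := by
  classical
  ext b n
  rw [coeff_atRight, coeff_const_mul, map_mul, coeff_mul, coeff_mul, HahnSeries.coeff_sum]
  refine Finset.sum_congr rfl fun x _ => ?_
  rw [coeff_map, coeff_const_mul, coeff_atRight]

lemma twoPointRes_map_C_mul (g : MvPowerSeries (Var ℓ) (Fn ℓ)) (F : TwoPoint ℓ) :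
    twoPointRes (MvPowerSeries.map HahnSeries.C g * F) = g * twoPointRes F := by
  classical
  ext b
  rw [coeff_twoPointRes, coeff_mul, coeff_mul, HahnSeries.coeff_sum]
  refine Finset.sum_congr rfl fun x _ => ?_
  rw [coeff_map, coeff_const_mul, coeff_twoPointRes]

lemma atLeft_C (c : Fn ℓ) : atLeft (HahnSeries.C c) = MvPowerSeries.map HahnSeries.C (C c) :=
  (map_C _ c).symm

lemma coeff_expXi (k : Fin ℓ) (b : Var ℓ →₀ ℕ) : coeff b (expXi k) =
    if ∀ p ∈ b.support, p.1 = k then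
      b.prod fun p e => ((e.factorial : ℂ)⁻¹) • (-zPow (p.2 : ℕ)) ^ e
    else 0 := rfl

lemma constantCoeff_expXi (k : Fin ℓ) : constantCoeff (expXi k) = 1 := by
  rw [← coeff_zero_eq_constantCoeff_apply, coeff_expXi, if_pos (by simp)]
  simp

lemma pderiv_expXi_of_ne (k : Fin ℓ) (p : Var ℓ) (h : p.1 ≠ k) : pderiv _ p (expXi k) = 0 := by
  ext1 b
  rw [coeff_pderiv, coeff_expXi, if_neg, zero_mul, map_zero]
  intro h'
  exact h (h' p (by simp))

lemma factorial_inv_smul_neg_pow_succ {K : Type*} [CommRing K] [Module ℂ K]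
    [IsScalarTower ℂ K K] [SMulCommClass ℂ K K] (w : K) (e : ℕ) :
    ((((e + 1).factorial : ℂ)⁻¹) • (-w) ^ (e + 1)) * ((e : K) + 1) =
      -(w * (((e.factorial : ℂ)⁻¹) • (-w) ^ e)) := by
  have h : ((e : K) + 1) = ((e + 1 : ℕ) : K) := by
    push_cast
    rfl
  rw [h, ← nsmul_eq_mul', ← Nat.cast_smul_eq_nsmul ℂ, smul_smul, Nat.factorial_succ,
    Nat.cast_mul, mul_inv, mul_inv_cancel_left₀ (by exact_mod_cast e.succ_ne_zero), pow_succ',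
    neg_mul, smul_neg, mul_smul_comm]

lemma pderiv_expXi (k : Fin ℓ) (n : ℕ+) :
    pderiv _ (k, n) (expXi k) = -(atLeft (zPow (n : ℕ)) * expXi k) := by
  classical
  ext1 b
  rw [coeff_pderiv, map_neg, atLeft, coeff_C_mul, coeff_expXi, coeff_expXi]
  have hiff : (∀ p ∈ (b + Finsupp.single (k, n) 1).support, p.1 = k) ↔
      ∀ p ∈ b.support, p.1 = k := by
    constructor
    · intro h p hp
      refine h p ?_
      rw [Finsupp.mem_support_iff] at hp ⊢
      rw [Finsupp.add_apply]
      omega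
    · intro h p hp
      rw [Finsupp.mem_support_iff, Finsupp.add_apply] at hp
      by_cases h0 : b p = 0
      · have : Finsupp.single (k, n) 1 p ≠ 0 := by omega
        rw [Finsupp.single_apply_ne_zero] at this
        rw [this.1]
      · exact h p (Finsupp.mem_support_iff.2 h0)
  by_cases h : ∀ p ∈ b.support, p.1 = k
  · rw [if_pos (hiff.2 h), if_pos h]
    have hg : ∀ p : Var ℓ, (((0 : ℕ).factorial : ℂ)⁻¹) •
        (-zPow (p.2 : ℕ) : LaurentSeries (Fn ℓ)) ^ 0 = 1 := by simp
    rw [← Finsupp.mul_prod_erase' _ (k, n) _ fun p => hg p,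
      ← Finsupp.mul_prod_erase' b (k, n) _ fun p => hg p]
    have he : Finsupp.erase (k, n) (b + Finsupp.single (k, n) 1) = Finsupp.erase (k, n) b := by
      rw [Finsupp.erase_add, Finsupp.erase_single, add_zero]
    rw [he, Finsupp.add_apply, Finsupp.single_eq_same]
    generalize (Finsupp.erase (k, n) b).prod (fun p e =>
      ((e.factorial : ℂ)⁻¹) • (-zPow (p.2 : ℕ) : LaurentSeries (Fn ℓ)) ^ e) = Y
    generalize b (k, n) = e
    -- the `ℂ`-action in `expXi`; instance search prefers a different `ℂ`-algebra structure
    let alg : Algebra ℂ (LaurentSeries (Fn ℓ)) := HahnSeries.instAlgebra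
    have tower : IsScalarTower ℂ (LaurentSeries (Fn ℓ)) (LaurentSeries (Fn ℓ)) :=
      @IsScalarTower.right _ _ _ _ alg
    have comm : SMulCommClass ℂ (LaurentSeries (Fn ℓ)) (LaurentSeries (Fn ℓ)) :=
      @Algebra.to_smulCommClass _ _ _ _ alg
    have h3 := factorial_inv_smul_neg_pow_succ (zPow (n : ℕ) : LaurentSeries (Fn ℓ)) e
    refine (mul_right_comm _ _ _).trans ((congrArg (· * Y) h3).trans ?_)
    ring
  · rw [if_neg (fun h' => h (hiff.1 h')), if_neg h]
    simp

/-! ### The residue pairing -/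

/-- The entries of `Res_z (A e^{Ξ(x,z)}) ((B e^{-Ξ(x,z)})ᵀ at x ↦ x')` for matrix operators `A`
and `B`. -/
noncomputable def pairing (A B : MatPDO ℓ) (r s : Fin ℓ) : MvPowerSeries (Var ℓ) (Fn ℓ) :=
  twoPointRes (∑ k, atLeft ((A r k).waveSymbol 1) * (expXi k * atRight ((B s k).waveSymbol (-1))))

lemma pairing_eq_sum (A B : MatPDO ℓ) (r s : Fin ℓ) : pairing A B r s =
    ∑ k, twoPointRes (atLeft ((A r k).waveSymbol 1) *
      (expXi k * atRight ((B s k).waveSymbol (-1)))) :=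
  map_sum twoPointResHom _ _

lemma waveSymbol_deriveCoeffs (s : ℤˣ) (p : Var ℓ) (P : PDO (del ℓ)) :
    (P.deriveCoeffs (partialDeriv p)).waveSymbol s = mapCoeff (partialHom p) (P.waveSymbol s) := by
  ext m
  rw [PDO.coeff_waveSymbol, coeff_mapCoeff, PDO.coeff_waveSymbol, map_zsmul]
  rfl

lemma waveSymbol_mul_del (P : PDO (del ℓ)) (n : ℤ) :
    (P * PDO.monomial (del ℓ) 1 n).waveSymbol 1 = zPow n * P.waveSymbol 1 := by
  rw [PDO.waveSymbol_mul_monomial_one, mul_comm]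
  rfl

lemma del_apply (f : Fn ℓ) : del ℓ f = ∑ i : Fin ℓ, partialDeriv (i, 1) f := by
  exact (congrFun (map_sum (Derivation.coeFnAddMonoidHom (R := ℂ) (A := Fn ℓ) (M := Fn ℓ)) _ _)
    f).trans (Finset.sum_apply _ _ _)

lemma waveSymbol_del_mul (P : PDO (del ℓ)) :
    (PDO.monomial (del ℓ) 1 1 * P).waveSymbol (-1) =
      ∑ i : Fin ℓ, mapCoeff (partialHom (i, 1)) (P.waveSymbol (-1)) -
        zPow 1 * P.waveSymbol (-1) := by
  ext m
  rw [PDO.coeff_waveSymbol_del_mul, HahnSeries.coeff_sub, HahnSeries.coeff_sum, coeff_zPow_mul]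
  rw [del_apply]
  rfl

lemma mul_unitE_mul_delPow_apply (A : MatPDO ℓ) (i r k : Fin ℓ) (n : ℕ) :
    (A * unitE i * delPow n : MatPDO ℓ) r k =
      if k = i then A r i * PDO.monomial (del ℓ) 1 n else 0 := by
  rw [delPow, Matrix.mul_diagonal, unitE]
  split_ifs with h
  · subst h
    rw [Matrix.mul_single_apply_same, mul_one]
  · rw [Matrix.mul_single_apply_of_ne _ _ _ _ _ h, zero_mul]

/-- Differentiation of the pairing with respect to `x'`. -/
lemma pderiv_pairing (i : Fin ℓ) (n : ℕ+) (A B : MatPDO ℓ) (r s : Fin ℓ) :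
    pderiv _ (i, n) (pairing A B r s) =
      pairing A (derivM i n B) r s - pairing (A * unitE i * delPow n) B r s := by
  rw [pairing, pderiv_twoPointRes, map_sum, pairing, pairing, ← twoPointResHom_apply,
    ← twoPointResHom_apply, ← twoPointResHom_apply, ← map_sub, ← Finset.sum_sub_distrib]
  congr 1
  refine Finset.sum_congr rfl fun k _ => ?_
  rw [pderiv_mul, pderiv_atLeft, mul_zero, add_zero, pderiv_mul, pderiv_atRight, derivM,
    Matrix.map_apply, waveSymbol_deriveCoeffs, mul_unitE_mul_delPow_apply]
  by_cases h : k = i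
  · subst h
    rw [if_pos rfl, pderiv_expXi, waveSymbol_mul_del, atLeft_mul]
    ring
  · rw [if_neg h, pderiv_expXi_of_ne k (i, n) (Ne.symm h), ← PDO.waveSymbolHom_apply 1 0, map_zero,
      show atLeft (0 : LaurentSeries (Fn ℓ)) = 0 from map_zero C]
    ring

lemma sum_pderiv_pairing (A B : MatPDO ℓ) (r s : Fin ℓ) :
    ∑ i : Fin ℓ, pderiv _ (i, (1 : ℕ+)) (pairing A B r s) = pairing A (delPow 1 * B) r s := by
  simp only [pairing, pderiv_twoPointRes, map_sum]
  simp only [← twoPointResHom_apply]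
  rw [← map_sum, Finset.sum_comm]
  congr 1
  refine Finset.sum_congr rfl fun k _ => ?_
  have h : ∀ i : Fin ℓ, pderiv _ (i, (1 : ℕ+)) (atLeft ((A r k).waveSymbol 1) *
      (expXi k * atRight ((B s k).waveSymbol (-1)))) =
      atLeft ((A r k).waveSymbol 1) * (expXi k *
        atRight (mapCoeff (partialHom (i, 1)) ((B s k).waveSymbol (-1)))) -
      if i = k then atLeft ((A r k).waveSymbol 1) * (expXi k *
        (atLeft (zPow 1) * atRight ((B s k).waveSymbol (-1)))) else 0 := by
    intro i
    rw [pderiv_mul, pderiv_atLeft, mul_zero, add_zero, pderiv_mul, pderiv_atRight]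
    split_ifs with h
    · subst h
      rw [pderiv_expXi]
      push_cast
      ring
    · rw [pderiv_expXi_of_ne k (i, 1) h]
      ring
  rw [Finset.sum_congr rfl fun i _ => h i, Finset.sum_sub_distrib, Finset.sum_ite_eq',
    if_pos (Finset.mem_univ k), ← Finset.mul_sum, ← Finset.mul_sum, ← mul_sub, ← mul_sub,
    ← atRight_zPow_mul, delPow_mul_apply]
  have h2 := waveSymbol_del_mul (B s k)
  rw [Nat.cast_one, h2]
  simp only [← atRightHom_apply, map_sub, map_sum]

lemma constantCoeff_pairing (A B : MatPDO ℓ) (r s : Fin ℓ) :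
    constantCoeff (pairing A B r s) =
      ∑ k, ((A r k).waveSymbol 1 * (B s k).waveSymbol (-1)).coeff 1 := by
  rw [pairing_eq_sum, map_sum]
  refine Finset.sum_congr rfl fun k _ => ?_
  rw [constantCoeff_twoPointRes, map_mul, map_mul, constantCoeff_atLeft, constantCoeff_atRight,
    constantCoeff_expXi, one_mul]
  rfl

/-- The pairing of `A` and `B` determines the negative part of `A B^*`. -/
theorem negM_eq_of_pairing {A B A' B' : MatPDO ℓ}
    (h : ∀ r s, pairing A B r s = pairing A' B' r s) :
    negM (A * adjointM B) = negM (A' * adjointM B') := by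
  rw [negM_eq_iff]
  intro r s p
  have hp : pairing A (delPow p * B) r s = pairing A' (delPow p * B') r s := by
    induction p with
    | zero => rw [delPow_zero, one_mul, one_mul, h]
    | succ p ih =>
      rw [delPow_succ, mul_assoc, mul_assoc, ← sum_pderiv_pairing, ih, sum_pderiv_pairing]
  have h2 := congrArg constantCoeff hp
  rw [constantCoeff_pairing, constantCoeff_pairing, coeff_mul_adjointM, coeff_mul_adjointM] at h2
  rcases Int.units_eq_one_or (Int.negOnePow (p : ℤ)) with h3 | h3
  · simpa [h3] using h2
  · simpa [h3] using h2

end AffineSL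

namespace AffineSL

open Finset.HasAntidiagonal (antidiagonal mem_antidiagonal)
open MvPowerSeries FormalFunction

variable {ℓ : ℕ}

/-! ### The substitution `x' = x - [t]` -/

/-- The partial derivatives `∂/∂x_{p+1}^{(k)}`, whose flow is `f(x) ↦ f(x + [t]^{(k)})`. -/
noncomputable def shiftDer (k : Fin ℓ) (p : ℕ) : Fn ℓ →+ Fn ℓ := partialHom (k, p.succPNat)

lemma algebraMap_coeff_shiftHom (s : ℂ) (k : Fin ℓ) (e : ℕ → Fn ℓ →+ Fn ℓ)
    (he : ∀ p f, e p f = algebraMap (FPS ℓ) (Fn ℓ) (C s) * shiftDer k p f) (n : ℕ) (f : FPS ℓ) :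
    algebraMap (FPS ℓ) (Fn ℓ) (PowerSeries.coeff n (shiftHom s k f)) =
      flow e n (algebraMap (FPS ℓ) (Fn ℓ) f) := by
  refine eq_flow e (fun n f => algebraMap (FPS ℓ) (Fn ℓ) (PowerSeries.coeff n (shiftHom s k f)))
    (fun p f => C s * pderiv ℂ (k, p.succPNat) f) (algebraMap (FPS ℓ) (Fn ℓ)) ?_ ?_ ?_ n f
  · intro f
    rw [coeff_zero_shiftHom]
  · intro n f
    rw [← map_nsmul, shiftHom_succ, map_sum]
    refine Finset.sum_congr rfl fun x _ => ?_
    rw [map_mul (shiftHom s k), shiftHom_C, PowerSeries.coeff_C_mul]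
  · intro p f
    rw [he, map_mul]
    congr 1
    exact (partialDeriv_algebraMap _ f).symm

lemma coeff_shifted_natCast (s : ℂ) (k : Fin ℓ) (f : FPS ℓ) (n : ℕ) :
    (shifted s k f).coeff n = algebraMap (FPS ℓ) (Fn ℓ) (PowerSeries.coeff n (shiftHom s k f)) := by
  rw [shifted, HahnSeries.ofPowerSeries_apply_coeff, PowerSeries.coeff_map]
  rfl

lemma coeff_shifted_of_neg (s : ℂ) (k : Fin ℓ) (f : FPS ℓ) (n : ℤ) (hn : n < 0) :
    (shifted s k f).coeff n = 0 := by
  rw [shifted, HahnSeries.ofPowerSeries_apply]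
  apply HahnSeries.embDomain_of_notMem_range
  rintro ⟨m, hm⟩
  change ((m : ℕ) : ℤ) = n at hm
  omega

lemma coeff_zero_shifted (s : ℂ) (k : Fin ℓ) (f : FPS ℓ) :
    (shifted s k f).coeff 0 = algebraMap (FPS ℓ) (Fn ℓ) f := by
  have := coeff_shifted_natCast s k f 0
  rwa [coeff_zero_shiftHom] at this

lemma coeff_shifted_one (k : Fin ℓ) (f : FPS ℓ) (n : ℕ) :
    (shifted 1 k f).coeff n = flow (shiftDer k) n (algebraMap (FPS ℓ) (Fn ℓ) f) := by
  rw [coeff_shifted_natCast, algebraMap_coeff_shiftHom 1 k (shiftDer k) fun p f => by simp]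

lemma coeff_shifted_neg_one (k : Fin ℓ) (f : FPS ℓ) (n : ℕ) :
    (shifted (-1) k f).coeff n =
      flow (fun p => -shiftDer k p) n (algebraMap (FPS ℓ) (Fn ℓ) f) := by
  rw [coeff_shifted_natCast,
    algebraMap_coeff_shiftHom (-1) k (fun p => -shiftDer k p) fun p f => by simp]

lemma shifted_zero (s : ℂ) (k : Fin ℓ) : shifted s k (0 : FPS ℓ) = 0 := by
  rw [shifted, ← shiftHom_apply, map_zero, map_zero, map_zero]

/-- The operators `-∂/∂y_{p+1}^{(i)}`; the constant coefficient of their flow substitutes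
`y = -[t]^{(i)}`, that is, `x' = x - [t]^{(i)}`. -/
noncomputable def yDer (R : Type*) [CommRing R] (i : Fin ℓ) (p : ℕ) :
    MvPowerSeries (Var ℓ) R →+ MvPowerSeries (Var ℓ) R :=
  -(pderiv R (i, p.succPNat)).toLinearMap.toAddMonoidHom

lemma yDer_apply {R : Type*} [CommRing R] (i : Fin ℓ) (p : ℕ) (F : MvPowerSeries (Var ℓ) R) :
    yDer R i p F = -pderiv R (i, p.succPNat) F := rfl

/-- The substitution `x ↦ x - [t]^{(i)}` in the coefficients of a Laurent series. -/
noncomputable def laurentFlow (i : Fin ℓ) : ℕ → LaurentSeries (Fn ℓ) →+ LaurentSeries (Fn ℓ) :=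
  flow fun p => mapCoeff (-shiftDer i p)

lemma coeff_laurentFlow (i : Fin ℓ) (n : ℕ) (F : LaurentSeries (Fn ℓ)) (m : ℤ) :
    (laurentFlow i n F).coeff m = flow (fun p => -shiftDer i p) n (F.coeff m) :=
  map_flow (HahnSeries.coeff.addMonoidHom m) (fun p => mapCoeff (-shiftDer i p))
    (fun p => -shiftDer i p) (fun _ _ => rfl) n F

lemma flow_atRight (i : Fin ℓ) (n : ℕ) (F : LaurentSeries (Fn ℓ)) :
    flow (yDer _ i) n (atRight F) = atRight (laurentFlow i n F) := by
  refine (map_flow atRightHom _ _ (fun p F => ?_) n F).symm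
  rw [atRightHom_apply, atRightHom_apply, yDer_apply, pderiv_atRight, ← atRightHom_apply,
    ← atRightHom_apply, ← map_neg]
  congr 1

lemma yDer_mul {R : Type*} [CommRing R] (i : Fin ℓ) (p : ℕ) (F G : MvPowerSeries (Var ℓ) R) :
    yDer R i p (F * G) = yDer R i p F * G + F * yDer R i p G := by
  rw [yDer_apply, yDer_apply, yDer_apply, pderiv_mul]
  ring

lemma flow_yDer_mul (i : Fin ℓ) (n : ℕ) (F G : TwoPoint ℓ) : flow (yDer _ i) n (F * G) =
    ∑ x ∈ antidiagonal n, flow (yDer _ i) x.1 F * flow (yDer _ i) x.2 G :=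
  flow_mul _ (yDer_mul i) n F G

lemma flow_atLeft_mul (i : Fin ℓ) (n : ℕ) (F : LaurentSeries (Fn ℓ)) (G : TwoPoint ℓ) :
    flow (yDer _ i) n (atLeft F * G) = atLeft F * flow (yDer _ i) n G :=
  flow_const_mul _ _ (fun p G => by
    rw [yDer_mul, yDer_apply, pderiv_atLeft, neg_zero, zero_mul, zero_add]) n G

lemma flow_expXi_self (i : Fin ℓ) (n : ℕ) :
    flow (yDer _ i) n (expXi i) = atLeft (zPow (n : ℤ)) * expXi i := by
  induction n using Nat.strong_induction_on with
  | _ n ih =>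
    cases n with
    | zero =>
      rw [flow_zero, Nat.cast_zero, zPow, neg_zero, show HahnSeries.single (0 : ℤ) (1 : Fn ℓ) = 1
        from rfl, show atLeft (1 : LaurentSeries (Fn ℓ)) = 1 from map_one C, one_mul]
    | succ n =>
      apply nsmul_succ_injective n
      change (n + 1) • flow (yDer _ i) (n + 1) (expXi i) = (n + 1) • _
      rw [flow_succ, ← Finset.Nat.card_antidiagonal n]
      refine (Finset.sum_congr rfl fun x hx => ?_).trans (Finset.sum_const _)
      rw [mem_antidiagonal] at hx
      rw [yDer_apply, pderiv_expXi, neg_neg, flow_atLeft_mul, ih x.2 (by omega), ← mul_assoc,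
        ← atLeft_mul, zPow, zPow, HahnSeries.single_mul_single, one_mul, zPow]
      congr 4
      rw [← hx]
      simp
      ring

lemma flow_expXi_of_ne (i k : Fin ℓ) (h : k ≠ i) (n : ℕ) :
    flow (yDer _ i) n (expXi k) = if n = 0 then expXi k else 0 := by
  split_ifs with hn
  · rw [hn, flow_zero]
  · obtain ⟨n, rfl⟩ := Nat.exists_eq_succ_of_ne_zero hn
    apply nsmul_succ_injective n
    change (n + 1) • flow (yDer _ i) (n + 1) (expXi k) = (n + 1) • 0
    rw [flow_succ]
    refine (Finset.sum_eq_zero fun x _ => ?_).trans (nsmul_zero _).symm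
    rw [yDer_apply, pderiv_expXi_of_ne k _ (Ne.symm h), neg_zero, map_zero]

/-- The bilinear identity at `x' = x - [t]^{(i)}`, where
`exp ξ(x^{(i)} - x'^{(i)}, z) = 1 / (1 - t z)`. -/
lemma pairing_eq_zero_at_shift {A B : MatPDO ℓ} {r s : Fin ℓ} (h : pairing A B r s = 0) (i : Fin ℓ)
    (n : ℕ) : ∑ k, (if k = i then ∑ x ∈ antidiagonal n, ((A r k).waveSymbol 1 *
        laurentFlow i x.2 ((B s k).waveSymbol (-1))).coeff (x.1 + 1 : ℕ)
      else ((A r k).waveSymbol 1 * laurentFlow i n ((B s k).waveSymbol (-1))).coeff 1) = 0 := by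
  have h2 : constantCoeff (flow (yDer _ i) n (pairing A B r s)) = 0 := by
    rw [h, map_zero, map_zero]
  rw [pairing, ← twoPointResHom_apply,
    ← map_flow twoPointResHom (yDer _ i) (yDer _ i) (fun p F => by
      rw [yDer_apply, yDer_apply, map_neg, twoPointResHom_apply, twoPointResHom_apply,
        pderiv_twoPointRes]), map_sum, map_sum, map_sum] at h2
  refine Eq.trans (Finset.sum_congr rfl fun k _ => ?_) h2
  rw [flow_atLeft_mul, flow_yDer_mul, twoPointResHom_apply, constantCoeff_twoPointRes, map_mul,
    constantCoeff_atLeft, map_sum]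
  split_ifs with hk
  · subst hk
    rw [Finset.mul_sum, res, HahnSeries.coeff_sum]
    refine Finset.sum_congr rfl fun x _ => ?_
    rw [flow_expXi_self, flow_atRight, map_mul, map_mul, constantCoeff_atLeft, constantCoeff_expXi,
      constantCoeff_atRight, mul_one, mul_left_comm, coeff_zPow_mul]
    push_cast
    rw [add_comm]
  · rw [Finset.sum_eq_single (0, n)]
    · rw [flow_expXi_of_ne i k hk, if_pos rfl, flow_atRight, map_mul, constantCoeff_expXi,
        constantCoeff_atRight, one_mul]
      rfl
    · rintro ⟨a, b⟩ hx hne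
      rw [mem_antidiagonal] at hx
      rw [flow_expXi_of_ne i k hk, if_neg, zero_mul, map_zero]
      rintro rfl
      apply hne
      rw [← hx]
      simp
    · intro hx
      exact absurd (mem_antidiagonal.2 (by simp)) hx

lemma coeff_mul_of_nonneg {F G : LaurentSeries (Fn ℓ)} (hF : ∀ n < 0, F.coeff n = 0)
    (hG : ∀ n < 0, G.coeff n = 0) (n : ℕ) :
    (F * G).coeff n = ∑ x ∈ antidiagonal n, F.coeff x.1 * G.coeff x.2 := by
  have key : ∀ H : LaurentSeries (Fn ℓ), (∀ n < 0, H.coeff n = 0) →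
      H = HahnSeries.ofPowerSeries ℤ (Fn ℓ) (PowerSeries.mk fun n => H.coeff n) := by
    intro H hH
    ext m
    by_cases hm : m < 0
    · rw [hH m hm, HahnSeries.ofPowerSeries_apply, HahnSeries.embDomain_of_notMem_range]
      rintro ⟨k, hk⟩
      change ((k : ℕ) : ℤ) = m at hk
      omega
    · obtain ⟨k, rfl⟩ := Int.eq_ofNat_of_zero_le (not_lt.1 hm)
      rw [HahnSeries.ofPowerSeries_apply_coeff, PowerSeries.coeff_mk]
  rw [key F hF, key G hG, ← map_mul, HahnSeries.ofPowerSeries_apply_coeff, PowerSeries.coeff_mul]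
  simp only [HahnSeries.ofPowerSeries_apply_coeff, PowerSeries.coeff_mk]

lemma IsMonic.coeff_waveSymbol {P : MatPDO ℓ} (h : IsMonic P) (s : ℤˣ) (i j : Fin ℓ) (n : ℤ)
    (hn : n ≤ 0) : ((P i j).waveSymbol s).coeff n = if i = j ∧ n = 0 then 1 else 0 := by
  have h2 := h i j (-n) (by omega)
  rw [Matrix.sub_apply, PDO.coeff_sub, sub_eq_zero, Matrix.one_apply] at h2
  rw [PDO.coeff_waveSymbol_eq_mul, h2]
  by_cases hij : i = j
  · rw [if_pos hij, PDO.coeff_one]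
    by_cases h0 : n = 0
    · simp [h0, hij]
    · rw [if_neg (by omega), mul_zero, if_neg (fun h => h0 h.2)]
  · rw [if_neg hij, if_neg (fun h => hij h.1), PDO.coeff_zero, mul_zero]

end AffineSL

namespace AffineSL

open Finset.HasAntidiagonal (antidiagonal mem_antidiagonal)
open MvPowerSeries FormalFunction

variable {ℓ : ℕ}

/-! ### The lattice and its signs -/

lemma form_basisVec (k : Fin ℓ) (α : Fin ℓ → ℤ) : form (basisVec k) α = α k := by
  rw [form, Finset.sum_eq_single k]
  · simp [basisVec]
  · intro i _ hi
    simp [basisVec, hi]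
  · simp

lemma eps_add_right (α β γ : Fin ℓ → ℤ) : eps α (β + γ) = eps α β * eps α γ := by
  simp only [eps, ← Finset.prod_mul_distrib, ← zpow_add, Pi.add_apply, mul_add]

lemma eps_basisVec (i j : Fin ℓ) : eps (basisVec i) (basisVec j) = if i < j then 1 else -1 := by
  rw [eps, Finset.prod_eq_single i, Finset.prod_eq_single j]
  · simp [basisVec]
  · intro k _ hk
    simp [basisVec, hk]
  · simp
  · intro k _ hk
    simp [basisVec, hk]
  · simp

lemma eps_basisVec_self (i : Fin ℓ) : eps (basisVec i) (basisVec i) = -1 := by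
  simp [eps_basisVec]

lemma eps_basisVec_swap {i j : Fin ℓ} (h : i ≠ j) :
    eps (basisVec i) (basisVec j) = -eps (basisVec j) (basisVec i) := by
  rw [eps_basisVec, eps_basisVec]
  rcases lt_or_gt_of_ne h with h | h
  · rw [if_pos h, if_neg (not_lt.2 h.le), neg_neg]
  · rw [if_pos h, if_neg (not_lt.2 h.le)]

lemma root_self (i : Fin ℓ) : root i i = 0 := by
  ext k
  simp [root]

lemma root_neg (i j : Fin ℓ) : -root i j = root j i := by
  ext k
  simp [root]

lemma coe_root (i j : Fin ℓ) : (root i j : Fin ℓ → ℤ) = basisVec i - basisVec j := rfl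

/-! ### The dressing operators -/

lemma waveSymbol_dressing (τ : rootLattice ℓ → FPS ℓ) (α : rootLattice ℓ) (i k : Fin ℓ) :
    (dressing τ α i k).waveSymbol 1 =
      HahnSeries.C ((((-eps (basisVec k) (basisVec i) : ℤˣ) : ℤ) : Fn ℓ) /
          algebraMap (FPS ℓ) (Fn ℓ) (τ α)) *
        (zPow (delta i k - 1) * shifted (-1) k (τ (α + root i k))) := by
  ext n
  rw [PDO.coeff_waveSymbol_eq_mul, coeff_const_mul, coeff_zPow_mul, one_zpow, Units.val_one,
    Int.cast_one, one_mul, dressing, Matrix.of_apply]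
  change (if -n ≤ 0 then _ else 0) = _
  split_ifs with hn
  · rw [neg_neg, res, coeff_zPow_mul, Units.val_neg, Int.cast_neg, div_mul_eq_mul_div,
      mul_div_assoc, Int.toNat_of_nonneg (by omega),
      show (1 : ℤ) + (n + delta i k - 2) = n + (delta i k - 1) by ring]
  · rw [coeff_shifted_of_neg, mul_zero]
    rw [delta]
    split_ifs <;> omega

lemma coeff_zero_zPow_mul_shifted (s : ℂ) (i k : Fin ℓ) (f : FPS ℓ) (n : ℤ) (hn : n ≤ 0) :
    (zPow (delta i k - 1) * shifted s k f).coeff n =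
      if i = k ∧ n = 0 then algebraMap (FPS ℓ) (Fn ℓ) f else 0 := by
  rw [coeff_zPow_mul]
  split_ifs with h
  · rw [h.1, h.2, delta, if_pos rfl, sub_self, add_zero, coeff_zero_shifted]
  · apply coeff_shifted_of_neg
    rw [delta]
    split_ifs with h2
    · have : n ≠ 0 := fun h0 => h ⟨h2, h0⟩
      omega
    · omega

lemma isMonic_of_coeff_waveSymbol {P : MatPDO ℓ} (s : ℤˣ) (h : ∀ i j (n : ℤ), n ≤ 0 →
    ((P i j).waveSymbol s).coeff n = if i = j ∧ n = 0 then 1 else 0) : IsMonic P := by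
  intro i j n hn
  have h2 := h i j (-n) (by omega)
  rw [PDO.coeff_waveSymbol_eq_mul, neg_neg] at h2
  have h3 : ((P i j).coeff n) = if i = j ∧ -n = 0 then 1 else 0 := by
    by_cases h0 : i = j ∧ -n = 0
    · rw [if_pos h0] at h2 ⊢
      simpa [h0.2] using h2
    · rw [if_neg h0] at h2 ⊢
      rcases Int.units_eq_one_or (s ^ (-n)) with h3 | h3 <;> simpa [h3] using h2
  rw [Matrix.sub_apply, PDO.coeff_sub, sub_eq_zero, h3, Matrix.one_apply]
  by_cases hij : i = j
  · rw [if_pos hij, PDO.coeff_one]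
    exact if_congr (by simp [hij]) rfl rfl
  · rw [if_neg hij, if_neg (fun h => hij h.1), PDO.coeff_zero]

lemma isMonic_dressing (τ : rootLattice ℓ → FPS ℓ) (α : rootLattice ℓ) (h : τ α ≠ 0) :
    IsMonic (dressing τ α) := by
  have h' : algebraMap (FPS ℓ) (Fn ℓ) (τ α) ≠ 0 := by simpa using h
  refine isMonic_of_coeff_waveSymbol 1 fun i j n hn => ?_
  rw [waveSymbol_dressing, coeff_const_mul, coeff_zero_zPow_mul_shifted _ _ _ _ _ hn]
  split_ifs with h0
  · rw [← h0.1, eps_basisVec_self, root_self, add_zero]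
    rw [neg_neg, Units.val_one, Int.cast_one, one_div_mul_cancel h']
  · rw [mul_zero]

/-- The operator `R_β` whose wave symbol in `R_β e^{-Ξ}` has the entries
`-ε(v_k, v_j) z^{δ_jk - 1} τ_{β-v_j+v_k}(x + [z⁻¹]^{(k)}) / τ_β(x)`. Under either form of the
bilinear identity it equals `(P_β^*)⁻¹`. -/
noncomputable def adjDressing (τ : rootLattice ℓ → FPS ℓ) (β : rootLattice ℓ) : MatPDO ℓ :=
  Matrix.of fun j k => PDO.ofSymbol (del ℓ) (-1)
    (HahnSeries.C ((((-eps (basisVec k) (basisVec j) : ℤˣ) : ℤ) : Fn ℓ) /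
          algebraMap (FPS ℓ) (Fn ℓ) (τ β)) *
      (zPow (delta j k - 1) * shifted 1 k (τ (β - root j k))))

lemma waveSymbol_adjDressing (τ : rootLattice ℓ → FPS ℓ) (β : rootLattice ℓ) (j k : Fin ℓ) :
    (adjDressing τ β j k).waveSymbol (-1) =
      HahnSeries.C ((((-eps (basisVec k) (basisVec j) : ℤˣ) : ℤ) : Fn ℓ) /
          algebraMap (FPS ℓ) (Fn ℓ) (τ β)) *
        (zPow (delta j k - 1) * shifted 1 k (τ (β - root j k))) :=
  PDO.waveSymbol_ofSymbol _ _

lemma isMonic_adjDressing (τ : rootLattice ℓ → FPS ℓ) (β : rootLattice ℓ) (h : τ β ≠ 0) :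
    IsMonic (adjDressing τ β) := by
  have h' : algebraMap (FPS ℓ) (Fn ℓ) (τ β) ≠ 0 := by simpa using h
  refine isMonic_of_coeff_waveSymbol (-1) fun i j n hn => ?_
  rw [waveSymbol_adjDressing, coeff_const_mul, coeff_zero_zPow_mul_shifted _ _ _ _ _ hn]
  split_ifs with h0
  · rw [← h0.1, eps_basisVec_self, root_self, sub_zero]
    rw [neg_neg, Units.val_one, Int.cast_one, one_div_mul_cancel h']
  · rw [mul_zero]

/-- `z^m Λ_γ(z)` as an operator: the diagonal matrix with entries `ε(v_k, γ) ∂^{(v_k|γ) + m}`. -/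
noncomputable def latticeOp (m : ℕ) (γ : rootLattice ℓ) : MatPDO ℓ := Matrix.diagonal fun k =>
  ((eps (basisVec k) γ : ℤˣ) : ℤ) • PDO.monomial (del ℓ) 1 (form (basisVec k) γ + m)

lemma latticeOp_zero (m : ℕ) : latticeOp m (0 : rootLattice ℓ) = delPow m := by
  rw [latticeOp, delPow]
  congr 1
  funext k
  rw [form_basisVec]
  simp [eps]

lemma waveSymbol_mul_latticeOp (A : MatPDO ℓ) (m : ℕ) (γ : rootLattice ℓ) (r k : Fin ℓ) :
    ((A * latticeOp m γ) r k).waveSymbol 1 =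
      (((eps (basisVec k) γ : ℤˣ) : ℤ) : LaurentSeries (Fn ℓ)) *
        (zPow (form (basisVec k) γ + m) * (A r k).waveSymbol 1) := by
  rw [latticeOp, Matrix.mul_diagonal, ← waveSymbol_mul_del]
  rcases Int.units_eq_one_or (eps (basisVec k) γ) with h | h
  · rw [h]
    simp
  · rw [h]
    simp only [Units.val_neg, Units.val_one, neg_smul, one_smul, mul_neg, Int.cast_neg,
      Int.cast_one, ← PDO.waveSymbolHom_apply, map_neg]
    ring

lemma zPow_add (a b : ℤ) : (zPow (a + b) : LaurentSeries (Fn ℓ)) = zPow a * zPow b := by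
  rw [zPow, zPow, zPow, HahnSeries.single_mul_single, one_mul, neg_add]

lemma bilinearResidue_apply (τ : rootLattice ℓ → FPS ℓ) (m : ℕ) (α β : rootLattice ℓ)
    (i j : Fin ℓ) : bilinearResidue τ m α β i j =
      pairing (dressing τ α * latticeOp m (α - β))
        (Ring.inverse (adjointM (dressing τ β))) i j := by
  have h : ∀ M : Matrix (Fin ℓ) (Fin ℓ) (TwoPoint ℓ),
      (((atLeft (zPow m) : TwoPoint ℓ) • M).map twoPointRes) i j =
        twoPointRes (atLeft (zPow m) * M i j) :=
    fun M => by rw [Matrix.map_apply, Matrix.smul_apply, smul_eq_mul]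
  refine (h _).trans ?_
  rw [pairing, Matrix.mul_apply, Finset.mul_sum]
  refine congrArg twoPointRes (Finset.sum_congr rfl fun k _ => ?_)
  rw [waveSymbol_mul_latticeOp, expXiM, lambdaM, Matrix.mul_diagonal, Matrix.mul_diagonal,
    Matrix.transpose_apply, Matrix.map_apply, Matrix.map_apply, zPow_add]
  have key : ∀ (a b c d : LaurentSeries (Fn ℓ)) (e r : TwoPoint ℓ),
      atLeft a * (atLeft b * e * atLeft (c * d) * r) = atLeft (c * (d * a * b)) * (e * r) := by
    intro a b c d e r
    rw [atLeft_mul c d, atLeft_mul c, atLeft_mul, atLeft_mul]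
    ring
  exact key _ _ _ _ _ _

lemma intCast_C (n : ℤ) : (HahnSeries.C ((n : Fn ℓ)) : LaurentSeries (Fn ℓ)) = n :=
  map_intCast HahnSeries.C n

lemma atRight_units_mul (u : ℤˣ) (F : LaurentSeries (Fn ℓ)) :
    atRight (((u : ℤ) : LaurentSeries (Fn ℓ)) * F) = ((u : ℤ) : TwoPoint ℓ) * atRight F := by
  rcases Int.units_eq_one_or u with h | h
  · rw [h]
    simp
  · rw [h, show (((-1 : ℤˣ) : ℤ) : LaurentSeries (Fn ℓ)) * F = -F by push_cast; ring,
      ← atRightHom_apply, map_neg]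
    push_cast
    rw [atRightHom_apply]
    ring

lemma atLeft_intCast (n : ℤ) : atLeft (n : LaurentSeries (Fn ℓ)) = (n : TwoPoint ℓ) :=
  map_intCast C n

lemma twoPointRes_units_mul (u : ℤˣ) (F : TwoPoint ℓ) :
    twoPointRes (((u : ℤ) : TwoPoint ℓ) * F) =
      ((u : ℤ) : MvPowerSeries (Var ℓ) (Fn ℓ)) * twoPointRes F := by
  rcases Int.units_eq_one_or u with h | h
  · rw [h]
    simp
  · rw [h, show (((-1 : ℤˣ) : ℤ) : TwoPoint ℓ) * F = -F by push_cast; ring,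
      ← twoPointResHom_apply, map_neg]
    push_cast
    rw [twoPointResHom_apply]
    ring

/-- The bilinear equations are, up to the invertible factor `τ_α(x) τ_β(x')`, residues of wave
functions. -/
lemma hirota_eq_pairing (τ : rootLattice ℓ → FPS ℓ) (m : ℕ) {α β : rootLattice ℓ} (hα : τ α ≠ 0)
    (hβ : τ β ≠ 0) (i j : Fin ℓ) : hirota τ m α β i j =
      C (algebraMap (FPS ℓ) (Fn ℓ) (τ α)) * (taylor (algebraMap (FPS ℓ) (Fn ℓ) (τ β)) *
        pairing (dressing τ α * latticeOp m (α - β)) (adjDressing τ β) i j) := by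
  have hα' : algebraMap (FPS ℓ) (Fn ℓ) (τ α) ≠ 0 := by simpa using hα
  have hβ' : algebraMap (FPS ℓ) (Fn ℓ) (τ β) ≠ 0 := by simpa using hβ
  rw [hirota, pairing_eq_sum, Finset.mul_sum, Finset.mul_sum]
  refine Finset.sum_congr rfl fun k _ => ?_
  rw [← twoPointRes_units_mul, ← twoPointRes_map_C_mul, ← twoPointRes_map_C_mul]
  congr 1
  have hR : MvPowerSeries.map HahnSeries.C (taylor (algebraMap (FPS ℓ) (Fn ℓ) (τ β))) *
      atRight ((adjDressing τ β j k).waveSymbol (-1)) =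
      (((-eps (basisVec k) (basisVec j) : ℤˣ) : ℤ) : TwoPoint ℓ) * (atLeft (zPow (delta j k - 1)) *
        atRight (shifted 1 k (τ (β - root j k)))) := by
    rw [← atRight_C_mul, waveSymbol_adjDressing, ← mul_assoc, ← map_mul, mul_div_cancel₀ _ hβ',
      intCast_C, ← atRight_zPow_mul, atRight_units_mul]
  have hL : MvPowerSeries.map HahnSeries.C (C (algebraMap (FPS ℓ) (Fn ℓ) (τ α))) *
      atLeft (((dressing τ α * latticeOp m (α - β)) i k).waveSymbol 1) =
      (((-eps (basisVec k) (basisVec i) : ℤˣ) : ℤ) : TwoPoint ℓ) *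
      (((eps (basisVec k) ((α - β : rootLattice ℓ) : Fin ℓ → ℤ) : ℤˣ) : ℤ) : TwoPoint ℓ) *
      (atLeft (zPow (form (basisVec k) ((α - β : rootLattice ℓ) : Fin ℓ → ℤ) + m) *
        zPow (delta i k - 1)) * atLeft (shifted (-1) k (τ (α + root i k)))) := by
    rw [← atLeft_C, waveSymbol_mul_latticeOp, waveSymbol_dressing, ← atLeft_mul, ← atLeft_mul,
      ← atLeft_intCast, ← atLeft_intCast]
    have : HahnSeries.C (algebraMap (FPS ℓ) (Fn ℓ) (τ α)) *
        HahnSeries.C ((((-eps (basisVec k) (basisVec i) : ℤˣ) : ℤ) : Fn ℓ) /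
          algebraMap (FPS ℓ) (Fn ℓ) (τ α)) =
        (((-eps (basisVec k) (basisVec i) : ℤˣ) : ℤ) : LaurentSeries (Fn ℓ)) := by
      rw [← map_mul, mul_div_cancel₀ _ hα', intCast_C]
    rw [← atLeft_mul, ← atLeft_mul, ← this]
    congr 1
    ring
  have hexp :
      form (basisVec k) ((α : Fin ℓ → ℤ) - (β : Fin ℓ → ℤ)) + m - 2 + delta i k + delta j k =
      (form (basisVec k) ((α - β : rootLattice ℓ) : Fin ℓ → ℤ) + m) + (delta i k - 1) +
        (delta j k - 1) := by
    rw [AddSubgroup.coe_sub]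
    ring
  have heps : eps (basisVec k) ((α : Fin ℓ → ℤ) - (β : Fin ℓ → ℤ) + basisVec i + basisVec j) =
      -eps (basisVec k) (basisVec i) * eps (basisVec k) ((α - β : rootLattice ℓ) : Fin ℓ → ℤ) *
        -eps (basisVec k) (basisVec j) := by
    rw [eps_add_right, eps_add_right, AddSubgroup.coe_sub, mul_neg, neg_mul, neg_mul, neg_neg,
      mul_comm (eps _ (basisVec i))]
  rw [show ∀ a b c d e : TwoPoint ℓ, a * (b * (c * (d * e))) = d * (a * c) * (b * e) from
    fun a b c d e => by ring, hR, hL, hexp, heps, zPow_add _ (delta j k - 1),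
    zPow_add _ (delta i k - 1)]
  simp only [atLeft_mul, Units.val_mul, Int.cast_mul]
  ring

lemma twoPointRes_zero : twoPointRes (0 : TwoPoint ℓ) = 0 := rfl

/-- The bilinear equation depends on `α, i` and `β, j` only through `α + v_i` and `β - v_j`. -/
lemma hirota_eq_hirota (τ : rootLattice ℓ → FPS ℓ) (m : ℕ) (α β : rootLattice ℓ)
    (i j i' j' : Fin ℓ) : hirota τ m α β i j =
      hirota τ m (α + root i i') (β - root j j') i' j' := by
  rw [hirota, hirota]
  refine Finset.sum_congr rfl fun k _ => ?_
  have h1 : α + root i i' + root i' k = α + root i k := by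
    ext l
    simp [root]
    ring
  have h2 : β - root j j' - root j' k = β - root j k := by
    ext l
    simp [root]
    ring
  have h3 : (((α + root i i' : rootLattice ℓ) : Fin ℓ → ℤ) -
      ((β - root j j' : rootLattice ℓ) : Fin ℓ → ℤ)) + basisVec i' + basisVec j' =
      (α : Fin ℓ → ℤ) - (β : Fin ℓ → ℤ) + basisVec i + basisVec j := by
    rw [AddSubgroup.coe_add, AddSubgroup.coe_sub, coe_root, coe_root]
    ring
  have h4 : form (basisVec k) (((α + root i i' : rootLattice ℓ) : Fin ℓ → ℤ) -
      ((β - root j j' : rootLattice ℓ) : Fin ℓ → ℤ)) + m - 2 + delta i' k + delta j' k =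
      form (basisVec k) ((α : Fin ℓ → ℤ) - (β : Fin ℓ → ℤ)) + m - 2 + delta i k + delta j k := by
    have hd : ∀ a : Fin ℓ, basisVec a k = delta a k := fun a => by
      rw [basisVec, delta, Pi.single_apply]
      exact if_congr eq_comm rfl rfl
    have := congrFun h3 k
    simp only [Pi.add_apply, hd] at this
    rw [form_basisVec, form_basisVec]
    omega
  rw [h1, h2, h3, h4]

lemma hirota_eq_zero_of_left (τ : rootLattice ℓ → FPS ℓ) (m : ℕ) (α β : rootLattice ℓ) (i j : Fin ℓ)
    (h : ∀ k, τ (α + root i k) = 0) : hirota τ m α β i j = 0 := by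
  rw [hirota]
  refine Finset.sum_eq_zero fun k _ => ?_
  rw [h, shifted_zero, show atLeft (0 : LaurentSeries (Fn ℓ)) = 0 from map_zero C, mul_zero,
    zero_mul, twoPointRes_zero, mul_zero]

lemma hirota_eq_zero_of_right (τ : rootLattice ℓ → FPS ℓ) (m : ℕ) (α β : rootLattice ℓ)
    (i j : Fin ℓ) (h : ∀ k, τ (β - root j k) = 0) : hirota τ m α β i j = 0 := by
  rw [hirota]
  refine Finset.sum_eq_zero fun k _ => ?_
  rw [h, shifted_zero, ← atRightHom_apply, map_zero, mul_zero, twoPointRes_zero, mul_zero]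

/-- It suffices to check the bilinear equations at `α, β` with `τ_α, τ_β ≠ 0`. -/
lemma satisfiesHirota_iff (τ : rootLattice ℓ → FPS ℓ) : SatisfiesHirota τ ↔
    ∀ (m : ℕ) (α β : rootLattice ℓ), τ α ≠ 0 → τ β ≠ 0 → ∀ i j,
      pairing (dressing τ α * latticeOp m (α - β)) (adjDressing τ β) i j = 0 := by
  constructor
  · intro h m α β hα hβ i j
    have h1 := h m α β i j
    rw [hirota_eq_pairing τ m hα hβ] at h1
    have h2 : C (σ := Var ℓ) (algebraMap (FPS ℓ) (Fn ℓ) (τ α)) ≠ 0 := by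
      rw [map_ne_zero_iff C (C_injective)]
      simpa using hα
    have h3 : taylor (algebraMap (FPS ℓ) (Fn ℓ) (τ β)) ≠ 0 := taylor_ne_zero (by simpa using hβ)
    have nzd : NoZeroDivisors (MvPowerSeries (Var ℓ) (Fn ℓ)) := inferInstance
    exact (mul_eq_zero.1 ((mul_eq_zero.1 h1).resolve_left h2)).resolve_left h3
  · intro h m α β i j
    by_cases hα : ∀ k, τ (α + root i k) = 0
    · exact hirota_eq_zero_of_left τ m α β i j hα
    by_cases hβ : ∀ k, τ (β - root j k) = 0
    · exact hirota_eq_zero_of_right τ m α β i j hβ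
    push Not at hα hβ
    obtain ⟨i', hi⟩ := hα
    obtain ⟨j', hj⟩ := hβ
    rw [hirota_eq_hirota τ m α β i j i' j', hirota_eq_pairing τ m hi hj, h m _ _ hi hj, mul_zero,
      mul_zero]

end AffineSL

namespace FormalFunction

/-! ### Uniqueness for twisted sums -/

open Finset.HasAntidiagonal (antidiagonal mem_antidiagonal)

section

variable {A : Type*} [AddCommGroup A] [Module ℂ A]

/-- A sequence is determined by its twisted sums `∑_{a + b = n} flow_b (g_a)`. -/
lemma eq_of_sum_flow_eq (d : ℕ → A →+ A) {g h : ℕ → A}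
    (e : ∀ n, ∑ x ∈ antidiagonal n, flow d x.2 (g x.1) = ∑ x ∈ antidiagonal n, flow d x.2 (h x.1))
    (n : ℕ) : g n = h n := by
  induction n using Nat.strong_induction_on with
  | _ n ih =>
    have hmem : (n, 0) ∈ antidiagonal n := mem_antidiagonal.2 (add_zero n)
    have e' := e n
    have hlt : ∑ x ∈ (antidiagonal n).erase (n, 0), flow d x.2 (g x.1) =
        ∑ x ∈ (antidiagonal n).erase (n, 0), flow d x.2 (h x.1) := by
      refine Finset.sum_congr rfl fun x hx => ?_
      obtain ⟨a, b⟩ := x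
      rw [Finset.mem_erase, mem_antidiagonal, Ne, Prod.mk.injEq] at hx
      rw [ih a (by have := hx.2; omega)]
    rw [← Finset.add_sum_erase _ _ hmem, ← Finset.add_sum_erase _ _ hmem, hlt] at e'
    simpa using add_right_cancel e'

end

/-- If `t F_n = flow_n t`, then multiplication by `t` turns the product of `∑ F_n` with the flow of
`∑ G_n` into the flow of `∑ t G_n`. -/
lemma mul_sum_flow {A : Type*} [CommRing A] [Algebra ℂ A] (d : ℕ → A →+ A)
    (hd : ∀ p f g, d p (f * g) = d p f * g + f * d p g) {t : A} {F : ℕ → A}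
    (hF : ∀ n, t * F n = flow d n t) (G : ℕ → A) (n : ℕ) :
    t * ∑ x ∈ antidiagonal n, ∑ y ∈ antidiagonal x.1, F y.1 * flow d x.2 (G y.2) =
      ∑ x ∈ antidiagonal n, flow d x.2 (t * G x.1) := by
  simp only [flow_mul d hd]
  rw [← sum_antidiagonal_assoc n fun b a c => flow d a t * flow d c (G b), Finset.mul_sum]
  refine Finset.sum_congr rfl fun x _ => ?_
  rw [Finset.mul_sum, ← Finset.Nat.sum_antidiagonal_swap]
  refine Finset.sum_congr rfl fun y _ => ?_
  rw [← mul_assoc, Prod.fst_swap, hF, Prod.snd_swap]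

end FormalFunction

namespace AffineSL

open Finset.HasAntidiagonal (antidiagonal mem_antidiagonal)
open MvPowerSeries FormalFunction

variable {ℓ : ℕ}

/-! ### The dual dressing operator -/

lemma negM_mul_adjointM_eq_zero {A B : MatPDO ℓ} (h : ∀ r s, pairing A B r s = 0) :
    negM (A * adjointM B) = 0 := by
  -- the zero operators also pair to zero
  have h0 : ∀ r s : Fin ℓ, pairing (0 : MatPDO ℓ) 0 r s = 0 := by
    intro r s
    rw [pairing_eq_sum]
    refine Finset.sum_eq_zero fun k _ => ?_
    rw [Matrix.zero_apply, ← PDO.waveSymbolHom_apply, map_zero,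
      show atLeft (0 : LaurentSeries (Fn ℓ)) = 0 from map_zero C, zero_mul, twoPointRes_zero]
  rw [negM_eq_of_pairing fun r s => (h r s).trans (h0 r s).symm, zero_mul, negM_zero]

/-- The bilinear identity for `P` and `N` says that `P N^*` has no negative part, so it is `1`. -/
lemma eq_inverse_adjointM_of_pairing {P N : MatPDO ℓ} (hP : IsMonic P) (hN : IsMonic N)
    (h : ∀ r s, pairing P N r s = 0) : N = Ring.inverse (adjointM P) := by
  have h1 := eq_one_of_negM_eq_zero (negM_mul_adjointM_eq_zero h) (hP.mul hN.adjointM)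
  have h2 := congrArg adjointM h1
  rw [adjointM_mul, adjointM_adjointM, adjointM_one] at h2
  have h3 := isUnit_adjointM hP.isUnit
  rw [← h3.mul_left_inj, h2, Ring.inverse_mul_cancel _ h3]

lemma shiftDer_comm (k : Fin ℓ) (p q : ℕ) (f : Fn ℓ) :
    shiftDer k p (shiftDer k q f) = shiftDer k q (shiftDer k p f) := partialDeriv_comm _ _ f

lemma neg_shiftDer_mul (k : Fin ℓ) (p : ℕ) (f g : Fn ℓ) :
    (-shiftDer k p) (f * g) = (-shiftDer k p) f * g + f * (-shiftDer k p) g := by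
  have : shiftDer k p (f * g) = f * shiftDer k p g + g * shiftDer k p f :=
    Derivation.leibniz (partialDeriv _) f g
  rw [AddMonoidHom.neg_apply, AddMonoidHom.neg_apply, AddMonoidHom.neg_apply, this]
  ring

lemma flow_neg_shiftDer_ite (k : Fin ℓ) (n : ℕ) (p : Prop) [Decidable p] :
    flow (fun q => -shiftDer k q) n (if p then 1 else 0) = if p ∧ n = 0 then 1 else 0 := by
  by_cases hp : p
  · by_cases hn : n = 0
    · simp [hp, hn]
    · rw [if_pos hp, if_neg (fun h => hn h.2), flow_one _ _ n hn]
      intro q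
      have : shiftDer k q 1 = 0 := Derivation.map_one_eq_zero (partialDeriv _)
      rw [AddMonoidHom.neg_apply, this, neg_zero]
  · rw [if_neg hp, if_neg (fun h => hp h.1), map_zero]

/-- For monic `P` and `Q`, the bilinear identity at `x' = x - [t]^{(i)}` computes the product of
`(P_ii)(x, t⁻¹)` and `Q_si(x - [t]^{(i)}, t⁻¹)`. -/
lemma sum_flow_of_pairing {P Q : MatPDO ℓ} (hP : IsMonic P) (hQ : IsMonic Q) {i s : Fin ℓ}
    (h : pairing P Q i s = 0) (n : ℕ) :
    ∑ x ∈ antidiagonal n, ∑ y ∈ antidiagonal x.1, ((P i i).waveSymbol 1).coeff y.1 *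
        flow (fun p => -shiftDer i p) x.2 (((Q s i).waveSymbol (-1)).coeff y.2) =
      if s = i then if n = 0 then 1 else 0
      else if n = 1 then -((P i s).waveSymbol 1).coeff 1 else 0 := by
  have hneg : ∀ {M : MatPDO ℓ}, IsMonic M → ∀ (u : ℤˣ) (a b : Fin ℓ) (m : ℤ), m < 0 →
      ((M a b).waveSymbol u).coeff m = 0 := by
    intro M hM u a b m hm
    rw [hM.coeff_waveSymbol u a b m hm.le, if_neg (by omega)]
  have hc : ∀ (k : Fin ℓ) (m b : ℕ), ((P i k).waveSymbol 1 *
      laurentFlow i b ((Q s k).waveSymbol (-1))).coeff m =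
      ∑ y ∈ antidiagonal m, ((P i k).waveSymbol 1).coeff y.1 *
        flow (fun p => -shiftDer i p) b (((Q s k).waveSymbol (-1)).coeff y.2) := by
    intro k m b
    rw [coeff_mul_of_nonneg (hneg hP _ _ _) fun m hm => by
      rw [coeff_laurentFlow, hneg hQ _ _ _ _ hm, map_zero]]
    simp only [coeff_laurentFlow]
  have h00 : ((P i i).waveSymbol 1).coeff (0 : ℕ) = 1 := by
    rw [hP.coeff_waveSymbol _ _ _ _ (by simp), if_pos ⟨rfl, by simp⟩]
  have hQ0 : ∀ (k : Fin ℓ), ((Q s k).waveSymbol (-1)).coeff (0 : ℕ) = if s = k then 1 else 0 := by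
    intro k
    rw [hQ.coeff_waveSymbol _ _ _ _ (by simp)]
    exact if_congr (by simp) rfl rfl
  cases n with
  | zero =>
    simp only [Finset.Nat.antidiagonal_zero, Finset.sum_singleton, flow_zero]
    rw [h00, hQ0, one_mul]
    simp
  | succ n =>
    have h2 := pairing_eq_zero_at_shift h i n
    -- the term with index `(0, n + 1)`, which the bilinear identity does not contain, vanishes
    rw [Finset.Nat.sum_antidiagonal_succ]
    simp only [Finset.Nat.antidiagonal_zero, Finset.sum_singleton]
    rw [h00, hQ0, one_mul, flow_neg_shiftDer_ite, if_neg (by omega), zero_add]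
    rw [← Finset.add_sum_erase _ _ (Finset.mem_univ i), if_pos rfl] at h2
    simp only [hc] at h2
    rw [eq_neg_of_add_eq_zero_left h2]
    -- for `k ≠ i` only the product of the leading terms contributes
    have h3 : ∀ k ∈ Finset.univ.erase i, (if k = i then
        ∑ x ∈ antidiagonal n, ∑ y ∈ antidiagonal (x.1 + 1), ((P i k).waveSymbol 1).coeff y.1 *
          flow (fun p => -shiftDer i p) x.2 (((Q s k).waveSymbol (-1)).coeff y.2)
        else ((P i k).waveSymbol 1 * laurentFlow i n ((Q s k).waveSymbol (-1))).coeff 1) =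
        if s = k then (if n = 0 then ((P i s).waveSymbol 1).coeff 1 else 0) else 0 := by
      intro k hk
      rw [if_neg (Finset.ne_of_mem_erase hk)]
      have := hc k 1 n
      rw [Nat.cast_one] at this
      rw [this, Finset.Nat.sum_antidiagonal_succ]
      simp only [Finset.Nat.antidiagonal_zero, Finset.sum_singleton]
      rw [hP.coeff_waveSymbol 1 i k (0 : ℕ) (by simp), if_neg (fun h =>
        Finset.ne_of_mem_erase hk h.1.symm), zero_mul, zero_add, hQ0, flow_neg_shiftDer_ite]
      by_cases hs : s = k
      · by_cases hn : n = 0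
        · simp [hs, hn]
        · simp [hs, hn]
      · simp [hs]
    rw [Finset.sum_congr rfl h3, Finset.sum_ite_eq]
    by_cases hs : s = i
    · simp [hs]
    · by_cases hn : n = 0 <;> simp [hs, hn]

/-- A monic operator that pairs to zero with `P_β` is given by shifted tau functions. -/
lemma eq_adjDressing_of_pairing (τ : rootLattice ℓ → FPS ℓ) (β : rootLattice ℓ) (hβ : τ β ≠ 0)
    {Q : MatPDO ℓ} (hQ : IsMonic Q) (h : ∀ r s, pairing (dressing τ β) Q r s = 0) :
    Q = adjDressing τ β := by
  have hP := isMonic_dressing τ β hβ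
  have hN := isMonic_adjDressing τ β hβ
  set t : Fn ℓ := algebraMap (FPS ℓ) (Fn ℓ) (τ β) with ht
  have ht0 : t ≠ 0 := by simpa [ht] using hβ
  ext1 s i
  apply PDO.waveSymbol_injective (-1)
  have hF : ∀ n : ℕ, t * ((dressing τ β i i).waveSymbol 1).coeff n =
      flow (fun p => -shiftDer i p) n t := by
    intro n
    rw [waveSymbol_dressing, coeff_const_mul, eps_basisVec_self, root_self, add_zero,
      coeff_zPow_mul, delta, if_pos rfl, sub_self, add_zero, coeff_shifted_neg_one, ← ht, neg_neg,
      Units.val_one, Int.cast_one, ← mul_assoc, mul_one_div_cancel ht0, one_mul]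
  -- both entries have the same twisted sums after multiplication by `τ_β`
  have hsum := fun n => (mul_sum_flow _ (neg_shiftDer_mul i) hF
    (fun m => ((Q s i).waveSymbol (-1)).coeff m) n).symm.trans
      (congrArg (t * ·) (sum_flow_of_pairing hP hQ (h i s) n))
  have key : ∀ n : ℕ, t * ((Q s i).waveSymbol (-1)).coeff n =
      t * ((adjDressing τ β s i).waveSymbol (-1)).coeff n := by
    refine eq_of_sum_flow_eq _ fun n => (hsum n).trans ?_
    by_cases hs : s = i
    · subst hs
      have hg : ∀ m : ℕ, t * ((adjDressing τ β s s).waveSymbol (-1)).coeff m =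
          flow (shiftDer s) m t := by
        intro m
        rw [waveSymbol_adjDressing, coeff_const_mul, eps_basisVec_self, root_self, sub_zero,
          coeff_zPow_mul, delta, if_pos rfl, sub_self, add_zero, coeff_shifted_one, ← ht, neg_neg,
          Units.val_one, Int.cast_one, ← mul_assoc, mul_one_div_cancel ht0, one_mul]
      simp only [hg]
      have h2 := sum_flow_neg_flow (shiftDer s) (shiftDer_comm s) n t
      rw [← Finset.Nat.sum_antidiagonal_swap] at h2
      simp only [Prod.fst_swap, Prod.snd_swap] at h2
      rw [h2]
      simp
    · have hroot : β - root s i = β + root i s := by rw [← root_neg i s, sub_neg_eq_add]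
      have hg : ∀ m : ℕ, t * ((adjDressing τ β s i).waveSymbol (-1)).coeff (m + 1 : ℕ) =
          ((eps (basisVec s) (basisVec i) : ℤˣ) : ℤ) *
            flow (shiftDer i) m (algebraMap (FPS ℓ) (Fn ℓ) (τ (β + root i s))) := by
        intro m
        rw [waveSymbol_adjDressing, coeff_const_mul, coeff_zPow_mul, delta, if_neg hs, hroot,
          show ((m + 1 : ℕ) : ℤ) + (0 - 1) = m by push_cast; ring, coeff_shifted_one, ← ht,
          ← eps_basisVec_swap hs, ← mul_assoc, mul_div_cancel₀ _ ht0]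
      have hP1 : t * ((dressing τ β i s).waveSymbol 1).coeff 1 =
          -(((eps (basisVec s) (basisVec i) : ℤˣ) : ℤ) *
            algebraMap (FPS ℓ) (Fn ℓ) (τ (β + root i s))) := by
        rw [waveSymbol_dressing, coeff_const_mul, coeff_zPow_mul, delta, if_neg (Ne.symm hs),
          show (1 : ℤ) + (0 - 1) = 0 by ring, coeff_zero_shifted, ← ht, ← mul_assoc,
          mul_div_cancel₀ _ ht0, Units.val_neg, Int.cast_neg, neg_mul]
      have hN0 : ((adjDressing τ β s i).waveSymbol (-1)).coeff (0 : ℕ) = 0 := by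
        rw [hN.coeff_waveSymbol _ _ _ _ (by simp), if_neg (fun h => hs h.1)]
      rw [if_neg hs]
      cases n with
      | zero =>
        simp only [Finset.Nat.antidiagonal_zero, Finset.sum_singleton, flow_zero]
        rw [hN0, if_neg (by omega)]
      | succ n =>
        rw [Finset.Nat.sum_antidiagonal_succ]
        simp only [hg]
        rw [hN0, mul_zero, map_zero,
          zero_add]
        have h2 := sum_flow_neg_flow (shiftDer i) (shiftDer_comm i) n
          (algebraMap (FPS ℓ) (Fn ℓ) (τ (β + root i s)))
        rw [← Finset.Nat.sum_antidiagonal_swap] at h2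
        simp only [Prod.fst_swap, Prod.snd_swap] at h2
        have h3 : ∀ (b : ℕ) (f : Fn ℓ), flow (fun p => -shiftDer i p) b
            ((((eps (basisVec s) (basisVec i) : ℤˣ) : ℤ) : Fn ℓ) * f) =
            (((eps (basisVec s) (basisVec i) : ℤˣ) : ℤ) : Fn ℓ) *
              flow (fun p => -shiftDer i p) b f := by
          intro b f
          rcases Int.units_eq_one_or (eps (basisVec s) (basisVec i)) with h | h <;> simp [h]
        simp only [h3]
        rw [← Finset.mul_sum, h2]
        by_cases hn : n = 0
        · rw [if_pos (by omega), if_pos hn, mul_neg, hP1, neg_neg]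
        · rw [if_neg (by omega), if_neg hn, mul_zero, mul_zero]
  ext m
  by_cases hm : m < 0
  · rw [hQ.coeff_waveSymbol _ _ _ _ hm.le, hN.coeff_waveSymbol _ _ _ _ hm.le]
  · obtain ⟨n, rfl⟩ := Int.eq_ofNat_of_zero_le (not_lt.1 hm)
    exact mul_left_cancel₀ ht0 (key n)

end AffineSL

namespace AffineSL

open MvPowerSeries FormalFunction

variable {ℓ : ℕ}

/-! ### Sato–Wilson and Lax equations -/

lemma partialDeriv_del (p : Var ℓ) (f : Fn ℓ) :
    partialDeriv p (del ℓ f) = del ℓ (partialDeriv p f) := by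
  rw [del_apply, del_apply, map_sum]
  exact Finset.sum_congr rfl fun i _ => partialDeriv_comm _ _ f

lemma derivM_mul (i : Fin ℓ) (k : ℕ+) (P Q : MatPDO ℓ) :
    derivM i k (P * Q) = derivM i k P * Q + P * derivM i k Q := by
  ext1 r s
  simp only [derivM, Matrix.map_apply, Matrix.mul_apply, Matrix.add_apply, PDO.deriveCoeffs_sum,
    PDO.deriveCoeffs_mul _ (partialDeriv_del (i, k)), Finset.sum_add_distrib]

lemma derivM_adjointM (i : Fin ℓ) (k : ℕ+) (P : MatPDO ℓ) :
    derivM i k (adjointM P) = adjointM (derivM i k P) := by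
  ext1 r s
  simp only [derivM, adjointM, Matrix.map_apply, Matrix.transpose_apply,
    PDO.deriveCoeffs_adjoint _ (partialDeriv_del (i, k))]

lemma MatOrderLE.derivM {P : MatPDO ℓ} {N : ℤ} (h : MatOrderLE P N) (i : Fin ℓ) (k : ℕ+) :
    MatOrderLE (derivM i k P) N := fun r s => (h r s).deriveCoeffs _

lemma deriveCoeffs_monomial_one (p : Var ℓ) (n : ℤ) :
    (PDO.monomial (del ℓ) 1 n).deriveCoeffs (partialDeriv p) = 0 := by
  ext m
  rw [PDO.coeff_deriveCoeffs, PDO.coeff_monomial]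
  split_ifs
  · exact Derivation.map_one_eq_zero _
  · exact map_zero _

lemma deriveCoeffs_zero (p : Var ℓ) : (0 : PDO (del ℓ)).deriveCoeffs (partialDeriv p) = 0 := by
  ext m
  exact map_zero _

lemma derivM_delPow (i : Fin ℓ) (k : ℕ+) (n : ℕ) : derivM i k (delPow n : MatPDO ℓ) = 0 := by
  ext1 r s
  rw [derivM, Matrix.map_apply, delPow, Matrix.diagonal_apply]
  split_ifs
  · exact deriveCoeffs_monomial_one _ _
  · exact deriveCoeffs_zero _

lemma derivM_unitE (i : Fin ℓ) (k : ℕ+) (j : Fin ℓ) : derivM i k (unitE j : MatPDO ℓ) = 0 := by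
  ext1 r s
  rw [derivM, Matrix.map_apply, unitE, Matrix.single_apply]
  split_ifs
  · exact deriveCoeffs_monomial_one _ 0
  · exact deriveCoeffs_zero _

lemma derivM_one (i : Fin ℓ) (k : ℕ+) : derivM i k (1 : MatPDO ℓ) = 0 := by
  rw [← delPow_zero, derivM_delPow]

lemma IsMonic.derivM {P : MatPDO ℓ} (h : IsMonic P) (i : Fin ℓ) (k : ℕ+) :
    MatOrderLE (derivM i k P) (-1) := by
  have h1 := MatOrderLE.derivM h i k
  have h2 : AffineSL.derivM i k P = AffineSL.derivM i k (P - 1) := by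
    have h3 : AffineSL.derivM i k (P - 1 + 1) =
        AffineSL.derivM i k (P - 1) + AffineSL.derivM i k 1 := by
      ext1 r s
      exact PDO.deriveCoeffs_add _ _ _
    rwa [sub_add_cancel, derivM_one, add_zero] at h3
  rwa [h2]

lemma derivM_inverse {P : MatPDO ℓ} (h : IsUnit P) (i : Fin ℓ) (k : ℕ+) :
    P * derivM i k (Ring.inverse P) = -(derivM i k P * Ring.inverse P) := by
  have h1 := derivM_mul i k P (Ring.inverse P)
  rw [Ring.mul_inverse_cancel _ h, derivM_one] at h1
  exact (neg_eq_of_add_eq_zero_right h1.symm).symm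

/-- Differentiating the bilinear identity at `α = β`, `m = 0` gives the Sato–Wilson equation. -/
lemma derivM_eq_of_pairing {P : MatPDO ℓ} (hP : IsMonic P)
    (h : ∀ r s, pairing P (Ring.inverse (adjointM P)) r s = 0) (i : Fin ℓ) (k : ℕ+) :
    derivM i k P = -negM (P * unitE i * delPow k * Ring.inverse P) * P := by
  have h1 : ∀ r s, pairing P (derivM i k (Ring.inverse (adjointM P))) r s =
      pairing (P * unitE i * delPow k) (Ring.inverse (adjointM P)) r s := by
    intro r s
    have h2 := pderiv_pairing i k P (Ring.inverse (adjointM P)) r s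
    rw [h r s, map_zero] at h2
    exact (sub_eq_zero.1 h2.symm)
  have h3 := negM_eq_of_pairing h1
  rw [adjointM_inverse hP.isUnit, derivM_adjointM, adjointM_adjointM, adjointM_adjointM,
    derivM_inverse hP.isUnit, negM_neg, negM_eq_self (((hP.derivM i k).mul
      hP.inverse.matOrderLE).mono (by omega))] at h3
  rw [← h3, neg_neg, mul_assoc, Ring.inverse_mul_cancel _ hP.isUnit, mul_one]

lemma laxL_pow {P : MatPDO ℓ} (hP : IsUnit P) (k : ℕ) :
    laxL P ^ k = P * delPow k * Ring.inverse P := by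
  induction k with
  | zero => rw [pow_zero, delPow_zero, mul_one, Ring.mul_inverse_cancel _ hP]
  | succ k ih =>
    rw [pow_succ', ih, laxL, delPow_succ k]
    simp only [mul_assoc]
    rw [Ring.inverse_mul_cancel_left _ _ hP]

lemma laxL_pow_mul_laxC {P : MatPDO ℓ} (hP : IsUnit P) (k : ℕ) (i : Fin ℓ) :
    laxL P ^ k * laxC P i = P * unitE i * delPow k * Ring.inverse P := by
  rw [laxL_pow hP, laxC, mul_assoc P (unitE i) (delPow k), unitE_mul_delPow]
  simp only [mul_assoc]
  rw [Ring.inverse_mul_cancel_left _ _ hP]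

lemma delPow_add_comm (k : ℕ) : (delPow 1 * delPow k : MatPDO ℓ) = delPow k * delPow 1 := by
  rw [delPow_eq_pow k, ← pow_succ, ← pow_succ']

/-- The Sato–Wilson equation implies the Lax equation for every dressed operator `P X P⁻¹`, where
`X` is constant and commutes with `E_ii ∂ᵏ`. -/
lemma lax_equation {P X : MatPDO ℓ} (hP : IsUnit P) {i : Fin ℓ} {k : ℕ+}
    (h : derivM i k P = -negM (P * unitE i * delPow k * Ring.inverse P) * P)
    (hX : derivM i k X = 0) (hc : unitE i * delPow k * X = X * (unitE i * delPow k)) :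
    derivM i k (P * X * Ring.inverse P) =
      laxB P i k * (P * X * Ring.inverse P) - P * X * Ring.inverse P * laxB P i k := by
  have hinv : derivM i k (Ring.inverse P) =
      -(Ring.inverse P * derivM i k P * Ring.inverse P) := by
    rw [mul_assoc, ← mul_neg, ← derivM_inverse hP, Ring.inverse_mul_cancel_left _ _ hP]
  rw [derivM_mul, derivM_mul, hX, mul_zero, add_zero, hinv, laxB, laxL_pow_mul_laxC hP]
  set M := P * unitE i * delPow k * Ring.inverse P with hM
  -- `M` commutes with `P X P⁻¹`, so its positive part may be replaced by minus its negative part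
  have hcomm : M * (P * X * Ring.inverse P) = P * X * Ring.inverse P * M := by
    rw [hM]
    simp only [mul_assoc]
    rw [Ring.inverse_mul_cancel_left _ _ hP, Ring.inverse_mul_cancel_left _ _ hP]
    rw [← mul_assoc (unitE i), ← mul_assoc (unitE i * delPow k), hc]
    simp only [mul_assoc]
  rw [h, eq_sub_of_add_eq (posM_add_negM M), sub_mul, mul_sub, hcomm]
  simp only [mul_assoc, neg_mul, mul_neg, neg_neg]
  rw [Ring.mul_inverse_cancel _ hP, mul_one]
  abel

end AffineSL

theorem mainTheorem7 (ℓ : ℕ) (τ : AffineSL.rootLattice ℓ → AffineSL.FPS ℓ) :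
    (∀ α, τ α ≠ 0 →
      IsUnit (AffineSL.dressing τ α) ∧ IsUnit (AffineSL.adjointM (AffineSL.dressing τ α))) ∧
    (AffineSL.SatisfiesHirota τ ↔
      ∀ (m : ℕ) (α β : AffineSL.rootLattice ℓ), τ α ≠ 0 → τ β ≠ 0 →
        AffineSL.bilinearResidue τ m α β = 0) ∧
    (AffineSL.SatisfiesHirota τ → ∀ α, τ α ≠ 0 → ∀ P, P = AffineSL.dressing τ α →
      AffineSL.negM (P * AffineSL.delPow 1 * Ring.inverse P) = 0 ∧
      (∀ (i : Fin ℓ) (k : ℕ+), AffineSL.derivM i k P =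
        -AffineSL.negM (P * AffineSL.unitE i * AffineSL.delPow k * Ring.inverse P) * P) ∧
      (∀ (i : Fin ℓ) (k : ℕ+), AffineSL.derivM i k (AffineSL.laxL P) =
        AffineSL.laxB P i k * AffineSL.laxL P - AffineSL.laxL P * AffineSL.laxB P i k) ∧
      (∀ (i j : Fin ℓ) (k : ℕ+), AffineSL.derivM i k (AffineSL.laxC P j) =
        AffineSL.laxB P i k * AffineSL.laxC P j - AffineSL.laxC P j * AffineSL.laxB P i k)) := by
  have hmon := fun α h => AffineSL.isMonic_dressing τ α h
  -- the case `α = β`, `m = 0`, in which the factor `z^m Λ_{α-β}` is trivial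
  have hself : ∀ {R : AffineSL.rootLattice ℓ → AffineSL.MatPDO ℓ} {α : AffineSL.rootLattice ℓ},
      (∀ (m : ℕ) (α β : AffineSL.rootLattice ℓ), τ α ≠ 0 → τ β ≠ 0 → ∀ i j,
        AffineSL.pairing (AffineSL.dressing τ α * AffineSL.latticeOp m (α - β)) (R β) i j = 0) →
      τ α ≠ 0 → ∀ i j, AffineSL.pairing (AffineSL.dressing τ α) (R α) i j = 0 := by
    intro R α h hα i j
    have h0 := h 0 α α hα hα i j
    rwa [sub_self, AffineSL.latticeOp_zero, AffineSL.delPow_zero, mul_one] at h0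
  -- by either identity, the two operators paired with `P_α` agree
  have hiff : AffineSL.SatisfiesHirota τ ↔
      ∀ (m : ℕ) (α β : AffineSL.rootLattice ℓ), τ α ≠ 0 → τ β ≠ 0 → ∀ i j,
        AffineSL.pairing (AffineSL.dressing τ α * AffineSL.latticeOp m (α - β))
          (Ring.inverse (AffineSL.adjointM (AffineSL.dressing τ β))) i j = 0 := by
    rw [AffineSL.satisfiesHirota_iff]
    constructor
    · intro h m α β hα hβ i j
      rw [← AffineSL.eq_inverse_adjointM_of_pairing (hmon β hβ)
        (AffineSL.isMonic_adjDressing τ β hβ) (hself h hβ)]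
      exact h m α β hα hβ i j
    · intro h m α β hα hβ i j
      rw [← AffineSL.eq_adjDressing_of_pairing τ β hβ (hmon β hβ).adjointM.inverse
        (hself (R := fun β => Ring.inverse (AffineSL.adjointM (AffineSL.dressing τ β))) h hβ)]
      exact h m α β hα hβ i j
  refine ⟨fun α hα => ⟨(hmon α hα).isUnit, AffineSL.isUnit_adjointM (hmon α hα).isUnit⟩,
    hiff.trans ⟨fun h m α β hα hβ => ?_, fun h m α β hα hβ i j => ?_⟩, ?_⟩
  · ext1 i j
    rw [AffineSL.bilinearResidue_apply, h m α β hα hβ, Matrix.zero_apply]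
  · rw [← AffineSL.bilinearResidue_apply, h m α β hα hβ, Matrix.zero_apply]
  · rintro hH α hα P rfl
    have hP := (hmon α hα).isUnit
    have h := hiff.1 hH
    have hSW := AffineSL.derivM_eq_of_pairing (hmon α hα)
      (hself (R := fun β => Ring.inverse (AffineSL.adjointM (AffineSL.dressing τ β))) h hα)
    refine ⟨?_, hSW,
      fun i k => AffineSL.lax_equation hP (hSW i k) (AffineSL.derivM_delPow i k 1) ?_,
      fun i j k => AffineSL.lax_equation hP (hSW i k) (AffineSL.derivM_unitE i k j) ?_⟩
    · have h1 := fun r s => h 1 α α hα hα r s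
      simp only [sub_self, AffineSL.latticeOp_zero] at h1
      have h2 := AffineSL.negM_mul_adjointM_eq_zero h1
      rwa [AffineSL.adjointM_inverse hP, AffineSL.adjointM_adjointM] at h2
    · rw [mul_assoc, ← mul_assoc _ (AffineSL.unitE i), ← AffineSL.unitE_mul_delPow, mul_assoc,
        ← AffineSL.delPow_add_comm]
    · rw [mul_assoc, ← AffineSL.unitE_mul_delPow, ← mul_assoc, ← mul_assoc,
        AffineSL.unitE_mul_unitE_comm]
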